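/- Let $n\ge 4$, let $U\subseteq\mathbb{R}^n$ be open and connected, and let $\eta_{ab}=\mathrm{diag}(-1,1,\dots,1)$. Let $\mathcal H$ be a smooth, nowhere vanishing function on $U$ and $k_a$ a smooth, nowhere vanishing 1-form on $U$ with $\eta^{ab}k_ak_b=0$, and consider the Kerr–Schild metric $$g_{ab}=\eta_{ab}-2\mathcal H\,k_ak_b .$$ Assume that $g$ is a vacuum metric ($R_{ab}=0$ on $U$), that $g$ is not flat on $U$ (its Riemann tensor is nonzero at some point), and that the null congruence $k^a=\eta^{ab}k_b$ is expanding at every point of $U$: $\theta=L_{ii}/(n-2)\neq0$, where $L_{ij}=k_{a;b}\,m^{(i)a}m^{(j)b}$ in a null frame $(k,\boldsymbol n,m^{(i)})$, that is, a frame whose scalar products with respect to $g$ vanish except $k\cdot \boldsymbol n=1$, $m^{(i)}\cdot m^{(j)}=\delta_{ij}$ ($1\le i,j\le n-2$). Then at every point of $U$ the Weyl tensor of $g$ is of algebraic type II or D. That is: (i) there is a null frame $(\ell,\boldsymbol n,m^{(i)})$ in which all Weyl components of positive boost weight vanish; and (ii) there is no null frame in which all Weyl components of boost weight $\ge 0$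 vanish, so types III, N and O are excluded. (The boost weight of a frame component is the number of its indices along $\ell$ minus the number along $\boldsymbol n$. The type is D if, moreover, in some null frame only components of boost weight $0$ are nonzero, and II otherwise.) -/

import Mathlib

open scoped ContDiff

namespace KerrSchild

/-- Coordinate space `ℝⁿ`; also used for the components of a vector or of a covector. -/
abbrev Coord (n : ℕ) : Type := Fin n → ℝ

/-- A metric field given by its component matrix `g_ab(x)` in the coordinates of `ℝⁿ`. -/
abbrev MetricField (n : ℕ) : Type := Coord n → Matrix (Fin n) (Fin n) ℝ

/-- Components of a covariant tensor of rank four at a point. -/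
abbrev Tensor4 (n : ℕ) : Type := Fin n → Fin n → Fin n → Fin n → ℝ

/-- The partial derivative `∂_a f` at `x`. -/
noncomputable def partialD {n : ℕ} (f : Coord n → ℝ) (a : Fin n) (x : Coord n) : ℝ :=
  fderiv ℝ f x (Pi.single a 1)

/-! ### Curvature of a metric in coordinates -/

/-- Christoffel symbols of the Levi-Civita connection,
`Γ^c_ab = ½ g^{cd} (∂_a g_db + ∂_b g_da - ∂_d g_ab)`. -/
noncomputable def christoffel {n : ℕ} (g : MetricField n) (x : Coord n) (c a b : Fin n) : ℝ :=
  (1 / 2) * ∑ d, (g x)⁻¹ c d *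
    (partialD (fun y => g y d b) a x + partialD (fun y => g y d a) b x
      - partialD (fun y => g y a b) d x)

/-- The curvature tensor with first index up,
`R^a_bcd = ∂_c Γ^a_db - ∂_d Γ^a_cb + Γ^a_ce Γ^e_db - Γ^a_de Γ^e_cb`. -/
noncomputable def riemannUp {n : ℕ} (g : MetricField n) (x : Coord n) (a b c d : Fin n) : ℝ :=
  partialD (fun y => christoffel g y a d b) c x - partialD (fun y => christoffel g y a c b) d x
    + ∑ e, (christoffel g x a c e * christoffel g x e d b
      - christoffel g x a d e * christoffel g x e c b)

/-- The Riemann tensor `R_abcd = g_ae R^e_bcd`. -/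
noncomputable def riemann {n : ℕ} (g : MetricField n) (x : Coord n) : Tensor4 n :=
  fun a b c d => ∑ e, g x a e * riemannUp g x e b c d

/-- The Ricci tensor `R_bd = R^a_bad`. -/
noncomputable def ricci {n : ℕ} (g : MetricField n) (x : Coord n) (b d : Fin n) : ℝ :=
  ∑ a, riemannUp g x a b a d

/-- The scalar curvature `R = g^{bd} R_bd`. -/
noncomputable def scalarCurv {n : ℕ} (g : MetricField n) (x : Coord n) : ℝ :=
  ∑ b, ∑ d, (g x)⁻¹ b d * ricci g x b d

/-- The Weyl tensor `C_abcd`. -/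
noncomputable def weyl {n : ℕ} (g : MetricField n) (x : Coord n) : Tensor4 n :=
  fun a b c d =>
    riemann g x a b c d
      - 1 / ((n : ℝ) - 2) *
        (g x a c * ricci g x b d - g x a d * ricci g x b c
          + g x b d * ricci g x a c - g x b c * ricci g x a d)
      + scalarCurv g x / (((n : ℝ) - 1) * ((n : ℝ) - 2)) *
        (g x a c * g x b d - g x a d * g x b c)

/-- The metric is Ricci flat on `U` (vacuum Einstein equations without cosmological constant). -/
def IsVacuumOn {n : ℕ} (g : MetricField n) (U : Set (Coord n)) : Prop :=
  ∀ x ∈ U, ∀ a b, ricci g x a b = 0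

/-- The covariant derivative `k_{a;b} = ∂_b k_a - Γ^c_ab k_c` of a covector field. -/
noncomputable def covDeriv {n : ℕ} (g : MetricField n) (k : Coord n → Coord n) (x : Coord n)
    (a b : Fin n) : ℝ :=
  partialD (fun y => k y a) b x - ∑ c, christoffel g x c a b * k x c

/-! ### Null frames -/

/-- Labels of the vectors of a null frame: `inl 0` for the first null vector `ℓ`, `inl 1` for the
second null vector `n`, and `inr i` for the spacelike vectors `m_(i)`. -/
abbrev FrameIdx (n : ℕ) : Type := Fin 2 ⊕ Fin (n - 2)

/-- The scalar products of a null frame: `ℓ·n = 1`, `m_(i)·m_(j) = δ_ij`, all others vanish. -/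
def frameProduct {n : ℕ} : FrameIdx n → FrameIdx n → ℝ
  | .inl p, .inl q => if p = q then 0 else 1
  | .inr i, .inr j => if i = j then 1 else 0
  | _, _ => 0

/-- `e` is a null frame `(ℓ, n, m_(i))` for the metric with component matrix `G` at a point. -/
def IsNullFrame {n : ℕ} (G : Matrix (Fin n) (Fin n) ℝ) (e : FrameIdx n → Coord n) : Prop :=
  ∀ p q, ∑ a, ∑ b, G a b * e p a * e q b = frameProduct p q

/-- Frame components of a tensor of rank four. -/
def frameComp {n : ℕ} (C : Tensor4 n) (e : FrameIdx n → Coord n) (p q r s : FrameIdx n) : ℝ :=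
  ∑ a, ∑ b, ∑ c, ∑ d, C a b c d * e p a * e q b * e r c * e s d

/-- Boost weight of a frame label: a boost `ℓ ↦ λ ℓ`, `n ↦ λ⁻¹ n`, `m_(i) ↦ m_(i)` multiplies the
frame vector by `λ` to this power. -/
def idxWeight {n : ℕ} : FrameIdx n → ℤ
  | .inl p => if p = 0 then 1 else -1
  | .inr _ => 0

/-- Boost weight of a frame component of a tensor of rank four. -/
def boostWeight {n : ℕ} (p q r s : FrameIdx n) : ℤ :=
  idxWeight p + idxWeight q + idxWeight r + idxWeight s

/-! ### Algebraic types (alignment classification of Weyl tensors) -/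

/-- The null alignment condition of level `w`: for some null frame all components of `C` with
boost weight greater than `w` vanish.  For a Weyl tensor, `w = 0` means "type II or more special"
and `w = -1` means "type III or more special" (types III, N and O). -/
def AlignedUpTo {n : ℕ} (G : Matrix (Fin n) (Fin n) ℝ) (C : Tensor4 n) (w : ℤ) : Prop :=
  ∃ e : FrameIdx n → Coord n, IsNullFrame G e ∧
    ∀ p q r s, w < boostWeight p q r s → frameComp C e p q r s = 0

/-- Principal (primary) type II, of which type D is a subtype: type II or more special, but not of
type III, N or O. -/
def IsPrincipalTypeII {n : ℕ} (G : Matrix (Fin n) (Fin n) ℝ) (C : Tensor4 n) : Prop :=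
  AlignedUpTo G C 0 ∧ ¬ AlignedUpTo G C (-1)

/-- Type D: principal type II, and in some null frame only components of boost weight zero are
present. -/
def IsTypeD {n : ℕ} (G : Matrix (Fin n) (Fin n) ℝ) (C : Tensor4 n) : Prop :=
  IsPrincipalTypeII G C ∧
    ∃ e : FrameIdx n → Coord n, IsNullFrame G e ∧
      ∀ p q r s, boostWeight p q r s ≠ 0 → frameComp C e p q r s = 0

/-- Type II in the narrow sense: principal type II, but not type D. -/
def IsTypeII {n : ℕ} (G : Matrix (Fin n) (Fin n) ℝ) (C : Tensor4 n) : Prop :=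
  IsPrincipalTypeII G C ∧ ¬ IsTypeD G C

/-! ### Kerr-Schild metrics and the optics of the Kerr-Schild congruence -/

/-- The Minkowski metric `η = diag(-1, 1, …, 1)`. -/
def minkowski (n : ℕ) : Matrix (Fin n) (Fin n) ℝ :=
  Matrix.diagonal fun a => if (a : ℕ) = 0 then -1 else 1

/-- The Kerr-Schild metric `g_ab = η_ab - 2 H k_a k_b`. -/
def ksMetric {n : ℕ} (H : Coord n → ℝ) (k : Coord n → Coord n) : MetricField n :=
  fun x => Matrix.of fun a b => minkowski n a b - 2 * H x * k x a * k x b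

/-- The components `k^a = η^{ab} k_b` of the Kerr-Schild vector field. -/
noncomputable def ksVector {n : ℕ} (k : Coord n → Coord n) (x : Coord n) : Coord n :=
  fun a => ∑ b, (minkowski n)⁻¹ a b * k x b

/-- `k` is null with respect to the Minkowski metric on `U`, and nowhere zero there. -/
def IsNullOneForm {n : ℕ} (k : Coord n → Coord n) (U : Set (Coord n)) : Prop :=
  ∀ x ∈ U, k x ≠ 0 ∧ ∑ a, ∑ b, (minkowski n)⁻¹ a b * k x a * k x b = 0

/-- The optical matrix `L_ij = k_{a;b} m_(i)^a m_(j)^b` relative to a frame `e` at `x`. -/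
noncomputable def opticalMatrix {n : ℕ} (g : MetricField n) (k : Coord n → Coord n) (x : Coord n)
    (e : FrameIdx n → Coord n) : Matrix (Fin (n - 2)) (Fin (n - 2)) ℝ :=
  Matrix.of fun i j => ∑ a, ∑ b, covDeriv g k x a b * e (Sum.inr i) a * e (Sum.inr j) b

/-- The expansion scalar `θ = L_ii / (n - 2)` relative to a frame `e` at `x`. -/
noncomputable def expansionScalar {n : ℕ} (g : MetricField n) (k : Coord n → Coord n)
    (x : Coord n) (e : FrameIdx n → Coord n) : ℝ :=
  (opticalMatrix g k x e).trace / ((n : ℝ) - 2)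

/-- The Kerr-Schild congruence is expanding at `x`: `θ ≠ 0` in a null frame whose first vector is
`k^a`.  (When `k` is geodetic, `θ` does not depend on the choice of such a frame.) -/
def IsExpandingAt {n : ℕ} (H : Coord n → ℝ) (k : Coord n → Coord n) (x : Coord n) : Prop :=
  ∃ e : FrameIdx n → Coord n, IsNullFrame (ksMetric H k x) e ∧
    e (Sum.inl 0) = ksVector k x ∧ expansionScalar (ksMetric H k) k x e ≠ 0

end KerrSchild

/-! Near a point write `k = l D`, where `D` is the null vector with stereographic parameters `Y_i`,
completed to a null frame `(D, U, X_i)` of the flat background with `U` constant. The optical matrix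
becomes `L_ij = X_j(Y_i)`, and the curvature is an explicit expression in `h = l² H`, `Y` and their
first two derivatives. All computations take place in the ring of germs of smooth functions, where
an identity valid near the point is an equality.

In vacuum the Weyl tensor is the Riemann tensor. The equation `R(D, D) = 0` says that `h` times a
sum of squares of the `D(Y_i)` vanishes, so the congruence is geodetic (`LocalModel.geodetic`). Then
all components of positive boost weight vanish identically (`LocalModel.aligned`), which is (i). The
equations `R(X_i, X_j) = 0` become the optical constraint `2 L Lᵀ = F (L + Lᵀ)` with `F = D(h)/h +
tr L`.

For (ii), suppose the type at `x₀` is III or more special. Then the components `R(D, X_i, U, X_j)`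
vanish at `x₀` (`component_eq_zero_of_aligned`). Together with the constraint and `tr L ≠ 0` this
forces `L = F e eᵀ` at `x₀` (`rank_one_of_optical`). The heart of the proof is that rank one spreads
to a neighbourhood. The constraint makes `1 - 2 L / F` orthogonal; at `x₀` it is a reflection, so
its eigenvector extends to an eigenvector of `L` nearby (`exists_eigenvector`). Let `M = L - F e
eᵀ`, and let `J` be the ideal of germs generated by the entries of `M`. The constraint puts the
symmetric part of `M` into `J²`. The Codazzi equations, which are the commutators of the `X_i`
applied to `Y`, put `X_k(M)` into `J` (`RankOneOptics.rigid`). Taking the divergence of the twist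
twice controls the derivative along `U` (`RankOneOptics.V_twist_sq_mem`), and the Sachs equation the
one along `D`. So every derivative of `S = ∑ M_ij²` lies in `J²` and is bounded by a multiple of
`S`; since `S(x₀) = 0`, Grönwall's inequality gives `S = 0` nearby (`eq_zero_of_derivative_mem_sq`).

A vacuum metric with a rank-one optical matrix is flat (`RankOneVacuum.riemann_eq_zero`). Hence the
curvature vanishes near any point of type III, N or O. In particular its zero set is open in `U`. It
is also relatively closed, so by connectedness and non-flatness it is empty, and those types cannot
occur. -/

namespace KerrSchild

set_option linter.unusedSectionVars false

/-! ### Codazzi equations modulo an ideal -/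

section Twist

/-- The Codazzi equations of an optical matrix of rank one force the derivative of the remaining,
skew part to vanish. -/
theorem codazzi_rigid {ι Q : Type*} [Fintype ι] [CommRing Q] {t F G : Q} (ht : 2 * t = 1)
    (hF : G * F = 1) {e f : ι → Q} {p : ι → ι → Q} {D : ι → ι → ι → Q}
    (he : ∑ i, e i * e i = 1) (hp : ∀ k, ∑ i, p k i * e i = 0)
    (hD : ∀ k i j, D k i j = -D k j i) (hDe : ∀ k i, ∑ j, D k i j * e j = 0)
    (hC : ∀ k i j, f k * e i * e j + F * (p k i * e j + e i * p k j) + D k i j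
      = f j * e i * e k + F * (p j i * e k + e i * p j k) + D j i k) :
    (∀ k i j, D k i j = 0) ∧ (∀ j i, p j i = e j * ∑ k, e k * p k i) ∧
      ∀ j, F * ∑ k, e k * p k j = f j - (∑ k, e k * f k) * e j := by
  have two_cancel : ∀ a : Q, 2 * a = 0 → a = 0 := fun a h => by
    linear_combination t * h - a * ht
  have hDe' : ∀ k j, ∑ i, e i * D k i j = 0 := fun k j => by
    have := hDe k j
    rw [← neg_eq_zero, ← Finset.sum_neg_distrib, ← this]
    exact Finset.sum_congr rfl fun i _ => by rw [hD k i j]; ring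
  -- Contraction with `e i` isolates `f` and `p`: the `D` term drops out, since skewness transfers
  -- `hDe` to the second index.
  have s1 : ∀ k j, ∑ i, e i * (f k * e i * e j + F * (p k i * e j + e i * p k j) + D k i j)
      = f k * e j + F * p k j := fun k j => by
    have : ∑ i, e i * (f k * e i * e j + F * (p k i * e j + e i * p k j) + D k i j)
        = f k * e j * (∑ i, e i * e i) + F * e j * (∑ i, p k i * e i)
          + F * p k j * (∑ i, e i * e i) + ∑ i, e i * D k i j := by
      simp only [Finset.mul_sum, ← Finset.sum_add_distrib]
      exact Finset.sum_congr rfl fun i _ => by ring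
    rw [this, he, hp, hDe']; ring
  have ha : ∀ k j, f k * e j + F * p k j = f j * e k + F * p j k := fun k j => by
    rw [← s1 k j, ← s1 j k]
    exact Finset.sum_congr rfl fun i _ => by rw [hC k i j]
  set fe := ∑ k, e k * f k with hfe
  set pe : ι → Q := fun j => ∑ k, e k * p k j with hpe
  have hc : ∀ j, fe * e j + F * pe j = f j := fun j => by
    have h1 : ∑ k, e k * (f k * e j + F * p k j) = fe * e j + F * pe j := by
      simp only [hfe, hpe, Finset.mul_sum, Finset.sum_mul, ← Finset.sum_add_distrib]
      exact Finset.sum_congr rfl fun i _ => by ring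
    have h2 : ∑ k, e k * (f j * e k + F * p j k) = f j := by
      have : ∑ k, e k * (f j * e k + F * p j k)
          = f j * (∑ i, e i * e i) + F * (∑ k, p j k * e k) := by
        simp only [Finset.mul_sum, ← Finset.sum_add_distrib]
        exact Finset.sum_congr rfl fun i _ => by ring
      rw [this, he, hp]; ring
    rw [← h1, ← h2]
    exact Finset.sum_congr rfl fun k _ => by rw [ha]
  have hpee : ∑ j, pe j * e j = 0 := by
    have : ∑ j, pe j * e j = ∑ k, e k * ∑ j, p k j * e j := by
      simp only [hpe, Finset.mul_sum, Finset.sum_mul]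
      rw [Finset.sum_comm]
      exact Finset.sum_congr rfl fun i _ => Finset.sum_congr rfl fun j _ => by ring
    rw [this]; simp [hp]
  have hb : ∀ i j, (∑ k, e k * D k i j) = F * (p j i - e j * pe i) := fun i j => by
    have h1 : ∑ k, e k * (f k * e i * e j + F * (p k i * e j + e i * p k j) + D k i j)
        = fe * e i * e j + F * (pe i * e j + e i * pe j) + ∑ k, e k * D k i j := by
      simp only [hfe, hpe, Finset.mul_sum, Finset.sum_mul, ← Finset.sum_add_distrib]
      exact Finset.sum_congr rfl fun i _ => by ring
    have h2 : ∑ k, e k * (f j * e i * e k + F * (p j i * e k + e i * p j k) + D j i k)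
        = f j * e i * (∑ k, e k * e k) + F * p j i * (∑ k, e k * e k)
          + F * e i * (∑ k, p j k * e k) + ∑ k, D j i k * e k := by
      simp only [Finset.mul_sum, ← Finset.sum_add_distrib]
      exact Finset.sum_congr rfl fun i _ => by ring
    have h3 : ∑ k, e k * (f k * e i * e j + F * (p k i * e j + e i * p k j) + D k i j)
        = ∑ k, e k * (f j * e i * e k + F * (p j i * e k + e i * p j k) + D j i k) :=
      Finset.sum_congr rfl fun k _ => by rw [hC]
    rw [h1, h2, he, hp, hDe] at h3
    linear_combination h3 - e i * hc j
  have hsym : ∀ i j, p j i - e j * pe i = p i j - e i * pe j := fun i j => by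
    have h := ha j i
    have hi := hc i
    have hj := hc j
    have : F * ((p j i - e j * pe i) - (p i j - e i * pe j)) = 0 := by
      linear_combination h + e i * hj - e j * hi
    linear_combination G * this - (p j i - e j * pe i - p i j + e i * pe j) * hF
  -- The left side of `hb` is skew in `i`, `j` by `hD`, the right side is symmetric by `hsym`; so
  -- both vanish.
  have hp0 : ∀ i j, p j i = e j * pe i := fun i j => by
    have h1 : (∑ k, e k * D k i j) = -∑ k, e k * D k j i := by
      rw [← Finset.sum_neg_distrib]
      exact Finset.sum_congr rfl fun k _ => by rw [hD k i j]; ring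
    rw [hb, hb] at h1
    have h2 := two_cancel (F * (p j i - e j * pe i)) (by
      linear_combination h1 + F * hsym i j)
    linear_combination G * h2 - (p j i - e j * pe i) * hF
  have hsw : ∀ k i j, D k i j = D j i k := fun k i j => by
    have h := hC k i j
    rw [hp0 i k, hp0 j k, hp0 i j, hp0 k j] at h
    linear_combination h + e i * e j * hc k - e i * e k * hc j
  -- `D` is symmetric under exchange of the outer indices and skew in the last two. These two
  -- transpositions generate all permutations with incompatible signs, so `D = 0`.
  refine ⟨fun k i j => two_cancel _ ?_, fun j i => hp0 i j, fun j => ?_⟩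
  · linear_combination hsw k i j + hD j i k - hsw j k i - hD i k j + hsw i j k + hD k j i
  · linear_combination hc j

variable {ι R : Type*} [Fintype ι] [CommRing R] [Algebra ℝ R]

theorem exists_half (R : Type*) [CommRing R] [Algebra ℝ R] : ∃ t : R, 2 * t = 1 :=
  ⟨algebraMap ℝ R (1 / 2), by
    rw [← map_ofNat (algebraMap ℝ R) 2, ← map_mul]; norm_num⟩

theorem mem_of_smul_mem {J : Ideal R} {c : ℝ} (hc : c ≠ 0) {a : R}
    (h : algebraMap ℝ R c * a ∈ J) : a ∈ J := by
  have := J.mul_mem_left (algebraMap ℝ R c⁻¹) h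
  rwa [← mul_assoc, ← map_mul, inv_mul_cancel₀ hc, map_one, one_mul] at this

theorem mem_of_two_mul_mem {J : Ideal R} {a : R} (h : 2 * a ∈ J) : a ∈ J :=
  mem_of_smul_mem (c := 2) two_ne_zero (by rwa [map_ofNat])

theorem derivation_mem {J : Ideal R} {s : Set R} (hJ : J = Ideal.span s) (δ : Derivation ℝ R R)
    (h : ∀ x ∈ s, δ x ∈ J) {x : R} (hx : x ∈ J) : δ x ∈ J := by
  subst hJ
  refine Submodule.span_induction (p := fun x _ => δ x ∈ Ideal.span s) h (by simp) ?_ ?_ hx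
  · intro x y _ _ hx hy
    rw [map_add]; exact add_mem hx hy
  · intro a x hx' hx
    rw [smul_eq_mul, δ.leibniz, smul_eq_mul, smul_eq_mul]
    exact add_mem (Ideal.mul_mem_left _ _ hx)
      (Ideal.mul_mem_right _ _ hx')

theorem derivation_mem_sq {J : Ideal R} (δ : Derivation ℝ R R) (h : ∀ x ∈ J, δ x ∈ J) {x : R}
    (hx : x ∈ J ^ 2) : δ x ∈ J ^ 2 := by
  rw [sq] at hx ⊢
  refine Submodule.mul_induction_on hx ?_ ?_
  · intro a ha b hb
    rw [δ.leibniz, smul_eq_mul, smul_eq_mul, mul_comm b]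
    exact add_mem (Ideal.mul_mem_mul ha (h b hb)) (Ideal.mul_mem_mul (h a ha) hb)
  · intro a b ha hb
    rw [map_add]; exact add_mem ha hb

/-- By the Leibniz rule a derivation lowers the order of vanishing along `J` by at most one. -/
theorem derivation_mem_of_mem_sq {J : Ideal R} (δ : Derivation ℝ R R) {x : R}
    (hx : x ∈ J ^ 2) : δ x ∈ J := by
  rw [sq] at hx
  refine Submodule.mul_induction_on hx ?_ ?_
  · intro a ha b hb
    rw [δ.leibniz, smul_eq_mul, smul_eq_mul]
    exact add_mem (Ideal.mul_mem_right _ _ ha) (Ideal.mul_mem_right _ _ hb)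
  · intro a b ha hb
    rw [map_add]; exact add_mem ha hb

end Twist

/-! ### The remainder of the optical matrix and its ideal -/

section Twist

variable {ι R : Type*} [Fintype ι] [CommRing R] [Algebra ℝ R]

/-- The optical matrix `X_j(Y_i)` of a null congruence which satisfies the optical constraint and
has the eigenvector `e` with eigenvalue `F`, the reciprocal of `G`. -/
structure RankOneOptics (X : ι → Derivation ℝ R R) (V : Derivation ℝ R R) (Y : ι → R) (F G : R)
    (e : ι → R) : Prop where
  comm_XX : ∀ i j f, X i (X j f) - X j (X i f) = (X j (Y i) - X i (Y j)) * V f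
  comm_VX : ∀ j f, V (X j f) - X j (V f) = -(V (Y j) * V f)
  inv : G * F = 1
  optical : ∀ i j, 2 * ∑ p, X p (Y i) * X p (Y j) = F * (X j (Y i) + X i (Y j))
  unit : ∑ i, e i * e i = 1
  right : ∀ i, ∑ j, X j (Y i) * e j = F * e i
  left : ∀ j, ∑ i, X j (Y i) * e i = F * e j

/-- The part of the optical matrix orthogonal to the eigenvector `e`. -/
def opticalRest (X : ι → Derivation ℝ R R) (Y : ι → R) (F : R) (e : ι → R) (i j : ι) : R :=
  X j (Y i) - F * e i * e j

/-- The ideal generated by the part of the optical matrix orthogonal to the eigenvector. -/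
def restIdeal (X : ι → Derivation ℝ R R) (Y : ι → R) (F : R) (e : ι → R) : Ideal R :=
  Ideal.span (Set.range fun p : ι × ι => opticalRest X Y F e p.1 p.2)

namespace RankOneOptics

variable {X : ι → Derivation ℝ R R} {V : Derivation ℝ R R} {Y : ι → R} {F G : R} {e : ι → R}

local notation "M" => opticalRest X Y F e
local notation "J" => restIdeal X Y F e

theorem rest_mem (i j : ι) : M i j ∈ J := Ideal.subset_span ⟨(i, j), rfl⟩

theorem optical_eq (_h : RankOneOptics X V Y F G e) (i j : ι) : X j (Y i) = M i j + F * e i * e j := by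
  unfold opticalRest; ring

theorem rest_right (h : RankOneOptics X V Y F G e) (i : ι) : ∑ j, M i j * e j = 0 := by
  have : ∑ j, M i j * e j = ∑ j, X j (Y i) * e j - F * e i * ∑ j, e j * e j := by
    simp only [Finset.mul_sum, ← Finset.sum_sub_distrib]
    exact Finset.sum_congr rfl fun j _ => by unfold opticalRest; ring
  rw [this, h.right, h.unit]; ring

theorem rest_left (h : RankOneOptics X V Y F G e) (j : ι) : ∑ i, M i j * e i = 0 := by
  have : ∑ i, M i j * e i = ∑ i, X j (Y i) * e i - F * e j * ∑ i, e i * e i := by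
    simp only [Finset.mul_sum, ← Finset.sum_sub_distrib]
    exact Finset.sum_congr rfl fun j _ => by unfold opticalRest; ring
  rw [this, h.left, h.unit]; ring

/-- The part `F e eᵀ` satisfies the optical constraint by itself and the cross terms vanish because
`M e = 0`, so the remainder inherits the constraint. -/
theorem rest_optical (h : RankOneOptics X V Y F G e) (i j : ι) :
    2 * ∑ p, M i p * M j p = F * (M i j + M j i) := by
  have h1 : ∑ p, X p (Y i) * X p (Y j) = ∑ p, M i p * M j p + F * e j * ∑ p, M i p * e p
      + F * e i * ∑ p, M j p * e p + F ^ 2 * e i * e j * ∑ p, e p * e p := by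
    simp only [Finset.mul_sum, ← Finset.sum_add_distrib]
    exact Finset.sum_congr rfl fun p _ => by rw [h.optical_eq i, h.optical_eq j]; ring
  have h2 := h.optical i j
  rw [h1, h.rest_right, h.rest_right, h.unit, h.optical_eq i j, h.optical_eq j i] at h2
  linear_combination h2

/-- The constraint is quadratic on one side and linear on the other, and `F` is invertible: to first
order the remainder is pure twist. -/
theorem rest_add_mem (h : RankOneOptics X V Y F G e) (i j : ι) : M i j + M j i ∈ J ^ 2 := by
  have : M i j + M j i = G * (2 * ∑ p, M i p * M j p) := by
    rw [h.rest_optical]; linear_combination -(M i j + M j i) * h.inv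
  rw [this, sq]
  exact Ideal.mul_mem_left _ _ (Ideal.mul_mem_left _ _
    (Ideal.sum_mem _ fun p _ => Ideal.mul_mem_mul (rest_mem _ _) (rest_mem _ _)))

theorem X_unit (h : RankOneOptics X V Y F G e) (k : ι) : ∑ i, X k (e i) * e i = 0 := by
  obtain ⟨t, ht⟩ := exists_half R
  have h1 := congrArg (X k) h.unit
  rw [map_sum, Derivation.map_one_eq_zero] at h1
  have : (2 : R) * ∑ i, X k (e i) * e i = 0 := by
    rw [← h1, Finset.mul_sum]
    exact Finset.sum_congr rfl fun i _ => by
      rw [Derivation.leibniz, smul_eq_mul]; ring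
  linear_combination t * this - (∑ i, X k (e i) * e i) * ht

/-- The Codazzi equations of the optical matrix. -/
theorem codazzi (h : RankOneOptics X V Y F G e) (k i j : ι) :
    X k (M i j) + X k F * e i * e j + F * (X k (e i) * e j + e i * X k (e j))
      = X j (M i k) + X j F * e i * e k + F * (X j (e i) * e k + e i * X j (e k))
        + (M k j - M j k) * V (Y i) := by
  have h1 := h.comm_XX k j (Y i)
  rw [h.optical_eq i j, h.optical_eq i k, h.optical_eq k j, h.optical_eq j k] at h1
  simp only [map_add, Derivation.leibniz, smul_eq_mul] at h1
  linear_combination h1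

/-- In the quotient by `J` the twist term of the Codazzi equations disappears, and the derivatives
of `M` are skew because its symmetric part lies in `J ^ 2`. Thus `codazzi_rigid` applies there. -/
theorem rigid (h : RankOneOptics X V Y F G e) :
    (∀ k i j, X k (M i j) ∈ J) ∧ (∀ j i, X j (e i) - e j * ∑ k, e k * X k (e i) ∈ J) ∧
      ∀ j, F * ∑ k, e k * X k (e j) - (X j F - (∑ k, e k * X k F) * e j) ∈ J := by
  obtain ⟨t, ht⟩ := exists_half R
  let π := Ideal.Quotient.mk J
  have hπ : ∀ {x : R}, x ∈ J → π x = 0 := fun hx => Ideal.Quotient.eq_zero_iff_mem.2 hx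
  have key := codazzi_rigid (Q := R ⧸ J) (t := π t) (F := π F) (G := π G) (e := fun i => π (e i))
    (f := fun k => π (X k F)) (p := fun k i => π (X k (e i))) (D := fun k i j => π (X k (M i j)))
    (by rw [← map_ofNat π 2, ← map_mul, ht, map_one]) (by rw [← map_mul, h.inv, map_one])
    (by simp only [← map_mul, ← map_sum]; rw [h.unit, map_one])
    (fun k => by simp only [← map_mul, ← map_sum]; rw [h.X_unit, map_zero])
    (fun k i j => by
      rw [eq_neg_iff_add_eq_zero, ← map_add, ← map_add]
      exact hπ (derivation_mem_of_mem_sq _ (h.rest_add_mem i j)))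
    (fun k i => by
      simp only [← map_mul, ← map_sum]
      have h1 := congrArg (X k) (h.rest_right i)
      rw [map_sum, map_zero] at h1
      have h2 : ∑ j, X k (M i j) * e j = -∑ j, M i j * X k (e j) := by
        rw [eq_neg_iff_add_eq_zero, ← h1, ← Finset.sum_add_distrib]
        exact Finset.sum_congr rfl fun j _ => by
          rw [Derivation.leibniz, smul_eq_mul, smul_eq_mul]; ring
      rw [h2]
      exact hπ (neg_mem (Ideal.sum_mem _ fun j _ => Ideal.mul_mem_right _ _ (rest_mem _ _))))
    (fun k i j => by
      have h1 := congrArg π (h.codazzi k i j)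
      have h2 : π ((M k j - M j k) * V (Y i)) = 0 :=
        hπ (Ideal.mul_mem_right _ _ (sub_mem (rest_mem _ _) (rest_mem _ _)))
      rw [map_add π _ ((M k j - M j k) * V (Y i)), h2] at h1
      simp only [map_add, map_mul] at h1
      linear_combination h1)
  refine ⟨fun k i j => Ideal.Quotient.eq_zero_iff_mem.1 (key.1 k i j), fun j i => ?_, fun j => ?_⟩
  · rw [← Ideal.Quotient.eq_zero_iff_mem]
    have := key.2.1 j i
    simp only [← map_mul, ← map_sum] at this
    rw [map_sub, sub_eq_zero]; exact this
  · rw [← Ideal.Quotient.eq_zero_iff_mem]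
    have := key.2.2 j
    simp only [← map_mul, ← map_sum, ← map_sub] at this
    rw [map_sub, sub_eq_zero]; exact this

theorem X_mem (h : RankOneOptics X V Y F G e) (k : ι) {x : R} (hx : x ∈ J) : X k x ∈ J :=
  derivation_mem rfl (X k) (by rintro _ ⟨p, rfl⟩; exact h.rigid.1 k p.1 p.2) hx

theorem X_mem_sq (h : RankOneOptics X V Y F G e) (k : ι) {x : R} (hx : x ∈ J ^ 2) :
    X k x ∈ J ^ 2 :=
  derivation_mem_sq (X k) (fun _ hx => h.X_mem k hx) hx

end RankOneOptics

end Twist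

/-! ### Divergence of the twist modulo `J ^ 2` -/

section Twist

variable {ι R : Type*} [Fintype ι] [CommRing R] [Algebra ℝ R]

theorem two_mul_sum_skew {a f : ι → ι → R} (ha : ∀ i j, a j i = -a i j) :
    2 * ∑ i, ∑ j, a i j * f i j = ∑ i, ∑ j, a i j * (f i j - f j i) := by
  have : ∑ i, ∑ j, a i j * f j i = -∑ i, ∑ j, a i j * f i j := by
    rw [Finset.sum_comm, ← Finset.sum_neg_distrib]
    refine Finset.sum_congr rfl fun i _ => ?_
    rw [← Finset.sum_neg_distrib]
    exact Finset.sum_congr rfl fun j _ => by rw [ha i j]; ring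
  simp only [mul_sub, Finset.sum_sub_distrib, this]
  ring

namespace RankOneOptics

variable {X : ι → Derivation ℝ R R} {V : Derivation ℝ R R} {Y : ι → R} {F G : R} {e : ι → R}

local notation "M" => opticalRest X Y F e
local notation "J" => restIdeal X Y F e

theorem trace_mem (h : RankOneOptics X V Y F G e) : ∑ i, M i i ∈ J ^ 2 := by
  refine mem_of_two_mul_mem ?_
  rw [Finset.mul_sum]
  refine Ideal.sum_mem _ fun i _ => ?_
  rw [two_mul]; exact h.rest_add_mem i i

/-- An exact contraction of the Codazzi equations with `e`: the congruences of `rigid` hold only to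
first order, too coarse for the divergence of the twist. -/
theorem codazzi_left (h : RankOneOptics X V Y F G e) (k j : ι) :
    X k F * e j + F * X k (e j) - ∑ i, M i j * X k (e i)
      = X j F * e k + F * X j (e k) - ∑ i, M i k * X j (e i)
        + (M k j - M j k) * ∑ i, e i * V (Y i) := by
  have hM : ∀ k j, ∑ i, e i * X k (M i j) = -∑ i, M i j * X k (e i) := fun k j => by
    have h1 := congrArg (X k) (h.rest_left j)
    rw [map_sum, map_zero] at h1
    rw [eq_neg_iff_add_eq_zero, ← h1, ← Finset.sum_add_distrib]
    exact Finset.sum_congr rfl fun i _ => by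
      rw [Derivation.leibniz, smul_eq_mul, smul_eq_mul]; ring
  have h1 : ∑ i, e i * (X k (M i j) + X k F * e i * e j + F * (X k (e i) * e j + e i * X k (e j)))
      = ∑ i, e i * (X j (M i k) + X j F * e i * e k + F * (X j (e i) * e k + e i * X j (e k))
        + (M k j - M j k) * V (Y i)) :=
    Finset.sum_congr rfl fun i _ => by rw [h.codazzi k i j]
  have h2 : ∀ k j, ∑ i, e i * (X k (M i j) + X k F * e i * e j
      + F * (X k (e i) * e j + e i * X k (e j)))
      = X k F * e j + F * X k (e j) - ∑ i, M i j * X k (e i) := fun k j => by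
    have : ∑ i, e i * (X k (M i j) + X k F * e i * e j + F * (X k (e i) * e j + e i * X k (e j)))
        = ∑ i, e i * X k (M i j) + X k F * e j * (∑ i, e i * e i)
          + F * e j * (∑ i, X k (e i) * e i) + F * X k (e j) * ∑ i, e i * e i := by
      simp only [Finset.mul_sum, ← Finset.sum_add_distrib]
      exact Finset.sum_congr rfl fun i _ => by ring
    rw [this, hM, h.unit, h.X_unit]; ring
  simp only [mul_add (_ : R) _ ((M k j - M j k) * _)] at h1
  rw [h2, Finset.sum_add_distrib, h2] at h1
  rw [h1, Finset.mul_sum]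
  congr 1
  exact Finset.sum_congr rfl fun i _ => by ring

theorem codazzi_left_left (h : RankOneOptics X V Y F G e) (j : ι) :
    (∑ k, e k * X k F) * e j + F * ∑ k, e k * X k (e j)
      = X j F + ∑ i, M i j * ∑ k, e k * X k (e i) := by
  have h1 : ∑ k, e k * (X k F * e j + F * X k (e j) - ∑ i, M i j * X k (e i))
      = ∑ k, e k * (X j F * e k + F * X j (e k) - ∑ i, M i k * X j (e i)
        + (M k j - M j k) * ∑ i, e i * V (Y i)) :=
    Finset.sum_congr rfl fun k _ => by rw [h.codazzi_left k j]
  have h2 : ∑ k, e k * (X k F * e j + F * X k (e j) - ∑ i, M i j * X k (e i))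
      = (∑ k, e k * X k F) * e j + F * ∑ k, e k * X k (e j)
        - ∑ i, M i j * ∑ k, e k * X k (e i) := by
    have : ∑ i, M i j * ∑ k, e k * X k (e i) = ∑ k, e k * ∑ i, M i j * X k (e i) := by
      simp only [Finset.mul_sum]
      rw [Finset.sum_comm]
      exact Finset.sum_congr rfl fun i _ => Finset.sum_congr rfl fun j _ => by ring
    rw [this]
    simp only [Finset.mul_sum (f := fun k => e k * X k (e j)), Finset.sum_mul,
      ← Finset.sum_add_distrib, ← Finset.sum_sub_distrib]
    exact Finset.sum_congr rfl fun i _ => by ring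
  have h3 : ∑ k, e k * (X j F * e k + F * X j (e k) - ∑ i, M i k * X j (e i)
        + (M k j - M j k) * ∑ i, e i * V (Y i)) = X j F := by
    have : ∑ k, e k * (X j F * e k + F * X j (e k) - ∑ i, M i k * X j (e i)
        + (M k j - M j k) * ∑ i, e i * V (Y i))
        = X j F * (∑ k, e k * e k) + F * (∑ k, X j (e k) * e k)
          - ∑ i, (∑ k, M i k * e k) * X j (e i)
          + ((∑ k, M k j * e k) - ∑ k, M j k * e k) * ∑ i, e i * V (Y i) := by
      have hc : ∑ i, (∑ k, M i k * e k) * X j (e i) = ∑ k, e k * ∑ i, M i k * X j (e i) := by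
        simp only [Finset.mul_sum, Finset.sum_mul]
        rw [Finset.sum_comm]
        exact Finset.sum_congr rfl fun i _ => Finset.sum_congr rfl fun j _ => by ring
      rw [hc, ← Finset.sum_sub_distrib, Finset.sum_mul]
      simp only [Finset.mul_sum (f := fun k => e k * e k),
        Finset.mul_sum (f := fun k => X j (e k) * e k),
        ← Finset.sum_add_distrib, ← Finset.sum_sub_distrib]
      exact Finset.sum_congr rfl fun i _ => by ring
    rw [this, h.unit, h.X_unit, h.rest_left, h.rest_right]
    simp [h.rest_right]
  rw [h2, h3] at h1
  linear_combination h1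

/-- Modulo `J`, `X i (e k)` is `e i` times a vector, and `e i` is annihilated by `M`. The error is a
product of two elements of `J`. -/
theorem rest_mul_X_mem (h : RankOneOptics X V Y F G e) :
    ∑ i, ∑ k, M i k * X i (e k) ∈ J ^ 2 := by
  have h0 : ∑ i, ∑ k, M i k * (e i * ∑ l, e l * X l (e k)) = 0 := by
    rw [Finset.sum_comm]
    refine Finset.sum_eq_zero fun k _ => ?_
    have := h.rest_left k
    calc _ = (∑ i, M i k * e i) * ∑ l, e l * X l (e k) := by
          rw [Finset.sum_mul]; exact Finset.sum_congr rfl fun i _ => by ring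
      _ = 0 := by rw [this, zero_mul]
  rw [← sub_zero (∑ i, _), ← h0, ← Finset.sum_sub_distrib]
  refine Ideal.sum_mem _ fun i _ => ?_
  rw [← Finset.sum_sub_distrib]
  refine Ideal.sum_mem _ fun k _ => ?_
  rw [← mul_sub, sq]
  exact Ideal.mul_mem_mul (rest_mem _ _) (h.rigid.2.1 i k)

/-- Trace the Codazzi equations over `i = j` and contract with `e k`: the derivatives of `F` cancel,
leaving derivatives of the trace of `M` and the sum of `rest_mul_X_mem`. -/
theorem div_e_mem (h : RankOneOptics X V Y F G e) : F * ∑ i, X i (e i) ∈ J ^ 2 := by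
  have h1 : ∑ k, e k * ∑ i, (X k (M i i) + X k F * e i * e i
        + F * (X k (e i) * e i + e i * X k (e i)))
      = ∑ k, e k * ∑ i, (X i (M i k) + X i F * e i * e k
        + F * (X i (e i) * e k + e i * X i (e k)) + (M k i - M i k) * V (Y i)) :=
    Finset.sum_congr rfl fun k _ => congrArg _ (Finset.sum_congr rfl fun i _ => h.codazzi k i i)
  have h2 : ∑ k, e k * ∑ i, (X k (M i i) + X k F * e i * e i
        + F * (X k (e i) * e i + e i * X k (e i)))
      = (∑ k, e k * X k (∑ i, M i i)) + ∑ k, e k * X k F := by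
    rw [← Finset.sum_add_distrib]
    refine Finset.sum_congr rfl fun k _ => ?_
    have : ∑ i, (X k (M i i) + X k F * e i * e i + F * (X k (e i) * e i + e i * X k (e i)))
        = X k (∑ i, M i i) + X k F * (∑ i, e i * e i) + 2 * F * ∑ i, X k (e i) * e i := by
      simp only [map_sum, Finset.mul_sum, ← Finset.sum_add_distrib]
      exact Finset.sum_congr rfl fun i _ => by ring
    rw [this, h.unit, h.X_unit]; ring
  have h3 : ∑ k, e k * ∑ i, (X i (M i k) + X i F * e i * e k
        + F * (X i (e i) * e k + e i * X i (e k)) + (M k i - M i k) * V (Y i))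
      = ∑ i, (-(∑ k, M i k * X i (e k)) + X i F * e i + F * X i (e i)) := by
    simp only [Finset.mul_sum]
    rw [Finset.sum_comm]
    refine Finset.sum_congr rfl fun i _ => ?_
    have hM : ∑ k, M i k * X i (e k) = -∑ k, e k * X i (M i k) := by
      have h1 := congrArg (X i) (h.rest_right i)
      rw [map_sum, map_zero] at h1
      rw [eq_neg_iff_add_eq_zero, ← h1, ← Finset.sum_add_distrib]
      exact Finset.sum_congr rfl fun i _ => by
        rw [Derivation.leibniz, smul_eq_mul, smul_eq_mul]
    have : ∑ k, e k * (X i (M i k) + X i F * e i * e k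
        + F * (X i (e i) * e k + e i * X i (e k)) + (M k i - M i k) * V (Y i))
        = ∑ k, e k * X i (M i k) + (X i F * e i + F * X i (e i)) * (∑ k, e k * e k)
          + F * e i * (∑ k, X i (e k) * e k)
          + V (Y i) * ((∑ k, M k i * e k) - ∑ k, M i k * e k) := by
      simp only [Finset.mul_sum, ← Finset.sum_sub_distrib, ← Finset.sum_add_distrib]
      exact Finset.sum_congr rfl fun i _ => by ring
    rw [this, h.unit, h.X_unit, h.rest_left, h.rest_right, hM]; ring
  rw [h2, h3, Finset.sum_add_distrib, Finset.sum_add_distrib, Finset.sum_neg_distrib] at h1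
  have : F * ∑ i, X i (e i)
      = (∑ k, e k * X k (∑ i, M i i)) + ∑ i, ∑ k, M i k * X i (e k) := by
    rw [Finset.mul_sum]
    have : ∑ i, e i * X i F = ∑ i, X i F * e i := Finset.sum_congr rfl fun i _ => mul_comm _ _
    linear_combination -h1 + this
  rw [this]
  exact add_mem (Ideal.sum_mem _ fun k _ => Ideal.mul_mem_left _ _ (h.X_mem_sq k h.trace_mem))
    h.rest_mul_X_mem

/-- The divergence of the twist, up to terms of second order. -/
theorem div_twist_mem (h : RankOneOptics X V Y F G e) (j : ι) :
    ∑ i, X i (M i j - M j i) - ∑ i, (M i j - M j i) * (2 * V (Y i) - G * X i F) ∈ J ^ 2 := by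
  have h1 : ∑ i, (X i (M i j) + X i F * e i * e j + F * (X i (e i) * e j + e i * X i (e j)))
      = ∑ i, (X j (M i i) + X j F * e i * e i + F * (X j (e i) * e i + e i * X j (e i))
        + (M i j - M j i) * V (Y i)) :=
    Finset.sum_congr rfl fun i _ => h.codazzi i i j
  have h2 : ∑ i, (X i (M i j) + X i F * e i * e j + F * (X i (e i) * e j + e i * X i (e j)))
      = ∑ i, X i (M i j) + ((∑ i, e i * X i F) * e j + F * ∑ i, e i * X i (e j))
        + (F * ∑ i, X i (e i)) * e j := by
    simp only [Finset.mul_sum, Finset.sum_mul, ← Finset.sum_add_distrib]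
    exact Finset.sum_congr rfl fun i _ => by ring
  have h3 : ∑ i, (X j (M i i) + X j F * e i * e i + F * (X j (e i) * e i + e i * X j (e i))
        + (M i j - M j i) * V (Y i))
      = X j (∑ i, M i i) + X j F * (∑ i, e i * e i) + 2 * F * (∑ i, X j (e i) * e i)
        + ∑ i, (M i j - M j i) * V (Y i) := by
    simp only [map_sum, Finset.mul_sum, ← Finset.sum_add_distrib]
    exact Finset.sum_congr rfl fun i _ => by ring
  rw [h2, h3, h.codazzi_left_left, h.unit, h.X_unit] at h1
  set p : ι → R := fun i => ∑ k, e k * X k (e i) with hp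
  have hp' : ∀ i, p i - G * (X i F - (∑ k, e k * X k F) * e i) ∈ J := fun i => by
    have := Ideal.mul_mem_left J G (h.rigid.2.2 i)
    have h4 : G * (F * p i - (X i F - (∑ k, e k * X k F) * e i))
        = p i - G * (X i F - (∑ k, e k * X k F) * e i) := by
      linear_combination p i * h.inv
    rwa [h4] at this
  -- The skew part is `2 M` minus the symmetric part, so this is twice the traced Codazzi equation
  -- with `p` replaced through `hp'`. The component of `p` along `e` drops out because `M`
  -- annihilates `e` on both sides. Each remaining term is of second order.
  have h5 : ∑ i, X i (M i j - M j i) - ∑ i, (M i j - M j i) * (2 * V (Y i) - G * X i F)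
      = 2 * X j (∑ i, M i i) - 2 * (F * ∑ i, X i (e i)) * e j - ∑ i, X i (M i j + M j i)
        - ∑ i, (M i j + M j i) * p i
        - ∑ i, (M i j - M j i) * (p i - G * (X i F - (∑ k, e k * X k F) * e i)) := by
    have h6 : ∑ i, (M i j - M j i) * (p i - G * (X i F - (∑ k, e k * X k F) * e i))
        = ∑ i, (M i j - M j i) * p i - ∑ i, (M i j - M j i) * (G * X i F)
          + G * (∑ k, e k * X k F) * ((∑ i, M i j * e i) - ∑ i, M j i * e i) := by
      generalize ∑ k, e k * X k F = c
      simp only [Finset.mul_sum, ← Finset.sum_sub_distrib, ← Finset.sum_add_distrib]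
      exact Finset.sum_congr rfl fun i _ => by ring
    rw [h6, h.rest_left, h.rest_right]
    simp only [mul_sub, sub_mul, add_mul, map_sub, map_add, Finset.sum_sub_distrib,
      Finset.sum_add_distrib] at h1 ⊢
    have e1 : ∀ a : ι → R, ∑ i, a i * (2 * V (Y i)) = 2 * ∑ i, a i * V (Y i) := fun a => by
      rw [Finset.mul_sum]; exact Finset.sum_congr rfl fun i _ => by ring
    rw [e1, e1]
    linear_combination 2 * h1
  rw [h5]
  refine sub_mem (sub_mem (sub_mem (sub_mem ?_ ?_) ?_) ?_) ?_
  · exact Ideal.mul_mem_left _ _ (h.X_mem_sq j h.trace_mem)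
  · rw [mul_assoc]
    exact Ideal.mul_mem_left _ _ (Ideal.mul_mem_right _ _ h.div_e_mem)
  · exact Ideal.sum_mem _ fun i _ => h.X_mem_sq i (h.rest_add_mem i j)
  · exact Ideal.sum_mem _ fun i _ => Ideal.mul_mem_right _ _ (h.rest_add_mem i j)
  · refine Ideal.sum_mem _ fun i _ => ?_
    rw [sq]
    exact Ideal.mul_mem_mul (sub_mem (rest_mem _ _) (rest_mem _ _)) (hp' i)

end RankOneOptics

end Twist

/-! ### Derivatives of the square of the remainder -/

section Twist

variable {ι R : Type*} [Fintype ι] [CommRing R] [Algebra ℝ R]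

namespace RankOneOptics

variable {X : ι → Derivation ℝ R R} {V : Derivation ℝ R R} {Y : ι → R} {F G : R} {e : ι → R}

local notation "M" => opticalRest X Y F e
local notation "J" => restIdeal X Y F e

theorem eq_zero_of_two_mul {a : R} (h : 2 * a = 0) : a = 0 := by
  obtain ⟨t, ht⟩ := exists_half R
  linear_combination t * h - a * ht

theorem twist_eq (h : RankOneOptics X V Y F G e) (i j : ι) :
    M i j - M j i = X j (Y i) - X i (Y j) := by
  rw [h.optical_eq i j, h.optical_eq j i]; ring

/-- The transversal derivative of the square of the twist is of second order. -/
theorem V_twist_sq_mem (h : RankOneOptics X V Y F G e) :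
    ∑ i, ∑ j, (M i j - M j i) * V (M i j - M j i) ∈ J ^ 2 := by
  set a : ι → ι → R := fun i j => M i j - M j i with ha
  have hskew : ∀ i j, a j i = -a i j := fun i j => by simp only [ha]; ring
  have hmem : ∀ i j, a i j ∈ J := fun i j => sub_mem (rest_mem _ _) (rest_mem _ _)
  set r : ι → R := fun i => 2 * V (Y i) - G * X i F with hr
  set W : ι → R := fun j => ∑ i, X i (a i j) with hW
  change ∑ i, ∑ j, a i j * V (a i j) ∈ J ^ 2
  have hcomm : ∀ i j f, X j (X i f) - X i (X j f) = -(a i j * V f) := fun i j f => by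
    have := h.twist_eq i j
    rw [h.comm_XX]
    simp only [ha]
    rw [this]; ring
  have hWmem : ∀ j, W j - ∑ i, a i j * r i ∈ J ^ 2 := h.div_twist_mem
  -- First evaluation of the double divergence: as `a` is skew, only the commutators of the `X i`
  -- survive.
  have hdiv : 2 * ∑ j, X j (W j) = -∑ i, ∑ j, a i j * V (a i j) := by
    have h1 : ∑ j, X j (W j) = ∑ i, ∑ j, X j (X i (a i j)) := by
      simp only [hW, map_sum]; exact Finset.sum_comm
    have h2 : ∑ j, X j (W j) = -∑ i, ∑ j, X i (X j (a i j)) := by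
      simp only [hW, map_sum]
      rw [← Finset.sum_neg_distrib]
      refine Finset.sum_congr rfl fun i _ => ?_
      rw [← Finset.sum_neg_distrib]
      exact Finset.sum_congr rfl fun j _ => by rw [hskew i j, map_neg, map_neg]
    rw [two_mul]
    nth_rw 1 [h1]
    rw [h2, ← sub_eq_add_neg, ← Finset.sum_sub_distrib, ← Finset.sum_neg_distrib]
    refine Finset.sum_congr rfl fun i _ => ?_
    rw [← Finset.sum_sub_distrib, ← Finset.sum_neg_distrib]
    exact Finset.sum_congr rfl fun j _ => by rw [hcomm]
  -- Modulo `J ^ 2` this is the skew `a i j` contracted with the symmetric `r i * r j`.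
  have hWr : ∑ j, W j * r j ∈ J ^ 2 := by
    have h0 : ∑ j, (∑ i, a i j * r i) * r j = 0 := by
      refine eq_zero_of_two_mul ?_
      have := two_mul_sum_skew (f := fun i j => r i * r j) hskew
      simp only [mul_comm (r _) (r _), sub_self, mul_zero, Finset.sum_const_zero] at this
      rw [← this, Finset.sum_comm]
      congr 1
      refine Finset.sum_congr rfl fun i _ => ?_
      rw [Finset.sum_mul]
      exact Finset.sum_congr rfl fun j _ => by ring
    rw [← sub_zero (∑ j, W j * r j), ← h0, ← Finset.sum_sub_distrib]
    refine Ideal.sum_mem _ fun j _ => ?_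
    rw [← sub_mul]
    exact Ideal.mul_mem_right _ _ (hWmem j)
  have hGF : ∀ j, X j G = -(G * G * X j F) := fun j => by
    have h1 := congrArg (X j) h.inv
    rw [Derivation.leibniz, Derivation.map_one_eq_zero, smul_eq_mul, smul_eq_mul] at h1
    linear_combination G * h1 - X j G * h.inv
  have hXX : ∑ i, ∑ j, a i j * X j (X i F) ∈ J ^ 2 := by
    refine mem_of_two_mul_mem ?_
    rw [two_mul_sum_skew hskew]
    refine Ideal.sum_mem _ fun i _ => Ideal.sum_mem _ fun j _ => ?_
    rw [hcomm, sq, mul_neg, ← mul_assoc]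
    exact neg_mem (Ideal.mul_mem_right _ _ (Ideal.mul_mem_mul (hmem _ _) (hmem _ _)))
  -- Exchanging `V` and `X j` costs `V (Y i) * V (Y j)`, which is symmetric and cancels against the
  -- skew `a`.
  have hq : 2 * ∑ i, ∑ j, a i j * X j (V (Y i)) = ∑ i, ∑ j, a i j * V (a i j) := by
    rw [two_mul_sum_skew hskew]
    refine Finset.sum_congr rfl fun i _ => Finset.sum_congr rfl fun j _ => ?_
    congr 1
    have h1 := h.comm_VX j (Y i)
    have h2 := h.comm_VX i (Y j)
    have h3 := h.twist_eq i j
    simp only [ha]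
    rw [h3, map_sub]
    linear_combination h2 - h1
  have hFF : ∑ i, ∑ j, a i j * (X j F * X i F) = 0 := by
    refine eq_zero_of_two_mul ?_
    rw [two_mul_sum_skew hskew]
    refine Finset.sum_eq_zero fun i _ => Finset.sum_eq_zero fun j _ => ?_
    ring
  have har : ∑ i, ∑ j, a i j * X j (r i) = ∑ i, ∑ j, a i j * V (a i j)
      - G * ∑ i, ∑ j, a i j * X j (X i F) + G * G * ∑ i, ∑ j, a i j * (X j F * X i F) := by
    rw [← hq]
    simp only [Finset.mul_sum, ← Finset.sum_sub_distrib, ← Finset.sum_add_distrib]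
    refine Finset.sum_congr rfl fun i _ => Finset.sum_congr rfl fun j _ => ?_
    have h2 : X j (2 : R) = 0 := by
      have := (X j).map_natCast 2
      simpa using this
    simp only [hr, map_sub, Derivation.leibniz, smul_eq_mul, hGF, h2]
    ring
  -- Second evaluation, from the divergence formula. With `Q = ∑ a V(a)`, the two results are `2 div
  -- W = -Q` and `div W ≡ Q`, hence `3 Q ∈ J ^ 2`.
  have hS : ∑ j, X j (W j) - ∑ i, ∑ j, a i j * V (a i j) ∈ J ^ 2 := by
    have h1 : ∑ j, X j (W j - ∑ i, a i j * r i) ∈ J ^ 2 :=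
      Ideal.sum_mem _ fun j _ => h.X_mem_sq j (hWmem j)
    have h2 : ∑ j, X j (∑ i, a i j * r i) = -∑ i, W i * r i + ∑ i, ∑ j, a i j * X j (r i) := by
      simp only [map_sum]
      rw [Finset.sum_comm, ← Finset.sum_neg_distrib, ← Finset.sum_add_distrib]
      refine Finset.sum_congr rfl fun i _ => ?_
      simp only [hW, Finset.sum_mul]
      rw [← Finset.sum_neg_distrib, ← Finset.sum_add_distrib]
      refine Finset.sum_congr rfl fun j _ => ?_
      rw [Derivation.leibniz, smul_eq_mul, smul_eq_mul, hskew j i, map_neg]; ring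
    simp only [map_sub, Finset.sum_sub_distrib] at h1
    rw [h2, har, hFF] at h1
    have h3 := add_mem (sub_mem h1 hWr) (neg_mem (Ideal.mul_mem_left _ G hXX))
    convert h3 using 1
    ring
  refine mem_of_smul_mem (c := 3) three_ne_zero ?_
  rw [map_ofNat]
  have h4 := Ideal.mul_mem_left _ (-2) hS
  convert h4 using 1
  linear_combination hdiv

theorem sum_rest_sq (a s : ι → ι → R) (δ : Derivation ℝ R R) (hM : ∀ i j, 2 * M i j = a i j + s i j) :
    2 * δ (∑ i, ∑ j, M i j * M i j) = ∑ i, ∑ j, (a i j * δ (a i j) + a i j * δ (s i j)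
      + s i j * δ (a i j) + s i j * δ (s i j)) := by
  simp only [map_sum, Finset.mul_sum]
  refine Finset.sum_congr rfl fun i _ => Finset.sum_congr rfl fun j _ => ?_
  have h1 := hM i j
  have h2 := congrArg δ h1
  have h3 : δ (2 : R) = 0 := by simpa using δ.map_natCast 2
  rw [map_add, Derivation.leibniz, h3, smul_zero, add_zero, smul_eq_mul] at h2
  rw [Derivation.leibniz, smul_eq_mul]
  linear_combination (2 * δ (M i j)) * h1 + (a i j + s i j) * h2

/-- Split `M` into skew and symmetric parts. Since the latter is in `J ^ 2`, its derivatives are in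
`J`, so every product that involves it is of second order; only the twist needs to be controlled. -/
theorem derivation_rest_sq_mem (h : RankOneOptics X V Y F G e) (δ : Derivation ℝ R R)
    (hδ : ∑ i, ∑ j, (M i j - M j i) * δ (M i j - M j i) ∈ J ^ 2) :
    δ (∑ i, ∑ j, M i j * M i j) ∈ J ^ 2 := by
  refine mem_of_two_mul_mem ?_
  rw [sum_rest_sq (fun i j => M i j - M j i) (fun i j => M i j + M j i) δ fun i j => by ring]
  simp only [add_assoc]
  simp only [Finset.sum_add_distrib]
  refine add_mem hδ (add_mem ?_ (add_mem ?_ ?_)) <;>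
    refine Ideal.sum_mem _ fun i _ => Ideal.sum_mem _ fun j _ => ?_
  · rw [sq]
    exact Ideal.mul_mem_mul (sub_mem (rest_mem _ _) (rest_mem _ _))
      (derivation_mem_of_mem_sq δ (h.rest_add_mem i j))
  · exact Ideal.mul_mem_right _ _ (h.rest_add_mem i j)
  · exact Ideal.mul_mem_right _ _ (h.rest_add_mem i j)

theorem X_rest_sq_mem (h : RankOneOptics X V Y F G e) (k : ι) :
    X k (∑ i, ∑ j, M i j * M i j) ∈ J ^ 2 := by
  simp only [map_sum]
  refine Ideal.sum_mem _ fun i _ => Ideal.sum_mem _ fun j _ => ?_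
  rw [Derivation.leibniz, smul_eq_mul, sq]
  exact add_mem (Ideal.mul_mem_mul (rest_mem _ _) (h.rigid.1 k i j))
    (Ideal.mul_mem_mul (rest_mem _ _) (h.rigid.1 k i j))

theorem V_rest_sq_mem (h : RankOneOptics X V Y F G e) :
    V (∑ i, ∑ j, M i j * M i j) ∈ J ^ 2 :=
  h.derivation_rest_sq_mem V h.V_twist_sq_mem

/-- Along the congruence, where the optical matrix satisfies the Sachs equation. -/
theorem sachs_rest_sq_mem (h : RankOneOptics X V Y F G e) (δ : Derivation ℝ R R)
    (hδ : ∀ i j, δ (X j (Y i)) = -∑ p, X p (Y i) * X j (Y p)) :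
    δ (∑ i, ∑ j, M i j * M i j) ∈ J ^ 2 := by
  refine h.derivation_rest_sq_mem δ (Ideal.sum_mem _ fun i _ => Ideal.sum_mem _ fun j _ => ?_)
  rw [sq]
  refine Ideal.mul_mem_mul (sub_mem (rest_mem _ _) (rest_mem _ _)) ?_
  have h1 : ∀ i j, ∑ p, X p (Y i) * X j (Y p) = ∑ p, M i p * M p j + F * F * e i * e j := by
    intro i j
    have : ∑ p, X p (Y i) * X j (Y p) = ∑ p, M i p * M p j + F * e j * (∑ p, M i p * e p)
        + F * e i * (∑ p, M p j * e p) + F * F * e i * e j * ∑ p, e p * e p := by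
      simp only [Finset.mul_sum, ← Finset.sum_add_distrib]
      exact Finset.sum_congr rfl fun p _ => by rw [h.optical_eq i, h.optical_eq p]; ring
    rw [this, h.rest_right, h.rest_left, h.unit]; ring
  -- The part of `L L` along `e eᵀ` is symmetric and cancels from the derivative of the twist.
  rw [h.twist_eq, map_sub, hδ, hδ, h1, h1]
  have h2 : ∀ i j, ∑ p, M i p * M p j ∈ J := fun i j =>
    Ideal.sum_mem _ fun p _ => Ideal.mul_mem_right _ _ (rest_mem _ _)
  have : -(∑ p, M i p * M p j + F * F * e i * e j) - -(∑ p, M j p * M p i + F * F * e j * e i)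
      = ∑ p, M j p * M p i - ∑ p, M i p * M p j := by ring
  rw [this]
  exact sub_mem (h2 _ _) (h2 _ _)

end RankOneOptics

end Twist

/-! ### Curvature over a differential ring -/

section FormalCurvature

variable {n : ℕ} {R : Type*} [CommRing R] [Algebra ℝ R] (δ : Fin n → Derivation ℝ R R)

/-- Christoffel symbols over a differential ring, for a metric `g` with inverse `gi`. -/
noncomputable def formalChristoffel (g gi : Fin n → Fin n → R) (c a b : Fin n) : R :=
  algebraMap ℝ R (1 / 2) * ∑ d, gi c d * (δ a (g d b) + δ b (g d a) - δ d (g a b))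

/-- Christoffel symbols with all indices down. -/
noncomputable def formalChristoffelLow (g : Fin n → Fin n → R) (e a b : Fin n) : R :=
  algebraMap ℝ R (1 / 2) * (δ a (g e b) + δ b (g e a) - δ e (g a b))

/-- The curvature tensor over a differential ring. -/
noncomputable def formalRiemannUp (g gi : Fin n → Fin n → R) (a b c d : Fin n) : R :=
  δ c (formalChristoffel δ g gi a d b) - δ d (formalChristoffel δ g gi a c b)
    + ∑ e, (formalChristoffel δ g gi a c e * formalChristoffel δ g gi e d b
      - formalChristoffel δ g gi a d e * formalChristoffel δ g gi e c b)

/-- The Riemann tensor with all indices down over a differential ring. -/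
noncomputable def formalRiemann (g gi : Fin n → Fin n → R) (a b c d : Fin n) : R :=
  ∑ e, g a e * formalRiemannUp δ g gi e b c d

/-- The Ricci tensor over a differential ring. -/
noncomputable def formalRicci (g gi : Fin n → Fin n → R) (b d : Fin n) : R :=
  ∑ a, formalRiemannUp δ g gi a b a d

variable {δ} {g gi : Fin n → Fin n → R}

theorem formalChristoffel_eq (c a b : Fin n) :
    formalChristoffel δ g gi c a b = ∑ d, gi c d * formalChristoffelLow δ g d a b := by
  simp only [formalChristoffel, formalChristoffelLow, Finset.mul_sum]
  exact Finset.sum_congr rfl fun d _ => by ring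

theorem sum_delta_mul {f : Fin n → R} (a : Fin n) :
    ∑ b, (if a = b then (1 : R) else 0) * f b = f a := by simp

theorem sum_metric_christoffel (hg : ∀ a b, ∑ e, g a e * gi e b = if a = b then 1 else 0)
    (e a b : Fin n) :
    ∑ c, g e c * formalChristoffel δ g gi c a b = formalChristoffelLow δ g e a b := by
  simp only [formalChristoffel_eq, Finset.mul_sum]
  rw [Finset.sum_comm, ← sum_delta_mul (f := fun d => formalChristoffelLow δ g d a b) e]
  refine Finset.sum_congr rfl fun d _ => ?_
  rw [← hg, Finset.sum_mul]
  exact Finset.sum_congr rfl fun c _ => by ring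

theorem formalChristoffelLow_add (hs : ∀ a b, g a b = g b a) (c a e : Fin n) :
    formalChristoffelLow δ g a c e + formalChristoffelLow δ g e c a = δ c (g a e) := by
  simp only [formalChristoffelLow]
  rw [hs e a, hs e c, hs a c]
  have : algebraMap ℝ R (1 / 2) * 2 = 1 := by
    rw [← map_ofNat (algebraMap ℝ R) 2, ← map_mul]; norm_num
  linear_combination δ c (g a e) * this

/-- Lowering the index under the derivative produces `δ c (g a e)`, which metric compatibility
splits into two Christoffel symbols. One cancels the quadratic term of the definition, the other
replaces it. The inverse metric is then never differentiated. -/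
theorem formalRiemann_eq (hs : ∀ a b, g a b = g b a)
    (hg : ∀ a b, ∑ e, g a e * gi e b = if a = b then 1 else 0) (a b c d : Fin n) :
    formalRiemann δ g gi a b c d
      = δ c (formalChristoffelLow δ g a d b) - δ d (formalChristoffelLow δ g a c b)
        - ∑ e, ∑ f, gi e f * (formalChristoffelLow δ g e c a * formalChristoffelLow δ g f d b
          - formalChristoffelLow δ g e d a * formalChristoffelLow δ g f c b) := by
  have h1 : ∀ c d, δ c (formalChristoffelLow δ g a d b)
      = ∑ e, (δ c (g a e) * formalChristoffel δ g gi e d b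
        + g a e * δ c (formalChristoffel δ g gi e d b)) := fun c d => by
    rw [← sum_metric_christoffel hg, map_sum]
    exact Finset.sum_congr rfl fun e _ => by
      rw [Derivation.leibniz, smul_eq_mul, smul_eq_mul]; ring
  have h2 : ∀ c d, ∑ e, g a e * ∑ f, formalChristoffel δ g gi e c f * formalChristoffel δ g gi f d b
      = ∑ f, formalChristoffelLow δ g a c f * formalChristoffel δ g gi f d b := fun c d => by
    simp only [Finset.mul_sum]
    rw [Finset.sum_comm]
    refine Finset.sum_congr rfl fun f _ => ?_
    rw [← sum_metric_christoffel hg a c f, Finset.sum_mul]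
    exact Finset.sum_congr rfl fun e _ => by ring
  have h3 : ∀ c d, ∑ e, ∑ f, gi e f * (formalChristoffelLow δ g e c a
        * formalChristoffelLow δ g f d b)
      = ∑ e, formalChristoffelLow δ g e c a * formalChristoffel δ g gi e d b := fun c d => by
    refine Finset.sum_congr rfl fun e _ => ?_
    rw [formalChristoffel_eq, Finset.mul_sum]
    exact Finset.sum_congr rfl fun f _ => by ring
  have h4 : formalRiemann δ g gi a b c d
      = ∑ e, g a e * δ c (formalChristoffel δ g gi e d b)
        - ∑ e, g a e * δ d (formalChristoffel δ g gi e c b)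
        + (∑ e, g a e * ∑ f, formalChristoffel δ g gi e c f * formalChristoffel δ g gi f d b
        - ∑ e, g a e * ∑ f, formalChristoffel δ g gi e d f * formalChristoffel δ g gi f c b) := by
    simp only [formalRiemann, formalRiemannUp, ← Finset.sum_sub_distrib, ← Finset.sum_add_distrib,
      ← mul_sub, ← mul_add]
  have h5 : ∑ e, ∑ f, gi e f * (formalChristoffelLow δ g e c a * formalChristoffelLow δ g f d b
          - formalChristoffelLow δ g e d a * formalChristoffelLow δ g f c b)
      = ∑ e, formalChristoffelLow δ g e c a * formalChristoffel δ g gi e d b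
        - ∑ e, formalChristoffelLow δ g e d a * formalChristoffel δ g gi e c b := by
    rw [← h3, ← h3]
    simp only [← Finset.sum_sub_distrib, ← mul_sub]
  rw [h4, h5, h1, h1, h2, h2]
  simp only [← Finset.sum_sub_distrib, ← Finset.sum_add_distrib]
  refine Finset.sum_congr rfl fun e _ => ?_
  rw [← formalChristoffelLow_add hs c a e, ← formalChristoffelLow_add hs d a e]
  ring

theorem formalRicci_eq (hg : ∀ a b, ∑ e, gi a e * g e b = if a = b then 1 else 0) (b d : Fin n) :
    formalRicci δ g gi b d = ∑ a, ∑ e, gi a e * formalRiemann δ g gi e b a d := by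
  refine Finset.sum_congr rfl fun a _ => ?_
  simp only [formalRiemann, Finset.mul_sum]
  rw [Finset.sum_comm, ← sum_delta_mul (f := fun c => formalRiemannUp δ g gi c b a d) a]
  refine Finset.sum_congr rfl fun c _ => ?_
  rw [← hg, Finset.sum_mul]
  exact Finset.sum_congr rfl fun e _ => by ring

end FormalCurvature

/-! ### Contraction with vectors -/

section Contraction

variable {n : ℕ} {R : Type*} [CommRing R]

/-- Contraction of the components of a tensor of rank four with four vectors. -/
def contract4 (T : Fin n → Fin n → Fin n → Fin n → R) (u v w z : Fin n → R) : R :=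
  ∑ a, ∑ b, ∑ c, ∑ d, T a b c d * u a * v b * w c * z d

theorem sum_single_mul {f : (Fin n → R) → R} (hf : IsLinearMap R f) (v : Fin n → R) :
    ∑ a, f (Pi.single a 1) * v a = f v := by
  have := LinearMap.pi_apply_eq_sum_univ hf.mk' v
  simp only [IsLinearMap.mk'_apply, smul_eq_mul] at this
  rw [this]
  refine Finset.sum_congr rfl fun a _ => ?_
  rw [mul_comm]
  congr 2
  ext b
  simp [Pi.single_apply, eq_comm]

/-- This lets the curvature be evaluated on frame vectors through a closed multilinear expression
that is compared with the definition on coordinate vectors only. -/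
theorem contract4_eq {T : Fin n → Fin n → Fin n → Fin n → R}
    {f : (Fin n → R) → (Fin n → R) → (Fin n → R) → (Fin n → R) → R}
    (h1 : ∀ v w z, IsLinearMap R fun u => f u v w z)
    (h2 : ∀ u w z, IsLinearMap R fun v => f u v w z)
    (h3 : ∀ u v z, IsLinearMap R fun w => f u v w z)
    (h4 : ∀ u v w, IsLinearMap R fun z => f u v w z)
    (hT : ∀ a b c d, T a b c d
      = f (Pi.single a 1) (Pi.single b 1) (Pi.single c 1) (Pi.single d 1)) (u v w z : Fin n → R) :
    contract4 T u v w z = f u v w z := by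
  rw [← sum_single_mul (h1 v w z)]
  refine Finset.sum_congr rfl fun a _ => ?_
  rw [← sum_single_mul (h2 _ w z), Finset.sum_mul]
  refine Finset.sum_congr rfl fun b _ => ?_
  rw [← sum_single_mul (h3 _ _ z), Finset.sum_mul, Finset.sum_mul]
  refine Finset.sum_congr rfl fun c _ => ?_
  rw [← sum_single_mul (h4 _ _ _), Finset.sum_mul, Finset.sum_mul, Finset.sum_mul]
  exact Finset.sum_congr rfl fun d _ => by rw [hT]; ring

end Contraction

/-! ### Null frames of the flat background -/

section KSFrame

variable {n : ℕ} {ι R : Type*} [Fintype ι] [DecidableEq ι] [CommRing R] [Algebra ℝ R]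

/-- The derivative of `f` along `v`. -/
def along (δ : Fin n → Derivation ℝ R R) (v : Fin n → R) : Derivation ℝ R R := ∑ a, v a • δ a

/-- The second derivative of `f` in flat coordinates. -/
def hess (δ : Fin n → Derivation ℝ R R) (f : R) (v w : Fin n → R) : R :=
  ∑ a, ∑ b, v a * w b * δ a (δ b f)

/-- The scalar product of a diagonal metric. -/
def dot (η v w : Fin n → R) : R := ∑ a, η a * v a * w a

/-- A null frame `(D, U, X_i)` of a flat metric, with `U` constant, adapted to the null
direction with parameters `Y_i`. -/
structure FlatNullFrame (δ : Fin n → Derivation ℝ R R) (η D U : Fin n → R) (X : ι → Fin n → R)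
    (Y : ι → R) : Prop where
  comm : ∀ a b f, δ a (δ b f) = δ b (δ a f)
  const : ∀ a b, δ a (η b) = 0
  sq : ∀ a, η a * η a = 1
  dU : ∀ a b, δ a (U b) = 0
  dX : ∀ a i b, δ a (X i b) = -(δ a (Y i) * U b)
  dD : ∀ a b, δ a (D b) = ∑ i, δ a (Y i) * X i b
  DD : dot η D D = 0
  DU : dot η D U = 1
  UU : dot η U U = 0
  DX : ∀ i, dot η D (X i) = 0
  UX : ∀ i, dot η U (X i) = 0
  XX : ∀ i j, dot η (X i) (X j) = if i = j then 1 else 0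
  complete : ∀ a b, D a * U b + U a * D b + ∑ i, X i a * X i b = if a = b then η a else 0

variable {δ : Fin n → Derivation ℝ R R} {η D U : Fin n → R} {X : ι → Fin n → R} {Y : ι → R}

theorem along_apply (v : Fin n → R) (f : R) : along δ v f = ∑ a, v a * δ a f := by
  have : ∀ (s : Finset (Fin n)), (∑ a ∈ s, v a • δ a) f = ∑ a ∈ s, v a * δ a f := fun s => by
    classical
    induction s using Finset.induction_on with
    | empty => simp
    | insert a s ha ih => rw [Finset.sum_insert ha, Finset.sum_insert ha, ← ih]; simp
  exact this _

theorem along_add (v w : Fin n → R) (f : R) : along δ (v + w) f = along δ v f + along δ w f := by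
  simp only [along_apply, ← Finset.sum_add_distrib, Pi.add_apply, add_mul]

theorem along_smul (c : R) (v : Fin n → R) (f : R) : along δ (c • v) f = c * along δ v f := by
  simp only [along_apply, Finset.mul_sum, Pi.smul_apply, smul_eq_mul, mul_assoc]

theorem along_single (a : Fin n) (f : R) : along δ (Pi.single a 1) f = δ a f := by
  simp [along_apply, Pi.single_apply]

theorem hess_add_left (f : R) (v v' w : Fin n → R) :
    hess δ f (v + v') w = hess δ f v w + hess δ f v' w := by
  simp only [hess, ← Finset.sum_add_distrib, Pi.add_apply, add_mul]

theorem hess_smul_left (f c : R) (v w : Fin n → R) :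
    hess δ f (c • v) w = c * hess δ f v w := by
  simp only [hess, Finset.mul_sum, Pi.smul_apply, smul_eq_mul, mul_assoc]

theorem hess_add_right (f : R) (v w w' : Fin n → R) :
    hess δ f v (w + w') = hess δ f v w + hess δ f v w' := by
  simp only [hess, ← Finset.sum_add_distrib, Pi.add_apply, add_mul, mul_add]

theorem hess_smul_right (f c : R) (v w : Fin n → R) :
    hess δ f v (c • w) = c * hess δ f v w := by
  simp only [hess, Finset.mul_sum, Pi.smul_apply, smul_eq_mul]
  exact Finset.sum_congr rfl fun a _ => Finset.sum_congr rfl fun b _ => by ring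

theorem hess_single (f : R) (a b : Fin n) :
    hess δ f (Pi.single a 1) (Pi.single b 1) = δ a (δ b f) := by
  simp [hess, Pi.single_apply]

theorem dot_add_right (v w w' : Fin n → R) : dot η v (w + w') = dot η v w + dot η v w' := by
  simp only [dot, ← Finset.sum_add_distrib, Pi.add_apply, mul_add]

theorem dot_smul_right (c : R) (v w : Fin n → R) : dot η v (c • w) = c * dot η v w := by
  simp only [dot, Finset.mul_sum, Pi.smul_apply, smul_eq_mul]
  exact Finset.sum_congr rfl fun a _ => by ring

theorem dot_comm (v w : Fin n → R) : dot η v w = dot η w v :=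
  Finset.sum_congr rfl fun a _ => by ring

theorem dot_single (v : Fin n → R) (a : Fin n) : dot η v (Pi.single a 1) = η a * v a := by
  simp [dot, Pi.single_apply]

namespace FlatNullFrame

theorem hess_comm (h : FlatNullFrame δ η D U X Y) (f : R) (v w : Fin n → R) :
    hess δ f v w = hess δ f w v := by
  unfold hess
  rw [Finset.sum_comm]
  exact Finset.sum_congr rfl fun a _ => Finset.sum_congr rfl fun b _ => by rw [h.comm]; ring

theorem along_along (v w : Fin n → R) (f : R) :
    along δ v (along δ w f) = hess δ f v w + ∑ b, along δ v (w b) * δ b f := by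
  rw [along_apply w, map_sum, hess, Finset.sum_comm, ← Finset.sum_add_distrib]
  refine Finset.sum_congr rfl fun b _ => ?_
  rw [Derivation.leibniz, smul_eq_mul, smul_eq_mul, along_apply v (δ b f), Finset.mul_sum]
  congr 1
  · exact Finset.sum_congr rfl fun a _ => by ring
  · ring

/-- No correction appears because `U` is constant; for `X i` and `D` the correction comes from `dX`
and `dD`. These three rules yield all commutators of the frame. -/
theorem along_U (h : FlatNullFrame δ η D U X Y) (v : Fin n → R) (f : R) :
    along δ v (along δ U f) = hess δ f v U := by
  rw [along_along]
  simp [along_apply, h.dU]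

theorem along_X (h : FlatNullFrame δ η D U X Y) (v : Fin n → R) (i : ι) (f : R) :
    along δ v (along δ (X i) f) = hess δ f v (X i) - along δ v (Y i) * along δ U f := by
  rw [along_along, sub_eq_add_neg]
  congr 1
  rw [along_apply U, Finset.mul_sum, ← Finset.sum_neg_distrib]
  refine Finset.sum_congr rfl fun b _ => ?_
  have : along δ v (X i b) = -(along δ v (Y i) * U b) := by
    simp only [along_apply, h.dX, Finset.sum_mul, ← Finset.sum_neg_distrib]
    exact Finset.sum_congr rfl fun b _ => by ring
  rw [this]; ring

theorem along_D (h : FlatNullFrame δ η D U X Y) (v : Fin n → R) (f : R) :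
    along δ v (along δ D f) = hess δ f v D + ∑ i, along δ v (Y i) * along δ (X i) f := by
  rw [along_along]
  congr 1
  simp only [along_apply (X _), Finset.mul_sum]
  rw [Finset.sum_comm]
  refine Finset.sum_congr rfl fun b _ => ?_
  have : along δ v (D b) = ∑ i, along δ v (Y i) * X i b := by
    simp only [along_apply, h.dD, Finset.mul_sum, Finset.sum_mul]
    rw [Finset.sum_comm]
    exact Finset.sum_congr rfl fun b _ => Finset.sum_congr rfl fun b _ => by ring
  rw [this, Finset.sum_mul]
  exact Finset.sum_congr rfl fun i _ => by ring

/-- A coordinate derivative in terms of derivatives along the frame. -/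
theorem coord_eq (h : FlatNullFrame δ η D U X Y) (a : Fin n) (f : R) :
    δ a f = η a * (D a * along δ U f + U a * along δ D f + ∑ i, X i a * along δ (X i) f) := by
  have h1 : ∑ b, (if a = b then η a else 0) * δ b f = η a * δ a f := by simp
  have h2 : ∑ b, (if a = b then η a else 0) * δ b f
      = D a * along δ U f + U a * along δ D f + ∑ i, X i a * along δ (X i) f := by
    simp only [along_apply, ← h.complete a, Finset.mul_sum, add_mul, Finset.sum_add_distrib,
      Finset.sum_mul]
    congr 1
    · congr 1 <;> exact Finset.sum_congr rfl fun b _ => by ring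
    · rw [Finset.sum_comm]
      exact Finset.sum_congr rfl fun b _ => Finset.sum_congr rfl fun b _ => by ring
  rw [← h2, h1, ← mul_assoc, h.sq, one_mul]

end FlatNullFrame

end KSFrame

/-! ### The Riemann tensor of a Kerr–Schild metric -/

section KSCurvature

variable {n : ℕ} {ι R : Type*} [Fintype ι] [DecidableEq ι] [CommRing R] [Algebra ℝ R]

/-- The Kerr-Schild metric `η - 2 h k k` over a differential ring. -/
def ksLow (η D : Fin n → R) (h : R) (a b : Fin n) : R :=
  (if a = b then η a else 0) - 2 * (h * (η a * D a) * (η b * D b))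

/-- The inverse of the Kerr-Schild metric. -/
def ksUp (η D : Fin n → R) (h : R) (a b : Fin n) : R :=
  (if a = b then η a else 0) + 2 * h * D a * D b

variable (δ : Fin n → Derivation ℝ R R) (η D U : Fin n → R) (X : ι → Fin n → R) (Y : ι → R) (h : R)

/-- The derivative of the null covector, `K(v, w) = v^a w^b ∂_b k_a`. -/
def nullD (v w : Fin n → R) : R := ∑ i, dot η (X i) v * along δ w (Y i)

/-- The second derivative of the null covector, `v^a w^b y^c ∂_c ∂_b k_a`. -/
def nullDD (v w y : Fin n → R) : R :=
  ∑ i, dot η (X i) v * hess δ (Y i) w y - dot η U v * ∑ i, along δ w (Y i) * along δ y (Y i)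

/-- The derivative along `c` of `h k_e k_a`. -/
def perturbD (e a c : Fin n → R) : R :=
  along δ c h * dot η D e * dot η D a
    + h * (nullD δ η X Y e c * dot η D a + dot η D e * nullD δ η X Y a c)

/-- The second derivative along `b` and `c` of `h k_a k_d`. -/
def perturbDD (a d b c : Fin n → R) : R :=
  hess δ h b c * dot η D a * dot η D d
    + along δ b h * (nullD δ η X Y a c * dot η D d + dot η D a * nullD δ η X Y d c)
    + along δ c h * (nullD δ η X Y a b * dot η D d + dot η D a * nullD δ η X Y d b)
    + h * (nullDD δ η U X Y a b c * dot η D d + dot η D a * nullDD δ η U X Y d b c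
      + nullD δ η X Y a b * nullD δ η X Y d c + nullD δ η X Y a c * nullD δ η X Y d b)

/-- Christoffel symbols of a Kerr-Schild metric with all indices down, contracted with vectors. -/
def ksGamma (e c a : Fin n → R) : R :=
  -(perturbD δ η D X Y h e a c + perturbD δ η D X Y h e c a - perturbD δ η D X Y h c a e)

/-- The contraction of two Christoffel symbols of a Kerr-Schild metric. -/
def ksGammaSq (c a d b : Fin n → R) : R :=
  ksGamma δ η D X Y h D c a * ksGamma δ η D X Y h U d b
    + ksGamma δ η D X Y h U c a * ksGamma δ η D X Y h D d b
    + 2 * h * (ksGamma δ η D X Y h D c a * ksGamma δ η D X Y h D d b)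
    + ∑ p, ksGamma δ η D X Y h (X p) c a * ksGamma δ η D X Y h (X p) d b

/-- The Riemann tensor of a Kerr-Schild metric, contracted with vectors. -/
def ksRiemann (a b c d : Fin n → R) : R :=
  -(perturbDD δ η D U X Y h a d b c - perturbDD δ η D U X Y h d b a c
      - perturbDD δ η D U X Y h a c b d + perturbDD δ η D U X Y h c b a d)
    - (ksGammaSq δ η D U X Y h c a d b - ksGammaSq δ η D U X Y h d a c b)

/-! ### Multilinearity of the curvature expression -/

section Linear

theorem nullD_add_left (v v' w : Fin n → R) :
    nullD δ η X Y (v + v') w = nullD δ η X Y v w + nullD δ η X Y v' w := by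
  simp only [nullD, dot_add_right, add_mul, Finset.sum_add_distrib]

theorem nullD_smul_left (c : R) (v w : Fin n → R) :
    nullD δ η X Y (c • v) w = c * nullD δ η X Y v w := by
  simp only [nullD, dot_smul_right, mul_assoc, Finset.mul_sum]

theorem nullD_add_right (v w w' : Fin n → R) :
    nullD δ η X Y v (w + w') = nullD δ η X Y v w + nullD δ η X Y v w' := by
  simp only [nullD, along_add, mul_add, Finset.sum_add_distrib]

theorem nullD_smul_right (c : R) (v w : Fin n → R) :
    nullD δ η X Y v (c • w) = c * nullD δ η X Y v w := by
  simp only [nullD, along_smul, Finset.mul_sum]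
  exact Finset.sum_congr rfl fun _ _ => by ring

theorem nullDD_add₁ (v v' w y : Fin n → R) :
    nullDD δ η U X Y (v + v') w y = nullDD δ η U X Y v w y + nullDD δ η U X Y v' w y := by
  simp only [nullDD, dot_add_right, add_mul, Finset.sum_add_distrib]
  ring

theorem nullDD_smul₁ (c : R) (v w y : Fin n → R) :
    nullDD δ η U X Y (c • v) w y = c * nullDD δ η U X Y v w y := by
  simp only [nullDD, dot_smul_right, mul_assoc, mul_sub, Finset.mul_sum]

theorem nullDD_add₂ (v w w' y : Fin n → R) :
    nullDD δ η U X Y v (w + w') y = nullDD δ η U X Y v w y + nullDD δ η U X Y v w' y := by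
  simp only [nullDD, along_add, hess_add_left, add_mul, mul_add, Finset.sum_add_distrib]
  ring

theorem nullDD_smul₂ (c : R) (v w y : Fin n → R) :
    nullDD δ η U X Y v (c • w) y = c * nullDD δ η U X Y v w y := by
  simp only [nullDD, along_smul, hess_smul_left, mul_sub, Finset.mul_sum]
  congr 1 <;> exact Finset.sum_congr rfl fun _ _ => by ring

theorem nullDD_add₃ (v w y y' : Fin n → R) :
    nullDD δ η U X Y v w (y + y') = nullDD δ η U X Y v w y + nullDD δ η U X Y v w y' := by
  simp only [nullDD, along_add, hess_add_right, mul_add, Finset.sum_add_distrib]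
  ring

theorem nullDD_smul₃ (c : R) (v w y : Fin n → R) :
    nullDD δ η U X Y v w (c • y) = c * nullDD δ η U X Y v w y := by
  simp only [nullDD, along_smul, hess_smul_right, mul_sub, Finset.mul_sum]
  congr 1 <;> exact Finset.sum_congr rfl fun _ _ => by ring

theorem ksGamma_linear₁ (c a : Fin n → R) : IsLinearMap R fun e => ksGamma δ η D X Y h e c a where
  map_add x y := by
    simp only [ksGamma, perturbD, nullD_add_left, nullD_add_right, along_add, dot_add_right]; ring
  map_smul r x := by
    simp only [ksGamma, perturbD, nullD_smul_left, nullD_smul_right, along_smul, dot_smul_right,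
      smul_eq_mul]
    ring

theorem ksGamma_linear₂ (e a : Fin n → R) : IsLinearMap R fun c => ksGamma δ η D X Y h e c a where
  map_add x y := by
    simp only [ksGamma, perturbD, nullD_add_left, nullD_add_right, along_add, dot_add_right]; ring
  map_smul r x := by
    simp only [ksGamma, perturbD, nullD_smul_left, nullD_smul_right, along_smul, dot_smul_right,
      smul_eq_mul]
    ring

theorem ksGamma_linear₃ (e c : Fin n → R) : IsLinearMap R fun a => ksGamma δ η D X Y h e c a where
  map_add x y := by
    simp only [ksGamma, perturbD, nullD_add_left, nullD_add_right, along_add, dot_add_right]; ring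
  map_smul r x := by
    simp only [ksGamma, perturbD, nullD_smul_left, nullD_smul_right, along_smul, dot_smul_right,
      smul_eq_mul]
    ring

theorem ksGammaSq_linear₁ (a d b : Fin n → R) :
    IsLinearMap R fun c => ksGammaSq δ η D U X Y h c a d b where
  map_add x y := by
    simp only [ksGammaSq, (ksGamma_linear₂ δ η D X Y h _ _).map_add, add_mul,
      Finset.sum_add_distrib]; ring
  map_smul r x := by
    simp only [ksGammaSq, (ksGamma_linear₂ δ η D X Y h _ _).map_smul, smul_eq_mul, mul_add,
      Finset.mul_sum, mul_assoc]; ring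

theorem ksGammaSq_linear₂ (c d b : Fin n → R) :
    IsLinearMap R fun a => ksGammaSq δ η D U X Y h c a d b where
  map_add x y := by
    simp only [ksGammaSq, (ksGamma_linear₃ δ η D X Y h _ _).map_add, add_mul,
      Finset.sum_add_distrib]; ring
  map_smul r x := by
    simp only [ksGammaSq, (ksGamma_linear₃ δ η D X Y h _ _).map_smul, smul_eq_mul, mul_add,
      Finset.mul_sum, mul_assoc]; ring

theorem ksGammaSq_comm (c a d b : Fin n → R) :
    ksGammaSq δ η D U X Y h c a d b = ksGammaSq δ η D U X Y h d b c a := by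
  simp only [ksGammaSq, mul_comm (ksGamma δ η D X Y h (X _) c a)]
  ring

theorem ksGammaSq_linear₃ (c a b : Fin n → R) :
    IsLinearMap R fun d => ksGammaSq δ η D U X Y h c a d b := by
  simp only [ksGammaSq_comm δ η D U X Y h c a]
  exact ksGammaSq_linear₁ ..

theorem ksGammaSq_linear₄ (c a d : Fin n → R) :
    IsLinearMap R fun b => ksGammaSq δ η D U X Y h c a d b := by
  simp only [ksGammaSq_comm δ η D U X Y h c a]
  exact ksGammaSq_linear₂ ..

theorem ksRiemann_linear₁ (b c d : Fin n → R) :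
    IsLinearMap R fun a => ksRiemann δ η D U X Y h a b c d where
  map_add x y := by
    simp only [ksRiemann, perturbDD, nullD_add_left, nullD_add_right, nullDD_add₁, nullDD_add₂,
      along_add, dot_add_right, hess_add_left,
      (ksGammaSq_linear₂ δ η D U X Y h _ _ _).map_add]
    ring
  map_smul r x := by
    simp only [ksRiemann, perturbDD, nullD_smul_left, nullD_smul_right, nullDD_smul₁, nullDD_smul₂,
      along_smul, dot_smul_right, hess_smul_left,
      (ksGammaSq_linear₂ δ η D U X Y h _ _ _).map_smul, smul_eq_mul]
    ring

theorem ksRiemann_linear₂ (a c d : Fin n → R) :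
    IsLinearMap R fun b => ksRiemann δ η D U X Y h a b c d where
  map_add x y := by
    simp only [ksRiemann, perturbDD, nullD_add_left, nullD_add_right, nullDD_add₁, nullDD_add₂,
      along_add, dot_add_right, hess_add_left,
      (ksGammaSq_linear₄ δ η D U X Y h _ _ _).map_add]
    ring
  map_smul r x := by
    simp only [ksRiemann, perturbDD, nullD_smul_left, nullD_smul_right, nullDD_smul₁, nullDD_smul₂,
      along_smul, dot_smul_right, hess_smul_left,
      (ksGammaSq_linear₄ δ η D U X Y h _ _ _).map_smul, smul_eq_mul]
    ring

theorem ksRiemann_linear₃ (a b d : Fin n → R) :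
    IsLinearMap R fun c => ksRiemann δ η D U X Y h a b c d where
  map_add x y := by
    simp only [ksRiemann, perturbDD, nullD_add_left, nullD_add_right, nullDD_add₁,
      nullDD_add₃, along_add, dot_add_right, hess_add_right,
      (ksGammaSq_linear₁ δ η D U X Y h _ _ _).map_add,
      (ksGammaSq_linear₃ δ η D U X Y h _ _ _).map_add]
    ring
  map_smul r x := by
    simp only [ksRiemann, perturbDD, nullD_smul_left, nullD_smul_right, nullDD_smul₁,
      nullDD_smul₃, along_smul, dot_smul_right, hess_smul_right,
      (ksGammaSq_linear₁ δ η D U X Y h _ _ _).map_smul,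
      (ksGammaSq_linear₃ δ η D U X Y h _ _ _).map_smul, smul_eq_mul]
    ring

theorem ksRiemann_swap (a b c d : Fin n → R) :
    ksRiemann δ η D U X Y h a b d c = -ksRiemann δ η D U X Y h a b c d := by
  simp only [ksRiemann]; ring

theorem ksRiemann_linear₄ (a b c : Fin n → R) :
    IsLinearMap R fun d => ksRiemann δ η D U X Y h a b c d := by
  have h1 := ksRiemann_linear₃ δ η D U X Y h a b c
  have h2 : (fun d => ksRiemann δ η D U X Y h a b c d)
      = fun d => -ksRiemann δ η D U X Y h a b d c :=
    funext fun d => ksRiemann_swap δ η D U X Y h a b d c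
  rw [h2]
  exact ⟨fun x y => by rw [h1.map_add]; ring,
    fun r x => by rw [h1.map_smul, smul_eq_mul, smul_eq_mul]; ring⟩

end Linear

variable {δ η D U X Y}

theorem diag_comm (η : Fin n → R) (a b : Fin n) :
    (if a = b then η a else 0) = if b = a then η b else 0 := by
  by_cases hab : a = b
  · subst hab; rfl
  · rw [if_neg hab, if_neg (Ne.symm hab)]

theorem ksLow_symm (a b : Fin n) : ksLow η D h a b = ksLow η D h b a := by
  simp only [ksLow, diag_comm η a b]; ring

theorem ksUp_symm (a b : Fin n) : ksUp η D h a b = ksUp η D h b a := by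
  simp only [ksUp, diag_comm η a b]; ring

namespace FlatNullFrame

/-- The terms linear in `h` cancel, and the quadratic one carries the factor `dot η D D = 0`. -/
theorem ks_mul (H : FlatNullFrame δ η D U X Y) (a b : Fin n) :
    ∑ e, ksLow η D h a e * ksUp η D h e b = if a = b then 1 else 0 := by
  have h1 : ∑ e, ksLow η D h a e * ksUp η D h e b
      = (if a = b then η a * η a else 0) + 2 * h * η a * D a * D b
        - 2 * (h * (η a * D a) * (η b * η b * D b)) - 4 * (h * h * η a * D a * D b) * dot η D D := by
    have : ∀ e, ksLow η D h a e * ksUp η D h e b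
        = (if a = e then η a else 0) * (if e = b then η e else 0)
          + (if a = e then η a else 0) * (2 * h * D e * D b)
          - (2 * (h * (η a * D a) * (η e * D e))) * (if e = b then η e else 0)
          - 4 * (h * h * η a * D a * D b) * (η e * D e * D e) := fun e => by
      simp only [ksLow, ksUp]; ring
    simp only [this, Finset.sum_sub_distrib, Finset.sum_add_distrib, ← Finset.mul_sum, ite_mul,
      zero_mul, mul_ite, mul_zero, Finset.sum_ite_eq, Finset.sum_ite_eq', Finset.mem_univ, if_true,
      dot]
    split_ifs with hab
    · subst hab; ring
    · ring
  rw [h1, H.DD, H.sq, H.sq]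
  ring

theorem ks_mul' (H : FlatNullFrame δ η D U X Y) (a b : Fin n) :
    ∑ e, ksUp η D h a e * ksLow η D h e b = if a = b then 1 else 0 := by
  have h1 := H.ks_mul h b a
  have h2 : (if b = a then (1 : R) else 0) = if a = b then 1 else 0 := by simp only [eq_comm]
  rw [← h2, ← h1]
  refine Finset.sum_congr rfl fun e _ => ?_
  rw [ksUp_symm, ksLow_symm, mul_comm]

theorem d_null (H : FlatNullFrame δ η D U X Y) (a b : Fin n) :
    δ b (η a * D a) = nullD δ η X Y (Pi.single a 1) (Pi.single b 1) := by
  simp only [nullD, dot_single, along_single, Derivation.leibniz, H.const, H.dD, smul_eq_mul,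
    Finset.mul_sum, mul_zero, add_zero]
  exact Finset.sum_congr rfl fun i _ => by ring

theorem dd_null (H : FlatNullFrame δ η D U X Y) (a b c : Fin n) :
    δ c (nullD δ η X Y (Pi.single a 1) (Pi.single b 1))
      = nullDD δ η U X Y (Pi.single a 1) (Pi.single b 1) (Pi.single c 1) := by
  simp only [nullD, nullDD, dot_single, along_single, Derivation.leibniz, H.const, H.dX,
    smul_eq_mul, Finset.mul_sum, mul_zero, add_zero, map_sum, hess_single,
    ← Finset.sum_sub_distrib]
  exact Finset.sum_congr rfl fun i _ => by rw [H.comm c b]; ring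

theorem d_perturb (H : FlatNullFrame δ η D U X Y) (a b c : Fin n) :
    δ c (h * (η a * D a) * (η b * D b))
      = perturbD δ η D X Y h (Pi.single a 1) (Pi.single b 1) (Pi.single c 1) := by
  have h1 := H.d_null a c
  have h2 := H.d_null b c
  simp only [perturbD, dot_single, along_single]
  generalize η a * D a = k at *
  generalize η b * D b = l at *
  simp only [Derivation.leibniz, smul_eq_mul, h1, h2]
  ring

theorem dd_perturb (H : FlatNullFrame δ η D U X Y) (a d b c : Fin n) :
    δ c (perturbD δ η D X Y h (Pi.single a 1) (Pi.single d 1) (Pi.single b 1))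
      = perturbDD δ η D U X Y h (Pi.single a 1) (Pi.single d 1) (Pi.single b 1)
        (Pi.single c 1) := by
  have h1 := H.d_null a c
  have h2 := H.d_null d c
  simp only [perturbD, perturbDD, dot_single, along_single, hess_single]
  generalize η a * D a = k at *
  generalize η d * D d = l at *
  simp only [map_add, Derivation.leibniz, smul_eq_mul, h1, h2, H.dd_null]
  rw [H.comm c b]
  ring

theorem christoffelLow_eq (H : FlatNullFrame δ η D U X Y) (e a b : Fin n) :
    formalChristoffelLow δ (ksLow η D h) e a b
      = ksGamma δ η D X Y h (Pi.single e 1) (Pi.single a 1) (Pi.single b 1) := by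
  have h1 : ∀ a b c, δ c (ksLow η D h a b)
      = -(2 * perturbD δ η D X Y h (Pi.single a 1) (Pi.single b 1) (Pi.single c 1)) := by
    intro a b c
    have h2 : δ c (2 : R) = 0 := by simpa using (δ c).map_natCast 2
    have h3 : δ c (if a = b then η a else 0) = 0 := by split_ifs <;> simp [H.const]
    simp only [ksLow]
    rw [map_sub, h3, Derivation.leibniz, h2, H.d_perturb, smul_eq_mul, smul_zero]
    ring
  have : algebraMap ℝ R (1 / 2) * 2 = 1 := by
    rw [← map_ofNat (algebraMap ℝ R) 2, ← map_mul]; norm_num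
  rw [formalChristoffelLow, h1, h1, h1, ksGamma]
  linear_combination (-(perturbD δ η D X Y h (Pi.single e 1) (Pi.single b 1) (Pi.single a 1)
    + perturbD δ η D X Y h (Pi.single e 1) (Pi.single a 1) (Pi.single b 1)
    - perturbD δ η D X Y h (Pi.single a 1) (Pi.single b 1) (Pi.single e 1))) * this

/-- By completeness of the frame the inverse metric is `D U + U D + 2 h D D + ∑ X_p X_p`, which
explains the terms of `ksGammaSq`. -/
theorem christoffel_mul_eq (H : FlatNullFrame δ η D U X Y) (c a d b : Fin n → R) :
    ∑ e, ∑ f, ksUp η D h e f * (ksGamma δ η D X Y h (Pi.single e 1) c a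
      * ksGamma δ η D X Y h (Pi.single f 1) d b) = ksGammaSq δ η D U X Y h c a d b := by
  have h1 := sum_single_mul (ksGamma_linear₁ δ η D X Y h c a)
  have h2 := sum_single_mul (ksGamma_linear₁ δ η D X Y h d b)
  simp only [ksGammaSq, ← h1 D, ← h1 U, ← h1 (X _), ← h2 D, ← h2 U, ← h2 (X _)]
  set A := fun e => ksGamma δ η D X Y h (Pi.single e 1) c a
  set B := fun e => ksGamma δ η D X Y h (Pi.single e 1) d b
  change ∑ e, ∑ f, ksUp η D h e f * (A e * B f) = (∑ e, A e * D e) * (∑ e, B e * U e)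
    + (∑ e, A e * U e) * (∑ e, B e * D e) + 2 * h * ((∑ e, A e * D e) * (∑ e, B e * D e))
    + ∑ p, (∑ e, A e * X p e) * (∑ e, B e * X p e)
  have key : ∀ v w : Fin n → R, (∑ e, A e * v e) * (∑ e, B e * w e)
      = ∑ e, ∑ f, v e * w f * (A e * B f) := fun v w => by
    rw [Finset.sum_mul_sum]
    exact Finset.sum_congr rfl fun e _ => Finset.sum_congr rfl fun f _ => by ring
  have hp : ∑ p, ∑ e, ∑ f, X p e * X p f * (A e * B f)
      = ∑ e, ∑ f, (∑ p, X p e * X p f) * (A e * B f) := by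
    rw [Finset.sum_comm]
    refine Finset.sum_congr rfl fun e _ => ?_
    rw [Finset.sum_comm]
    exact Finset.sum_congr rfl fun f _ => by rw [Finset.sum_mul]
  simp only [key, hp]
  rw [Finset.mul_sum]
  simp only [Finset.mul_sum (s := Finset.univ (α := Fin n)), ← Finset.sum_add_distrib]
  refine Finset.sum_congr rfl fun e _ => Finset.sum_congr rfl fun f _ => ?_
  rw [ksUp, ← H.complete]
  ring

/-- The computational tool of the proof: curvature components are found by inserting frame vectors
into `ksRiemann`, where most terms vanish by the scalar products of the frame. -/
theorem contract4_formalRiemann (H : FlatNullFrame δ η D U X Y) (a b c d : Fin n → R) :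
    contract4 (formalRiemann δ (ksLow η D h) (ksUp η D h)) a b c d
      = ksRiemann δ η D U X Y h a b c d := by
  refine contract4_eq (f := ksRiemann δ η D U X Y h) (ksRiemann_linear₁ δ η D U X Y h)
    (ksRiemann_linear₂ δ η D U X Y h) (ksRiemann_linear₃ δ η D U X Y h)
    (ksRiemann_linear₄ δ η D U X Y h) ?_ a b c d
  intro a b c d
  rw [formalRiemann_eq (ksLow_symm h) (H.ks_mul h)]
  simp only [H.christoffelLow_eq, mul_sub, Finset.sum_sub_distrib, H.christoffel_mul_eq]
  simp only [ksGamma, map_neg, map_sub, map_add, H.dd_perturb, ksRiemann]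
  have hc : ∀ a d b c, perturbDD δ η D U X Y h a d b c = perturbDD δ η D U X Y h a d c b := by
    intro a d b c
    have : ∀ v, nullDD δ η U X Y v b c = nullDD δ η U X Y v c b := fun v => by
      simp only [nullDD, H.hess_comm _ b c, mul_comm (along δ b _)]
    simp only [perturbDD, this, H.hess_comm h b c]
    ring
  rw [hc _ _ (Pi.single d 1) (Pi.single c 1)]
  ring

end FlatNullFrame

end KSCurvature

/-! ### The Ricci tensor in the null frame -/

section KSComponents

variable {n : ℕ} {ι R : Type*} [Fintype ι] [DecidableEq ι] [CommRing R] [Algebra ℝ R]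
  {δ : Fin n → Derivation ℝ R R} {η D U : Fin n → R} {X : ι → Fin n → R} {Y : ι → R} {h : R}

namespace FlatNullFrame

/-- The Ricci tensor of a Kerr-Schild metric as a trace over the null frame. -/
theorem ricci_contract (H : FlatNullFrame δ η D U X Y) (v w : Fin n → R) :
    ∑ b, ∑ d, formalRicci δ (ksLow η D h) (ksUp η D h) b d * v b * w d
      = ksRiemann δ η D U X Y h U v D w + ksRiemann δ η D U X Y h D v U w
        + 2 * h * ksRiemann δ η D U X Y h D v D w + ∑ p, ksRiemann δ η D U X Y h (X p) v (X p) w := by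
  simp only [← H.contract4_formalRiemann, formalRicci_eq (H.ks_mul' h)]
  generalize formalRiemann δ (ksLow η D h) (ksUp η D h) = T
  have h1 : ∀ x y, contract4 T x v y w = ∑ b, ∑ d, ∑ a, ∑ e, y a * x e * T e b a d * v b * w d := by
    intro x y
    simp only [contract4]
    rw [Finset.sum_comm]
    refine Finset.sum_congr rfl fun b _ => ?_
    rw [Finset.sum_congr rfl fun a _ => Finset.sum_comm, Finset.sum_comm]
    refine Finset.sum_congr rfl fun d _ => ?_
    rw [Finset.sum_comm]
    exact Finset.sum_congr rfl fun e _ => Finset.sum_congr rfl fun f _ => by ring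
  have h2 : ∑ p, contract4 T (X p) v (X p) w
      = ∑ b, ∑ d, ∑ a, ∑ e, (∑ p, X p a * X p e) * T e b a d * v b * w d := by
    simp only [h1]
    rw [Finset.sum_comm]; refine Finset.sum_congr rfl fun b _ => ?_
    rw [Finset.sum_comm]; refine Finset.sum_congr rfl fun d _ => ?_
    rw [Finset.sum_comm]; refine Finset.sum_congr rfl fun a _ => ?_
    rw [Finset.sum_comm]; refine Finset.sum_congr rfl fun e _ => ?_
    simp only [Finset.sum_mul]
  rw [h2, h1, h1, h1]
  simp only [Finset.mul_sum, Finset.sum_mul (s := Finset.univ (α := Fin n)),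
    ← Finset.sum_add_distrib]
  refine Finset.sum_congr rfl fun b _ => Finset.sum_congr rfl fun d _ =>
    Finset.sum_congr rfl fun a _ => Finset.sum_congr rfl fun e _ => ?_
  rw [ksUp, ← H.complete]
  ring

theorem UD (H : FlatNullFrame δ η D U X Y) : dot η U D = 1 := by rw [dot_comm, H.DU]

theorem XD (H : FlatNullFrame δ η D U X Y) (i : ι) : dot η (X i) D = 0 := by rw [dot_comm, H.DX]

theorem XU (H : FlatNullFrame δ η D U X Y) (i : ι) : dot η (X i) U = 0 := by rw [dot_comm, H.UX]

theorem nullD_D (H : FlatNullFrame δ η D U X Y) (w : Fin n → R) : nullD δ η X Y D w = 0 := by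
  simp [nullD, H.XD]

theorem nullD_U (H : FlatNullFrame δ η D U X Y) (w : Fin n → R) : nullD δ η X Y U w = 0 := by
  simp [nullD, H.XU]

theorem nullD_X (H : FlatNullFrame δ η D U X Y) (i : ι) (w : Fin n → R) :
    nullD δ η X Y (X i) w = along δ w (Y i) := by
  simp [nullD, H.XX]

theorem nullDD_D (H : FlatNullFrame δ η D U X Y) (w y : Fin n → R) :
    nullDD δ η U X Y D w y = -∑ i, along δ w (Y i) * along δ y (Y i) := by
  simp [nullDD, H.XD, H.UD]

theorem nullDD_U (H : FlatNullFrame δ η D U X Y) (w y : Fin n → R) :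
    nullDD δ η U X Y U w y = 0 := by
  simp [nullDD, H.XU, H.UU]

theorem nullDD_X (H : FlatNullFrame δ η D U X Y) (i : ι) (w y : Fin n → R) :
    nullDD δ η U X Y (X i) w y = hess δ (Y i) w y := by
  simp [nullDD, H.XX, H.UX]

/-- The component `R(D, D)` of the Ricci tensor is the square of the acceleration of the
congruence. -/
theorem ricci_DD (H : FlatNullFrame δ η D U X Y) :
    ∑ b, ∑ d, formalRicci δ (ksLow η D h) (ksUp η D h) b d * D b * D d
      = 2 * h * ∑ i, along δ D (Y i) * along δ D (Y i) := by
  rw [H.ricci_contract, Finset.mul_sum]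
  have h0 : ∀ i, ksRiemann δ η D U X Y h (X i) D (X i) D
      = 2 * h * (along δ D (Y i) * along δ D (Y i)) := fun i => by
    simp only [ksRiemann, perturbDD, ksGammaSq, ksGamma, perturbD, H.nullD_D, H.nullD_U,
      H.nullD_X, H.nullDD_D, H.nullDD_X, H.DD, H.DU, H.DX]
    simp
    ring
  have h1 : ksRiemann δ η D U X Y h U D D D = 0 := by
    simp only [ksRiemann]; ring
  have h2 : ksRiemann δ η D U X Y h D D D D = 0 := by
    simp only [ksRiemann]; ring
  have h3 : ksRiemann δ η D U X Y h D D U D = 0 := by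
    simp only [ksRiemann, perturbDD, ksGammaSq, ksGamma, perturbD, H.nullD_D, H.nullD_U,
      H.nullD_X, H.nullDD_D, H.nullDD_U, H.DD, H.DU, H.DX]
    simp
  rw [h1, h2, h3, Finset.sum_congr rfl fun i _ => h0 i]
  ring

end FlatNullFrame

end KSComponents

/-! ### Curvature symmetries and the optical constraint -/

section KSComponents

variable {n : ℕ} {ι R : Type*} [Fintype ι] [DecidableEq ι] [CommRing R] [Algebra ℝ R]
  {δ : Fin n → Derivation ℝ R R} {η D U : Fin n → R} {X : ι → Fin n → R} {Y : ι → R} {h : R}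

theorem ksGamma_comm (e c a : Fin n → R) :
    ksGamma δ η D X Y h e c a = ksGamma δ η D X Y h e a c := by
  simp only [ksGamma, perturbD]; ring

theorem ksRiemann_swap_left (a b c d : Fin n → R) :
    ksRiemann δ η D U X Y h b a c d = -ksRiemann δ η D U X Y h a b c d := by
  have h1 : ∀ c a d b, ksGammaSq δ η D U X Y h c a d b = ksGammaSq δ η D U X Y h a c b d := by
    intro c a d b
    simp only [ksGammaSq, ksGamma_comm _ c a, ksGamma_comm _ d b]
  simp only [ksRiemann, perturbDD, ksGammaSq_comm δ η D U X Y h c b,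
    ksGammaSq_comm δ η D U X Y h d b]
  ring

theorem ksRiemann_self_left (a c d : Fin n → R) : ksRiemann δ η D U X Y h a a c d = 0 := by
  have h1 := ksRiemann_swap_left (δ := δ) (η := η) (D := D) (U := U) (X := X) (Y := Y) (h := h)
    a a c d
  obtain ⟨t, ht⟩ := exists_half R
  linear_combination t * h1 - ksRiemann δ η D U X Y h a a c d * ht

theorem ksRiemann_self_right (a b c : Fin n → R) : ksRiemann δ η D U X Y h a b c c = 0 := by
  simp only [ksRiemann]; ring

/-- The vectors of a null frame of the Kerr-Schild metric. -/
def ksFrame {m : ℕ} (D U : Fin n → R) (X : Fin m → Fin n → R) (h : R) :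
    Fin 2 ⊕ Fin m → Fin n → R
  | .inl p => if p = 0 then D else U + h • D
  | .inr i => X i

namespace FlatNullFrame

theorem pair_symm (H : FlatNullFrame δ η D U X Y) (a b c d : Fin n → R) :
    ksRiemann δ η D U X Y h a b c d = ksRiemann δ η D U X Y h c d a b := by
  have hc : ∀ a d b c, perturbDD δ η D U X Y h a d b c = perturbDD δ η D U X Y h a d c b := by
    intro a d b c
    have : ∀ v, nullDD δ η U X Y v b c = nullDD δ η U X Y v c b := fun v => by
      simp only [nullDD, H.hess_comm _ b c, mul_comm (along δ b _)]
    simp only [perturbDD, this, H.hess_comm h b c]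
    ring
  have hs : ∀ a d b c, perturbDD δ η D U X Y h a d b c = perturbDD δ η D U X Y h d a b c := by
    intro a d b c; simp only [perturbDD]; ring
  have h1 : ∀ c a d b, ksGammaSq δ η D U X Y h c a d b = ksGammaSq δ η D U X Y h a c b d := by
    intro c a d b
    simp only [ksGammaSq, ksGamma_comm _ c a, ksGamma_comm _ d b]
  simp only [ksRiemann]
  rw [hc c b d a, hs b d c a, hc d b c a, hs c a d b, hc a c d b, hc a d c b, h1 a c b d,
    ksGammaSq_comm δ η D U X Y h b c a d, h1 a d b c]
  ring

/-! ### Components of the curvature when the congruence is geodetic -/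

variable (H : FlatNullFrame δ η D U X Y) (geo : ∀ i, along δ D (Y i) = 0)
include H geo

/-- Differentiating the geodesic equation `D (Y i) = 0` along `X j` gives the Sachs equation `D L =
-L L` in terms of second derivatives. -/
theorem hess_X_D (i j : ι) :
    hess δ (Y i) (X j) D = -∑ p, along δ (X p) (Y i) * along δ (X j) (Y p) := by
  have h1 := H.along_D (X j) (Y i)
  rw [geo, map_zero] at h1
  rw [eq_neg_iff_add_eq_zero, h1]
  congr 1
  exact Finset.sum_congr rfl fun p _ => mul_comm _ _

theorem hess_D_D (i : ι) : hess δ (Y i) D D = 0 := by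
  have h1 := H.along_D D (Y i)
  rw [geo, map_zero] at h1
  simpa [geo] using h1.symm

/-- Up to the symmetries of the curvature, this component and the next two exhaust the positive
boost weights. -/
theorem riemann_DXDX (i j : ι) : ksRiemann δ η D U X Y h D (X i) D (X j) = 0 := by
  simp only [ksRiemann, perturbDD, ksGammaSq, ksGamma, perturbD, H.nullD_D, H.nullD_U, H.nullD_X,
    H.nullDD_D, H.nullDD_X, H.DD, H.DU, H.DX, geo]
  simp

theorem riemann_DXDU (i : ι) : ksRiemann δ η D U X Y h D (X i) D U = 0 := by
  simp only [ksRiemann, perturbDD, ksGammaSq, ksGamma, perturbD, H.nullD_D, H.nullD_U, H.nullD_X,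
    H.nullDD_D, H.nullDD_U, H.nullDD_X, H.DD, H.DU, H.DX, geo, H.hess_D_D geo]
  simp

theorem riemann_DXXX (i j k : ι) : ksRiemann δ η D U X Y h D (X i) (X j) (X k) = 0 := by
  simp only [ksRiemann, perturbDD, ksGammaSq, ksGamma, perturbD, H.nullD_D, H.nullD_U, H.nullD_X,
    H.nullDD_D, H.nullDD_X, H.DD, H.DU, H.DX, geo]
  simp

/-- The component of boost weight zero that decides the type. Its vanishing is the matrix equation
`D(h) L + h (Lᵀ - L) L = 0`. -/
theorem riemann_DXUX (i j : ι) : ksRiemann δ η D U X Y h D (X i) U (X j)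
    = -(along δ D h * along δ (X j) (Y i)
      + h * ∑ p, (along δ (X i) (Y p) - along δ (X p) (Y i)) * along δ (X j) (Y p)) := by
  simp only [ksRiemann, perturbDD, ksGammaSq, ksGamma, perturbD, H.nullD_D, H.nullD_U, H.nullD_X,
    H.nullDD_D, H.nullDD_X, H.DD, H.DU, H.DX, geo, H.hess_comm _ D (X j),
    H.hess_X_D geo]
  simp [sub_mul]
  ring

theorem riemann_XXXX (i j k l : ι) : ksRiemann δ η D U X Y h (X i) (X j) (X k) (X l)
    = h * (along δ (X i) (Y l) * along δ (X k) (Y j) + along δ (X k) (Y l) * along δ (X i) (Y j)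
      + along δ (X j) (Y i) * along δ (X l) (Y k) + along δ (X l) (Y i) * along δ (X j) (Y k)
      - along δ (X j) (Y i) * along δ (X k) (Y l) - along δ (X k) (Y i) * along δ (X j) (Y l)
      - along δ (X i) (Y k) * along δ (X l) (Y j) - along δ (X l) (Y k) * along δ (X i) (Y j)) := by
  simp only [ksRiemann, perturbDD, ksGammaSq, ksGamma, perturbD, H.nullD_D, H.nullD_U, H.nullD_X,
    H.nullDD_X, H.DD, H.DU, H.DX, geo]
  simp
  ring

/-- In vacuum, division by `h` yields the optical constraint `2 L Lᵀ = F (L + Lᵀ)` with `F = D(h)/h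
+ tr L`. -/
theorem ricci_XX (i j : ι) :
    ∑ b, ∑ d, formalRicci δ (ksLow η D h) (ksUp η D h) b d * X i b * X j d
      = 2 * h * ∑ p, along δ (X p) (Y i) * along δ (X p) (Y j)
        - (along δ D h + h * ∑ p, along δ (X p) (Y p))
          * (along δ (X j) (Y i) + along δ (X i) (Y j)) := by
  rw [H.ricci_contract, H.pair_symm U, H.riemann_DXDX geo, H.riemann_DXUX geo, H.riemann_DXUX geo]
  simp only [H.riemann_XXXX geo]
  have key : -(h * ∑ p, (along δ (X j) (Y p) - along δ (X p) (Y j)) * along δ (X i) (Y p))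
      - h * ∑ p, (along δ (X i) (Y p) - along δ (X p) (Y i)) * along δ (X j) (Y p)
      + ∑ p, h * (along δ (X p) (Y j) * along δ (X p) (Y i)
        + along δ (X p) (Y j) * along δ (X p) (Y i)
        + along δ (X i) (Y p) * along δ (X j) (Y p) + along δ (X j) (Y p) * along δ (X i) (Y p)
        - along δ (X i) (Y p) * along δ (X p) (Y j) - along δ (X p) (Y p) * along δ (X i) (Y j)
        - along δ (X p) (Y p) * along δ (X j) (Y i) - along δ (X j) (Y p) * along δ (X p) (Y i))
      = 2 * h * ∑ p, along δ (X p) (Y i) * along δ (X p) (Y j)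
        - (h * ∑ p, along δ (X p) (Y p)) * (along δ (X j) (Y i) + along δ (X i) (Y j)) := by
    simp only [Finset.mul_sum, Finset.sum_mul, ← Finset.sum_add_distrib, ← Finset.sum_sub_distrib,
      ← Finset.sum_neg_distrib]
    exact Finset.sum_congr rfl fun p _ => by ring
  linear_combination key

end FlatNullFrame

end KSComponents

/-! ### Vacuum metrics with a rank-one optical matrix are flat -/

section KSFlat

variable {n : ℕ} {ι R : Type*} [Fintype ι] [DecidableEq ι] [CommRing R] [Algebra ℝ R]
  {δ : Fin n → Derivation ℝ R R} {η D U : Fin n → R} {X : ι → Fin n → R} {Y : ι → R} {h : R}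

namespace FlatNullFrame

theorem expand (H : FlatNullFrame δ η D U X Y) (v : Fin n → R) :
    v = dot η U v • D + dot η D v • U + ∑ i, dot η (X i) v • X i := by
  ext a
  have h1 : ∑ b, (if a = b then η a else 0) * (η b * v b) = v a := by
    simp [← mul_assoc, H.sq]
  rw [← h1]
  simp only [← H.complete a, add_mul, Finset.sum_add_distrib, Finset.sum_mul, dot, Pi.add_apply,
    Pi.smul_apply, smul_eq_mul, Finset.sum_apply]
  congr 1
  · congr 1 <;> exact Finset.sum_congr rfl fun b _ => by ring
  · rw [Finset.sum_comm]
    exact Finset.sum_congr rfl fun b _ => Finset.sum_congr rfl fun b _ => by ring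

theorem linear_ext (H : FlatNullFrame δ η D U X Y) {f : (Fin n → R) → R} (hf : IsLinearMap R f)
    (hD : f D = 0) (hU : f U = 0) (hX : ∀ i, f (X i) = 0) (v : Fin n → R) : f v = 0 := by
  have h1 : IsLinearMap.mk' f hf v = 0 := by
    rw [H.expand v]
    simp only [map_add, map_sum, map_smul, IsLinearMap.mk'_apply, hD, hU, hX, smul_zero,
      Finset.sum_const_zero, add_zero]
  exact h1

end FlatNullFrame

/-- A Ricci-flat Kerr-Schild metric whose congruence is geodetic, with an optical matrix of rank
one. -/
structure RankOneVacuum (δ : Fin n → Derivation ℝ R R) (η D U : Fin n → R) (X : ι → Fin n → R)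
    (Y : ι → R) (h F G : R) (e p : ι → R) : Prop where
  frame : FlatNullFrame δ η D U X Y
  geo : ∀ i, along δ D (Y i) = 0
  inv : G * F = 1
  unit : ∑ i, e i * e i = 1
  rank_one : ∀ i j, along δ (X j) (Y i) = F * e i * e j
  along_e : ∀ i j, along δ (X j) (e i) = e j * p i
  ricci : ∀ b d, formalRicci δ (ksLow η D h) (ksUp η D h) b d = 0

namespace RankOneVacuum

variable {F G : R} {e p : ι → R} (K : RankOneVacuum δ η D U X Y h F G e p)
include K

theorem ricci_zero (v w : Fin n → R) :
    ∑ b, ∑ d, formalRicci δ (ksLow η D h) (ksUp η D h) b d * v b * w d = 0 := by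
  simp [K.ricci]

/-- For `L = F e eᵀ` the terms of `R(X_i, X_j)` that contain `h` undifferentiated cancel, leaving a
multiple of `F D(h) e_i e_j`. -/
theorem D_h : along δ D h = 0 := by
  have h1 : ∀ i j, 2 * F * (along δ D h) * (e i * e j) = 0 := fun i j => by
    have := K.frame.ricci_XX (h := h) K.geo i j
    rw [K.ricci_zero] at this
    simp only [K.rank_one] at this
    have e1 : ∑ p, F * e i * e p * (F * e j * e p) = F ^ 2 * e i * e j * ∑ p, e p * e p := by
      rw [Finset.mul_sum]; exact Finset.sum_congr rfl fun _ _ => by ring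
    have e2 : ∑ p, F * e p * e p = F * ∑ p, e p * e p := by
      rw [Finset.mul_sum]; exact Finset.sum_congr rfl fun _ _ => by ring
    rw [e1, e2, K.unit] at this
    linear_combination this
  have h2 : 2 * F * (along δ D h) * ((∑ i, e i * e i) * 1) = 0 := by
    rw [mul_one, Finset.mul_sum]
    exact Finset.sum_eq_zero fun i _ => h1 i i
  rw [K.unit] at h2
  obtain ⟨t, ht⟩ := exists_half R
  linear_combination (t * G) * h2 - (along δ D h) * G * F * ht - (along δ D h) * K.inv

theorem hess_DX_h (i : ι) :
    hess δ h D (X i) = -(F * e i * ∑ p, e p * along δ (X p) h) := by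
  have h1 := K.frame.along_D (X i) h
  rw [K.D_h, map_zero] at h1
  rw [K.frame.hess_comm, eq_neg_iff_add_eq_zero, h1, Finset.mul_sum]
  congr 1
  exact Finset.sum_congr rfl fun p _ => by rw [K.rank_one]; ring

theorem hess_DD_h : hess δ h D D = 0 := by
  have h1 := K.frame.along_D D h
  rw [K.D_h, map_zero] at h1
  simpa [K.geo] using h1.symm

theorem hess_DU_Y (i : ι) :
    hess δ (Y i) D U = -(F * e i * ∑ p, along δ U (Y p) * e p) := by
  have h1 := K.frame.along_D U (Y i)
  rw [K.geo, map_zero] at h1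
  rw [K.frame.hess_comm, eq_neg_iff_add_eq_zero, h1, Finset.mul_sum]
  congr 1
  exact Finset.sum_congr rfl fun p _ => by rw [K.rank_one]; ring

theorem hess_XX_Y (i j k : ι) : hess δ (Y j) (X i) (X k)
    = along δ (X i) F * e j * e k + F * e i * (p j * e k + e j * p k)
      + F * e k * e i * along δ U (Y j) := by
  have h1 := K.frame.along_X (X i) k (Y j)
  simp only [K.rank_one, Derivation.leibniz, K.along_e, smul_eq_mul] at h1
  linear_combination -h1

theorem riemann_DXDX (i j : ι) : ksRiemann δ η D U X Y h D (X i) D (X j) = 0 :=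
  K.frame.riemann_DXDX K.geo i j

theorem riemann_DXUX (i j : ι) : ksRiemann δ η D U X Y h D (X i) U (X j) = 0 := by
  rw [K.frame.riemann_DXUX K.geo]
  simp only [K.D_h, K.rank_one]
  rw [Finset.sum_eq_zero fun _ _ => by ring]
  ring

theorem riemann_XXXX (i j k l : ι) :
    ksRiemann δ η D U X Y h (X i) (X j) (X k) (X l) = 0 := by
  rw [K.frame.riemann_XXXX K.geo]
  simp only [K.rank_one]
  ring

theorem riemann_DUDU : ksRiemann δ η D U X Y h D U D U = 0 := by
  simp only [ksRiemann, perturbDD, ksGammaSq, ksGamma, perturbD, K.frame.nullD_D, K.frame.nullD_U,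
    K.frame.nullD_X, K.frame.nullDD_U, K.frame.nullDD_D, K.frame.DD, K.frame.DU,
    K.frame.DX, K.geo, K.D_h, K.hess_DD_h]
  simp

theorem riemann_DUXX (i j : ι) : ksRiemann δ η D U X Y h D U (X i) (X j) = 0 := by
  have h1 : ∀ i j, hess δ (Y i) D (X j) = -∑ p, F * e i * e p * (F * e p * e j) := fun i j => by
    rw [K.frame.hess_comm, K.frame.hess_X_D K.geo]
    simp only [K.rank_one]
  simp only [ksRiemann, perturbDD, ksGammaSq, ksGamma, perturbD, K.frame.nullD_D, K.frame.nullD_U,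
    K.frame.nullD_X, K.frame.nullDD_U, K.frame.nullDD_D, K.frame.nullDD_X, K.frame.DD, K.frame.DU,
    K.frame.DX, K.geo, K.D_h, K.rank_one, h1]
  have h2 : ∑ p, F * e i * e p * (F * e p * e j) = ∑ p, F * e j * e p * (F * e p * e i) :=
    Finset.sum_congr rfl fun _ _ => by ring
  simp [h2]

theorem riemann_DUUX' (i : ι) : ksRiemann δ η D U X Y h D U U (X i)
    = F * e i * (∑ p, e p * along δ (X p) h - 2 * h * ∑ p, along δ U (Y p) * e p) := by
  simp only [ksRiemann, perturbDD, ksGammaSq, ksGamma, perturbD, K.frame.nullD_D, K.frame.nullD_U,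
    K.frame.nullD_X, K.frame.nullDD_U, K.frame.nullDD_D, K.frame.nullDD_X, K.frame.DD, K.frame.DU,
    K.frame.DX, K.geo, K.D_h, K.rank_one, K.hess_DX_h, K.hess_DU_Y]
  have h2 : ∑ x, along δ U (Y x) * (F * e x * e i) = F * e i * ∑ p, along δ U (Y p) * e p := by
    rw [Finset.mul_sum]; exact Finset.sum_congr rfl fun _ _ => by ring
  simp [h2]
  ring

theorem riemann_UXXX' (i j k : ι) : ksRiemann δ η D U X Y h U (X i) (X j) (X k)
    = F * e i * (along δ (X k) h * e j - along δ (X j) h * e k) := by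
  simp only [ksRiemann, perturbDD, ksGammaSq, ksGamma, perturbD, K.frame.nullD_D, K.frame.nullD_U,
    K.frame.nullD_X, K.frame.nullDD_U, K.frame.nullDD_X, K.frame.DD, K.frame.DU,
    K.frame.DX, K.geo, K.D_h, K.rank_one, K.hess_XX_Y]
  simp
  ring

/-- `R(U, X_i) = 0` makes the derivatives of `h` along the `X i` proportional to `e i`, and
contraction with `e` fixes the factor. This removes the components of boost weight `-1`. -/
theorem X_h (i : ι) :
    along δ (X i) h = 2 * h * (∑ p, along δ U (Y p) * e p) * e i := by
  have h1 : ∀ i, along δ (X i) h = (2 * ∑ p, e p * along δ (X p) h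
      - 2 * h * ∑ p, along δ U (Y p) * e p) * e i := fun i => by
    have h2 := K.frame.ricci_contract (h := h) U (X i)
    have h3 : ∑ q, ksRiemann δ η D U X Y h (X q) U (X q) (X i)
        = F * e i * ∑ p, e p * along δ (X p) h - F * along δ (X i) h * ∑ p, e p * e p := by
      simp only [ksRiemann_swap_left U, K.riemann_UXXX', Finset.mul_sum, ← Finset.sum_sub_distrib]
      exact Finset.sum_congr rfl fun _ _ => by ring
    have h4 : ksRiemann δ η D U X Y h D U D (X i) = 0 := by
      rw [K.frame.pair_symm, K.frame.riemann_DXDU K.geo]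
    rw [K.ricci_zero, ksRiemann_self_left, h3, K.riemann_DUUX', h4, K.unit] at h2
    linear_combination G * h2 + (-along δ (X i) h + (2 * ∑ p, e p * along δ (X p) h
      - 2 * h * ∑ p, along δ U (Y p) * e p) * e i) * K.inv
  have h5 : ∑ p, e p * along δ (X p) h = 2 * h * ∑ p, along δ U (Y p) * e p := by
    have h6 : ∑ p, e p * along δ (X p) h = (2 * ∑ p, e p * along δ (X p) h
      - 2 * h * ∑ p, along δ U (Y p) * e p) * ∑ p, e p * e p := by
      rw [Finset.mul_sum]
      exact Finset.sum_congr rfl fun i _ => by rw [h1 i]; ring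
    rw [K.unit] at h6
    linear_combination -h6
  rw [h1, h5]
  ring

theorem riemann_DUUX (i : ι) : ksRiemann δ η D U X Y h D U U (X i) = 0 := by
  rw [K.riemann_DUUX']
  simp only [K.X_h]
  have : ∑ q, e q * (2 * h * (∑ p, along δ U (Y p) * e p) * e q)
      = 2 * h * (∑ p, along δ U (Y p) * e p) * ∑ q, e q * e q := by
    rw [Finset.mul_sum _ _ (2 * h * _)]; exact Finset.sum_congr rfl fun _ _ => by ring
  rw [this, K.unit]
  ring

theorem riemann_UXXX (i j k : ι) : ksRiemann δ η D U X Y h U (X i) (X j) (X k) = 0 := by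
  rw [K.riemann_UXXX', K.X_h, K.X_h]
  ring

theorem X_U_Y (i j : ι) : along δ (X j) (along δ U (Y i))
    = along δ U (F * e i * e j) + along δ U (Y i) * along δ U (Y j) := by
  have h1 := K.frame.along_X U j (Y i)
  rw [K.rank_one] at h1
  rw [K.frame.along_U, K.frame.hess_comm, h1]
  ring

/-- Only the factor `e i` matters. Symmetry in `i`, `j` then makes `z` proportional to `e`, and
`R(U, U) = 0` makes `e` orthogonal to `z`, so the component vanishes. -/
theorem exists_riemann_UXUX : ∃ z : ι → R, ∀ i j,
    ksRiemann δ η D U X Y h U (X i) U (X j) = e i * z j := by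
  have hq : ∀ i, along δ (X i) (∑ p, along δ U (Y p) * e p)
      = along δ U F * e i + F * along δ U (e i)
        + along δ U (Y i) * (∑ p, along δ U (Y p) * e p)
        + e i * ∑ q, along δ U (Y q) * p q := fun i => by
    have h1 : ∑ q, along δ U (e q) * e q = 0 := by
      have h2 := congrArg (along δ U) K.unit
      simp only [map_sum, Derivation.leibniz, smul_eq_mul, Derivation.map_one_eq_zero,
        Finset.sum_add_distrib] at h2
      have h3 : ∑ q, e q * along δ U (e q) = ∑ q, along δ U (e q) * e q :=
        Finset.sum_congr rfl fun _ _ => mul_comm _ _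
      rw [h3] at h2
      obtain ⟨t, ht⟩ := exists_half R
      linear_combination t * h2 - (∑ q, along δ U (e q) * e q) * ht
    have h4 : along δ (X i) (∑ p, along δ U (Y p) * e p)
        = (along δ U F * e i + F * along δ U (e i)) * (∑ q, e q * e q)
          + F * e i * (∑ q, along δ U (e q) * e q)
          + along δ U (Y i) * (∑ p, along δ U (Y p) * e p)
          + e i * ∑ q, along δ U (Y q) * p q := by
      simp only [map_sum, Finset.mul_sum, ← Finset.sum_add_distrib]
      refine Finset.sum_congr rfl fun q _ => ?_
      simp only [Derivation.leibniz, K.X_U_Y, K.along_e, smul_eq_mul]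
      ring
    rw [h4, h1, K.unit]
    ring
  have hh : ∀ i j, hess δ h (X i) (X j) = along δ (X i) (along δ (X j) h)
      + F * e j * e i * along δ U h := fun i j => by
    have h1 := K.frame.along_X (X i) j h
    rw [K.rank_one] at h1
    linear_combination -h1
  have hY : ∀ i j, hess δ (Y i) (X j) U = along δ (X j) (along δ U (Y i)) := fun i j =>
    (K.frame.along_U _ _).symm
  have h2 : ∀ (v : Fin n → R), along δ v (2 : R) = 0 := fun v => by
    simpa using (along δ v).map_natCast 2
  -- What is left after `e i` is factored out, with the derivatives of `h` and `Y` substituted from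
  -- `X_h`, `X_U_Y` and `hq`.
  refine ⟨fun j => 2 * h * ((∑ p, along δ U (Y p) * e p) * (p j - along δ U (Y j))
    - F * along δ U (e j)) + e j * (2 * h * ∑ q, along δ U (Y q) * p q
    + 4 * h * (∑ p, along δ U (Y p) * e p) ^ 2 - F * along δ U h), fun i j => ?_⟩
  simp only [ksRiemann, perturbDD, ksGammaSq, ksGamma, perturbD, K.frame.nullD_D,
    K.frame.nullD_U, K.frame.nullD_X, K.frame.nullDD_U, K.frame.nullDD_X, K.frame.DD, K.frame.DU,
    K.frame.DX, K.geo, K.D_h, K.rank_one, K.frame.hess_comm _ U (X j), hh, hY]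
  have h3 : ∀ x, h * (F * e x * e j) - h * (F * e j * e x) = 0 := fun x => by ring
  simp only [zero_mul, mul_zero, zero_add, add_zero, mul_one, one_mul, sub_zero,
    neg_sub, h3, neg_zero, Finset.sum_const_zero]
  simp only [K.X_h, K.X_U_Y, Derivation.leibniz, smul_eq_mul, hq, K.along_e, h2]
  generalize ∑ p, along δ U (Y p) * e p = s
  generalize ∑ q, along δ U (Y q) * p q = t
  ring

theorem riemann_UXUX (i j : ι) : ksRiemann δ η D U X Y h U (X i) U (X j) = 0 := by
  obtain ⟨z, hz⟩ := K.exists_riemann_UXUX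
  have h1 : ∀ i j, e i * z j = e j * z i := fun i j => by
    rw [← hz, ← hz, K.frame.pair_symm]
  have h2 : ∑ q, e q * z q = 0 := by
    have h3 := K.frame.ricci_contract (h := h) U U
    have h4 : ∀ q, ksRiemann δ η D U X Y h (X q) U (X q) U = e q * z q := fun q => by
      rw [ksRiemann_swap_left U, ksRiemann_swap, hz, neg_neg]
    rw [K.ricci_zero, ksRiemann_self_left, ksRiemann_self_right, K.riemann_DUDU] at h3
    simp only [h4] at h3
    linear_combination -h3
  have h3 : z j = e j * ∑ q, e q * z q := by
    have : z j * ∑ q, e q * e q = e j * ∑ q, e q * z q := by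
      rw [Finset.mul_sum, Finset.mul_sum]
      exact Finset.sum_congr rfl fun q _ => by linear_combination e q * h1 q j
    rw [← this, K.unit, mul_one]
  rw [hz, h3, h2]
  ring

/-- A Ricci-flat Kerr-Schild metric is flat if its congruence is geodetic and has an optical matrix
of rank one. -/
theorem riemann_eq_zero (a b c d : Fin n → R) : ksRiemann δ η D U X Y h a b c d = 0 := by
  have key : ∀ c d, ksRiemann δ η D U X Y h D U c d = 0 →
      (∀ i, ksRiemann δ η D U X Y h D (X i) c d = 0) →
      (∀ i, ksRiemann δ η D U X Y h U (X i) c d = 0) →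
      (∀ i j, ksRiemann δ η D U X Y h (X i) (X j) c d = 0) →
      ∀ a b, ksRiemann δ η D U X Y h a b c d = 0 := by
    intro c d h1 h2 h3 h4
    have hD : ∀ b, ksRiemann δ η D U X Y h D b c d = 0 :=
      K.frame.linear_ext (ksRiemann_linear₂ δ η D U X Y h D c d) (ksRiemann_self_left _ _ _) h1 h2
    have hU : ∀ b, ksRiemann δ η D U X Y h U b c d = 0 :=
      K.frame.linear_ext (ksRiemann_linear₂ δ η D U X Y h U c d)
        (by rw [ksRiemann_swap_left, hD, neg_zero]) (ksRiemann_self_left _ _ _) h3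
    have hX : ∀ i b, ksRiemann δ η D U X Y h (X i) b c d = 0 := fun i =>
      K.frame.linear_ext (ksRiemann_linear₂ δ η D U X Y h (X i) c d)
        (by rw [ksRiemann_swap_left, hD, neg_zero]) (by rw [ksRiemann_swap_left, hU, neg_zero])
        (h4 i)
    intro a b
    exact K.frame.linear_ext (ksRiemann_linear₁ δ η D U X Y h b c d) (hD b) (hU b)
      (fun i => hX i b) a
  have s := K.frame.pair_symm (h := h)
  have hDXDU : ∀ i, ksRiemann δ η D U X Y h D (X i) D U = 0 := K.frame.riemann_DXDU K.geo
  have hDXXX : ∀ i j k, ksRiemann δ η D U X Y h D (X i) (X j) (X k) = 0 :=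
    K.frame.riemann_DXXX K.geo
  rw [s]
  refine key a b ?_ (fun i => ?_) (fun i => ?_) (fun i j => ?_) c d <;> rw [s] <;>
    refine key _ _ ?_ (fun k => ?_) (fun k => ?_) (fun k l => ?_) a b
  · exact K.riemann_DUDU
  · exact hDXDU k
  · rw [s, K.riemann_DUUX]
  · rw [s, K.riemann_DUXX]
  · rw [s, hDXDU]
  · exact K.riemann_DXDX _ _
  · rw [s, K.riemann_DXUX]
  · rw [s, hDXXX]
  · exact K.riemann_DUUX _
  · exact K.riemann_DXUX _ _
  · exact K.riemann_UXUX _ _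
  · rw [s, K.riemann_UXXX]
  · exact K.riemann_DUXX _ _
  · exact hDXXX _ _ _
  · exact K.riemann_UXXX _ _ _
  · exact K.riemann_XXXX _ _ _ _

end RankOneVacuum

end KSFlat

/-! ### Boost weights of curvature components -/

section BoostWeight

variable {n : ℕ}

/-- The components of positive boost weight of a tensor with the symmetries of the curvature
vanish if those of types `0i0j`, `0i01` and `0ijk` do. -/
theorem positive_weight_eq_zero {C : FrameIdx n → FrameIdx n → FrameIdx n → FrameIdx n → ℝ}
    (hl : ∀ p q r s, C q p r s = -C p q r s) (hs : ∀ p q r s, C p q r s = C r s p q)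
    (h1 : ∀ i j, C (.inl 0) (.inr i) (.inl 0) (.inr j) = 0)
    (h2 : ∀ i, C (.inl 0) (.inr i) (.inl 0) (.inl 1) = 0)
    (h3 : ∀ i j k, C (.inl 0) (.inr i) (.inr j) (.inr k) = 0) (p q r s : FrameIdx n)
    (hw : 0 < boostWeight p q r s) : C p q r s = 0 := by
  have hr : ∀ p q r s, C p q s r = -C p q r s := fun p q r s => by rw [hs, hl, hs]
  have h0 : ∀ p r s, C p p r s = 0 := fun p r s => by linarith [hl p p r s]
  have h0' : ∀ p r s, C r s p p = 0 := fun p r s => by rw [hs, h0]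
  have key : ∀ r s, 0 ≤ idxWeight r + idxWeight s → ∀ i, C (.inl 0) (.inr i) r s = 0 := by
    rintro (r | r) (s | s) hrs i
    · fin_cases r <;> fin_cases s
      · exact h0' _ _ _
      · exact h2 i
      · rw [hr]; exact neg_eq_zero.2 (h2 i)
      · exact h0' _ _ _
    · fin_cases r
      · exact h1 i s
      · simp [idxWeight] at hrs
    · fin_cases s
      · rw [hr]; exact neg_eq_zero.2 (h1 i r)
      · simp [idxWeight] at hrs
    · exact h3 i r s
  have key' : ∀ p q, 0 < idxWeight p + idxWeight q → ∀ r s, 0 ≤ idxWeight r + idxWeight s →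
      C p q r s = 0 := by
    rintro (p | p) (q | q) hpq r s hrs
    · fin_cases p <;> fin_cases q
      · exact h0 _ _ _
      · simp [idxWeight] at hpq
      · simp [idxWeight] at hpq
      · exact h0 _ _ _
    · fin_cases p
      · exact key r s hrs q
      · simp [idxWeight] at hpq
    · fin_cases q
      · rw [hl]; exact neg_eq_zero.2 (key r s hrs p)
      · simp [idxWeight] at hpq
    · simp [idxWeight] at hpq
  -- By antisymmetry only pairs of distinct labels count, so positive total weight means one pair of
  -- weight one and the other of weight at least zero.
  have hb : ∀ p : FrameIdx n, ∀ q, p ≠ q → idxWeight p + idxWeight q ≤ 1 := by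
    rintro (p | p) (q | q) hpq
    · fin_cases p <;> fin_cases q <;> simp [idxWeight] at hpq ⊢
    · fin_cases p <;> simp [idxWeight]
    · fin_cases q <;> simp [idxWeight]
    · simp [idxWeight]
  by_cases hpq : p = q
  · rw [hpq, h0]
  by_cases hrs : r = s
  · rw [hrs, h0']
  have h4 := hb p q hpq
  have h5 := hb r s hrs
  unfold boostWeight at hw
  by_cases h6 : 0 < idxWeight p + idxWeight q
  · exact key' p q h6 r s (by omega)
  · rw [hs]; exact key' r s (by omega) p q (by omega)

end BoostWeight

/-! ### Germs of smooth functions and Grönwall's inequality -/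

section Germs

open Filter Topology

variable {n : ℕ}

/-- The algebra of the functions which are smooth at a point. -/
def smoothAt (x₀ : Coord n) : Subalgebra ℝ (Coord n → ℝ) where
  carrier := {f | ContDiffAt ℝ ∞ f x₀}
  mul_mem' {f g} hf hg := by
    rw [Set.mem_ofPred_eq] at *; exact hf.mul hg
  add_mem' {f g} hf hg := by
    rw [Set.mem_ofPred_eq] at *; exact hf.add hg
  algebraMap_mem' c := by
    rw [Set.mem_ofPred_eq]; exact contDiffAt_const (c := c)

/-- The ideal of the functions which vanish near a point. -/
def flatAt (x₀ : Coord n) : Ideal (smoothAt x₀) where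
  carrier := {f | (f : Coord n → ℝ) =ᶠ[𝓝 x₀] 0}
  add_mem' {f g} hf hg := by
    filter_upwards [hf, hg] with x h1 h2
    simp [h1, h2]
  zero_mem' := EventuallyEq.rfl
  smul_mem' c f hf := by
    filter_upwards [hf] with x h1
    simp [h1]

/-- The algebra of germs of smooth functions at a point. -/
def SmoothGerm (x₀ : Coord n) : Type := smoothAt x₀ ⧸ flatAt x₀

noncomputable instance (x₀ : Coord n) : CommRing (SmoothGerm x₀) :=
  inferInstanceAs (CommRing (smoothAt x₀ ⧸ flatAt x₀))

noncomputable instance (x₀ : Coord n) : Algebra ℝ (SmoothGerm x₀) :=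
  inferInstanceAs (Algebra ℝ (smoothAt x₀ ⧸ flatAt x₀))

/-- `r` is the germ of `f`. -/
def IsGerm (x₀ : Coord n) (f : Coord n → ℝ) (r : SmoothGerm x₀) : Prop :=
  ∃ hf : ContDiffAt ℝ ∞ f x₀, Ideal.Quotient.mk (flatAt x₀) ⟨f, hf⟩ = r

variable {x₀ : Coord n}

theorem exists_rep (r : SmoothGerm x₀) : ∃ f, IsGerm x₀ f r := by
  obtain ⟨⟨f, hf⟩, rfl⟩ := Ideal.Quotient.mk_surjective r
  exact ⟨f, hf, rfl⟩

theorem _root_.ContDiffAt.exists_germ {f : Coord n → ℝ} (hf : ContDiffAt ℝ ∞ f x₀) :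
    ∃ r, IsGerm x₀ f r := ⟨_, hf, rfl⟩

namespace IsGerm

variable {f g : Coord n → ℝ} {r s : SmoothGerm x₀}

theorem eq_iff (hf : IsGerm x₀ f r) (hg : IsGerm x₀ g s) : r = s ↔ f =ᶠ[𝓝 x₀] g := by
  obtain ⟨hf, rfl⟩ := hf
  obtain ⟨hg, rfl⟩ := hg
  refine Ideal.Quotient.eq.trans ?_
  change ((f - g : Coord n → ℝ) =ᶠ[𝓝 x₀] 0) ↔ _
  constructor <;> intro h <;> filter_upwards [h] with x hx
  · simpa [sub_eq_zero] using hx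
  · simpa [sub_eq_zero] using hx

theorem congr (hf : IsGerm x₀ f r) (h : g =ᶠ[𝓝 x₀] f) : IsGerm x₀ g r := by
  obtain ⟨hf, rfl⟩ := hf
  have hg : ContDiffAt ℝ ∞ g x₀ := hf.congr_of_eventuallyEq h
  exact ⟨hg, (eq_iff ⟨hg, rfl⟩ ⟨hf, rfl⟩).2 h⟩

theorem add (hf : IsGerm x₀ f r) (hg : IsGerm x₀ g s) :
    IsGerm x₀ (fun x => f x + g x) (r + s) := by
  obtain ⟨hf, rfl⟩ := hf
  obtain ⟨hg, rfl⟩ := hg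
  exact ⟨hf.add hg, rfl⟩

theorem neg (hf : IsGerm x₀ f r) : IsGerm x₀ (fun x => -f x) (-r) := by
  obtain ⟨hf, rfl⟩ := hf
  exact ⟨hf.neg, rfl⟩

theorem sub (hf : IsGerm x₀ f r) (hg : IsGerm x₀ g s) :
    IsGerm x₀ (fun x => f x - g x) (r - s) := by
  obtain ⟨hf, rfl⟩ := hf
  obtain ⟨hg, rfl⟩ := hg
  exact ⟨hf.sub hg, rfl⟩

theorem mul (hf : IsGerm x₀ f r) (hg : IsGerm x₀ g s) :
    IsGerm x₀ (fun x => f x * g x) (r * s) := by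
  obtain ⟨hf, rfl⟩ := hf
  obtain ⟨hg, rfl⟩ := hg
  exact ⟨hf.mul hg, rfl⟩

theorem const (c : ℝ) : IsGerm x₀ (fun _ => c) (algebraMap ℝ _ c) := ⟨contDiffAt_const, rfl⟩

theorem zero : IsGerm x₀ (fun _ => 0) 0 := ⟨contDiffAt_const, rfl⟩

theorem one : IsGerm x₀ (fun _ => 1) 1 := ⟨contDiffAt_const, rfl⟩

theorem two : IsGerm x₀ (fun _ => 2) 2 := ⟨contDiffAt_const, rfl⟩

theorem sum {ι : Type*} {s : Finset ι} {f : ι → Coord n → ℝ} {r : ι → SmoothGerm x₀}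
    (h : ∀ i, IsGerm x₀ (f i) (r i)) : IsGerm x₀ (fun x => ∑ i ∈ s, f i x) (∑ i ∈ s, r i) := by
  classical
  induction s using Finset.induction_on with
  | empty => simpa using zero
  | insert a s ha ih => simpa only [Finset.sum_insert ha] using (h a).add ih

end IsGerm

/-- The value of a germ at the base point. -/
noncomputable def germValue (x₀ : Coord n) : SmoothGerm x₀ →+* ℝ :=
  Ideal.Quotient.lift (flatAt x₀) ((Pi.evalRingHom _ x₀).comp (smoothAt x₀).val.toRingHom)
    fun _ hf => hf.self_of_nhds

theorem IsGerm.value {f : Coord n → ℝ} {r : SmoothGerm x₀} (h : IsGerm x₀ f r) :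
    germValue x₀ r = f x₀ := by
  obtain ⟨hf, rfl⟩ := h
  rfl

theorem exists_inv {r : SmoothGerm x₀} (h : germValue x₀ r ≠ 0) : ∃ s, s * r = 1 := by
  obtain ⟨f, hf⟩ := exists_rep r
  rw [hf.value] at h
  obtain ⟨s, hs⟩ := (hf.1.inv h).exists_germ
  refine ⟨s, ((hs.mul hf).eq_iff .one).2 ?_⟩
  filter_upwards [hf.1.continuousAt.eventually_ne h] with x hx
  exact inv_mul_cancel₀ hx

theorem exists_sqrt {r : SmoothGerm x₀} (h : 0 < germValue x₀ r) :
    ∃ s, s * s = r := by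
  obtain ⟨f, hf⟩ := exists_rep r
  rw [hf.value] at h
  obtain ⟨s, hs⟩ := (hf.1.sqrt h.ne').exists_germ
  refine ⟨s, ((hs.mul hs).eq_iff hf).2 ?_⟩
  filter_upwards [hf.1.continuousAt.eventually_const_lt h] with x hx
  exact Real.mul_self_sqrt hx.le

/-- Reality enters here: it yields the geodesic equation from `R(D, D) = 0`, and `M = 0` from the
vanishing of the sum of squares. -/
theorem eq_zero_of_sum_sq {ι : Type*} [Fintype ι] {r : ι → SmoothGerm x₀}
    (h : ∑ i, r i * r i = 0) (i : ι) : r i = 0 := by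
  choose f hf using fun i => exists_rep (r i)
  rw [(IsGerm.sum fun i => (hf i).mul (hf i)).eq_iff .zero] at h
  refine ((hf i).eq_iff .zero).2 ?_
  filter_upwards [h] with x hx
  have := (Finset.sum_eq_zero_iff_of_nonneg fun i _ => mul_self_nonneg (f i x)).1 hx i
    (Finset.mem_univ i)
  simpa using this

theorem _root_.ContDiffAt.partialD {f : Coord n → ℝ} (hf : ContDiffAt ℝ ∞ f x₀) (a : Fin n) :
    ContDiffAt ℝ ∞ (fun x => partialD f a x) x₀ := by
  have h1 : ContDiffAt ℝ ∞ (fderiv ℝ f) x₀ := hf.fderiv_right (by rfl)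
  exact h1.clm_apply contDiffAt_const

theorem partialD_congr {f g : Coord n → ℝ} (h : f =ᶠ[𝓝 x₀] g) (a : Fin n) :
    (fun x => partialD f a x) =ᶠ[𝓝 x₀] fun x => partialD g a x := by
  filter_upwards [h.fderiv (𝕜 := ℝ)] with x hx
  rw [partialD, partialD, hx]

theorem _root_.ContDiffAt.eventually_differentiableAt {f : Coord n → ℝ}
    (hf : ContDiffAt ℝ ∞ f x₀) : ∀ᶠ x in 𝓝 x₀, DifferentiableAt ℝ f x := by
  have h1 : ContDiffAt ℝ 1 f x₀ := hf.of_le (by exact_mod_cast le_top)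
  filter_upwards [h1.eventually (by simp)] with x hx
  exact hx.differentiableAt (by simp)

/-- The derivative of a germ in a coordinate direction. -/
noncomputable def germPartial (a : Fin n) (r : SmoothGerm x₀) : SmoothGerm x₀ :=
  Ideal.Quotient.mk (flatAt x₀)
    ⟨fun x => partialD (exists_rep r).choose a x, (exists_rep r).choose_spec.1.partialD a⟩

theorem IsGerm.germPartial {f : Coord n → ℝ} {r : SmoothGerm x₀} (hf : IsGerm x₀ f r)
    (a : Fin n) : IsGerm x₀ (fun x => partialD f a x) (germPartial a r) := by
  refine ⟨hf.1.partialD a, (eq_iff ⟨_, rfl⟩ ⟨_, rfl⟩).2 ?_⟩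
  exact partialD_congr ((hf.eq_iff (exists_rep r).choose_spec).1 rfl) a

/-- The coordinate derivations of the algebra of germs. -/
noncomputable def germD (x₀ : Coord n) (a : Fin n) :
    Derivation ℝ (SmoothGerm x₀) (SmoothGerm x₀) :=
  Derivation.mk'
    { toFun := germPartial a
      map_add' := fun r s => by
        obtain ⟨f, hf⟩ := exists_rep r
        obtain ⟨g, hg⟩ := exists_rep s
        refine (((hf.add hg).germPartial a).eq_iff ((hf.germPartial a).add (hg.germPartial a))).2 ?_
        filter_upwards [hf.1.eventually_differentiableAt, hg.1.eventually_differentiableAt]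
          with x h1 h2
        simp only [partialD]
        rw [fderiv_fun_add h1 h2]
        rfl
      map_smul' := fun c r => by
        obtain ⟨f, hf⟩ := exists_rep r
        rw [RingHom.id_apply, Algebra.smul_def c (germPartial a r), Algebra.smul_def c r]
        refine ((((IsGerm.const c).mul hf).germPartial a).eq_iff
          ((IsGerm.const c).mul (hf.germPartial a))).2 ?_
        filter_upwards [hf.1.eventually_differentiableAt] with x h1
        simp only [partialD]
        rw [fderiv_const_mul h1]
        rfl }
    fun r s => by
      obtain ⟨f, hf⟩ := exists_rep r
      obtain ⟨g, hg⟩ := exists_rep s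
      refine (((hf.mul hg).germPartial a).eq_iff
        ((hf.mul (hg.germPartial a)).add (hg.mul (hf.germPartial a)))).2 ?_
      filter_upwards [hf.1.eventually_differentiableAt, hg.1.eventually_differentiableAt]
        with x h1 h2
      simp only [partialD]
      rw [fderiv_fun_mul h1 h2]
      rfl

theorem IsGerm.germD {f : Coord n → ℝ} {r : SmoothGerm x₀} (hf : IsGerm x₀ f r) (a : Fin n) :
    IsGerm x₀ (fun x => partialD f a x) (germD x₀ a r) := hf.germPartial a

theorem germD_comm (a b : Fin n) (r : SmoothGerm x₀) :
    germD x₀ a (germD x₀ b r) = germD x₀ b (germD x₀ a r) := by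
  obtain ⟨f, hf⟩ := exists_rep r
  refine (((hf.germD b).germD a).eq_iff ((hf.germD a).germD b)).2 ?_
  have h2 : ContDiffAt ℝ 2 f x₀ := by exact_mod_cast contDiffAt_infty.1 hf.1 2
  filter_upwards [h2.eventually (by simp)] with x hx
  have h3 : DifferentiableAt ℝ (fderiv ℝ f) x :=
    (hx.fderiv_right (m := 1) (by norm_num)).differentiableAt (by simp)
  have h4 : ∀ a b, partialD (fun x => partialD f b x) a x
      = fderiv ℝ (fderiv ℝ f) x (Pi.single a 1) (Pi.single b 1) := fun a b => by
    simp only [partialD]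
    rw [fderiv_clm_apply h3 (differentiableAt_const _)]
    simp
  rw [h4, h4]
  exact hx.isSymmSndFDerivAt (by simp) _ _

/-- The ideal of the germs bounded by a multiple of a given germ. -/
def boundedBy (S : Coord n → ℝ) (x₀ : Coord n) : Ideal (SmoothGerm x₀) where
  carrier := {r | ∃ f, IsGerm x₀ f r ∧ ∃ C, ∀ᶠ x in 𝓝 x₀, |f x| ≤ C * S x}
  add_mem' := by
    rintro _ _ ⟨f, hf, C, hC⟩ ⟨g, hg, B, hB⟩
    refine ⟨_, hf.add hg, C + B, ?_⟩
    filter_upwards [hC, hB] with x h1 h2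
    have := abs_add_le (f x) (g x)
    linarith
  zero_mem' := ⟨_, .zero, 0, by simp⟩
  smul_mem' := by
    rintro c _ ⟨f, hf, C, hC⟩
    obtain ⟨g, hg⟩ := exists_rep c
    refine ⟨_, hg.mul hf, (|g x₀| + 1) * C, ?_⟩
    filter_upwards [hC, hg.1.continuousAt.abs.eventually_lt_const (lt_add_one |g x₀|)] with x h1 h2
    rw [abs_mul, mul_assoc]
    exact mul_le_mul h2.le h1 (abs_nonneg _) (by positivity)

theorem span_range_sq_le {R ι : Type*} [CommRing R] {M : ι → R} {I : Ideal R}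
    (h : ∀ i j, M i * M j ∈ I) : Ideal.span (Set.range M) ^ 2 ≤ I := by
  rw [pow_two, Ideal.span_mul_span, Ideal.span_le]
  rintro _ ⟨_, ⟨i, rfl⟩, _, ⟨j, rfl⟩, rfl⟩
  exact h i j

/-- Grönwall's inequality for a family of germs whose sum of squares has derivatives in the square
of the ideal which the family generates. -/
theorem eq_zero_of_derivative_mem_sq {ι : Type*} [Fintype ι] {M : ι → SmoothGerm x₀}
    (h0 : ∀ i, germValue x₀ (M i) = 0)
    (hd : ∀ a, germD x₀ a (∑ i, M i * M i) ∈ Ideal.span (Set.range M) ^ 2) (i : ι) : M i = 0 := by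
  choose m hm using fun i => exists_rep (M i)
  set S : Coord n → ℝ := fun x => ∑ i, m i x * m i x with hS
  have hSg : IsGerm x₀ S (∑ i, M i * M i) := IsGerm.sum fun i => (hm i).mul (hm i)
  -- Products `m i * m j` are bounded by `S`, which turns membership in the square of the ideal into
  -- the differential inequality.
  have hle : Ideal.span (Set.range M) ^ 2 ≤ boundedBy S x₀ := by
    refine span_range_sq_le fun i j => ?_
    refine ⟨_, (hm i).mul (hm j), 1, Eventually.of_forall fun x => ?_⟩
    have h1 : ∀ i, m i x * m i x ≤ S x := fun i =>
      Finset.single_le_sum (f := fun i => m i x * m i x) (fun i _ => mul_self_nonneg _)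
        (Finset.mem_univ i)
    rw [one_mul, abs_le]
    constructor <;> nlinarith [h1 i, h1 j, mul_self_nonneg (m i x + m j x),
      mul_self_nonneg (m i x - m j x)]
  have hb : ∀ a, ∃ C, ∀ᶠ x in 𝓝 x₀, |partialD S a x| ≤ C * S x := fun a => by
    obtain ⟨f, hf, C, hC⟩ := hle (hd a)
    refine ⟨C, ?_⟩
    filter_upwards [hC, ((hSg.germD a).eq_iff hf).1 rfl] with x h1 h2
    rwa [h2]
  choose C hC using hb
  have hev : ∀ᶠ x in 𝓝 x₀, DifferentiableAt ℝ S x ∧ ∀ a, |partialD S a x| ≤ C a * S x :=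
    hSg.1.eventually_differentiableAt.and (eventually_all.2 hC)
  obtain ⟨ε, hε, hball⟩ := Metric.eventually_nhds_iff_ball.1 hev
  have hS0 : S x₀ = 0 := by
    refine Finset.sum_eq_zero fun i _ => ?_
    rw [← (hm i).value, h0, mul_zero]
  have hnn : ∀ x, 0 ≤ S x := fun x => Finset.sum_nonneg fun i _ => mul_self_nonneg _
  have hzero : S =ᶠ[𝓝 x₀] fun _ => 0 := by
    filter_upwards [Metric.ball_mem_nhds x₀ hε] with x hx
    have hseg : ∀ t ∈ Set.Icc (0 : ℝ) 1, x₀ + t • (x - x₀) ∈ Metric.ball x₀ ε := fun t ht =>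
      (convex_ball x₀ ε).add_smul_sub_mem (Metric.mem_ball_self hε) hx ht
    have hder : ∀ t ∈ Set.Icc (0 : ℝ) 1, HasDerivAt (fun t : ℝ => S (x₀ + t • (x - x₀)))
        (fderiv ℝ S (x₀ + t • (x - x₀)) (x - x₀)) t := fun t ht => by
      have h1 : HasDerivAt (fun t : ℝ => x₀ + t • (x - x₀)) (x - x₀) t := by
        simpa using ((hasDerivAt_id t).smul_const (x - x₀)).const_add x₀
      exact (hball _ (hseg t ht)).1.hasFDerivAt.comp_hasDerivAt t h1
    -- The one-dimensional inequality on the segment from `x₀` to `x`; `K` combines the bounds for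
    -- the coordinate derivatives with the components of the segment.
    have key := eq_zero_of_abs_deriv_le_mul_abs_self_of_eq_zero_right
      (f := fun t : ℝ => S (x₀ + t • (x - x₀)))
      (f' := fun t => fderiv ℝ S (x₀ + t • (x - x₀)) (x - x₀))
      (K := ∑ a, |x a - x₀ a| * C a) (a := 0) (b := 1)
      (fun t ht => (hder t ht).continuousAt.continuousWithinAt)
      (fun t ht => (hder t (Set.Ico_subset_Icc_self ht)).hasDerivWithinAt) (by simpa using hS0)
      (fun t ht => by
        have h1 := (hball _ (hseg t (Set.Ico_subset_Icc_self ht))).2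
        set y := x₀ + t • (x - x₀)
        have h2 : fderiv ℝ S y (x - x₀) = ∑ a, (x a - x₀ a) * partialD S a y := by
          conv_lhs => rw [pi_eq_sum_univ' (x - x₀)]
          simp [partialD]
        rw [h2, Real.norm_eq_abs, Real.norm_eq_abs, abs_of_nonneg (hnn y), Finset.sum_mul]
        refine (Finset.abs_sum_le_sum_abs _ _).trans (Finset.sum_le_sum fun a _ => ?_)
        rw [abs_mul, mul_assoc]
        exact mul_le_mul_of_nonneg_left (h1 a) (abs_nonneg _))
      1 (by simp)
    simpa using key
  exact eq_zero_of_sum_sq ((hSg.eq_iff .zero).2 hzero) i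

end Germs

/-! ### The stereographic null frame of Minkowski space -/

section StandardFrame

variable {m : ℕ} {R : Type*} [CommRing R] [Algebra ℝ R]

/-- The signature of the Minkowski metric. -/
def stdSign (m : ℕ) (R : Type*) [CommRing R] : Fin (m + 2) → R :=
  Fin.cons (-1) (Fin.cons 1 fun _ => 1)

/-- A constant null vector. -/
def stdU (m : ℕ) (σ : R) : Fin (m + 2) → R := Fin.cons 1 (Fin.cons σ fun _ => 0)

/-- The null vector with parameters `Y`. -/
def stdD (σ t : R) (Y : Fin m → R) : Fin (m + 2) → R :=
  Fin.cons (-(t * (1 + ∑ i, Y i * Y i))) (Fin.cons (σ * (t * (1 - ∑ i, Y i * Y i))) Y)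

/-- The spacelike vectors orthogonal to the null vector with parameters `Y`. -/
def stdX (σ : R) (Y : Fin m → R) (i : Fin m) : Fin (m + 2) → R :=
  Fin.cons (-(Y i)) (Fin.cons (-(σ * Y i)) (Pi.single i 1))

/-- `stdD` is the stereographic chart of the light cone normalized by `D · U = 1`, hence quadratic
in `Y`. `t` is one half, and the sign `σ` selects the null direction `U` that the chart omits. -/
theorem stdFrame {δ : Fin (m + 2) → Derivation ℝ R R}
    (hδ : ∀ a b f, δ a (δ b f) = δ b (δ a f)) {σ t : R} (hσ : σ * σ = 1) (ht : 2 * t = 1)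
    (hσ' : ∀ a, δ a σ = 0) (Y : Fin m → R) :
    FlatNullFrame δ (stdSign m R) (stdD σ t Y) (stdU m σ) (stdX σ Y) Y := by
  have ht' : ∀ a, δ a t = 0 := fun a => by
    have h2 : δ a (2 : R) = 0 := by simpa using (δ a).map_natCast 2
    have h1 := congrArg (δ a) ht
    rw [Derivation.leibniz, h2, Derivation.map_one_eq_zero, smul_eq_mul, smul_zero, add_zero] at h1
    linear_combination t * h1 - δ a t * ht
  refine ⟨hδ, ?_, ?_, ?_, ?_, ?_, ?_, ?_, ?_, ?_, ?_, ?_, ?_⟩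
  · intro a b
    refine Fin.cases ?_ (fun b => Fin.cases ?_ (fun b => ?_) b) b <;> simp [stdSign]
  · intro a
    refine Fin.cases ?_ (fun b => Fin.cases ?_ (fun b => ?_) b) a <;> simp [stdSign]
  · intro a b
    refine Fin.cases ?_ (fun b => Fin.cases ?_ (fun b => ?_) b) b <;> simp [stdU, hσ']
  · intro a i b
    refine Fin.cases ?_ (fun b => Fin.cases ?_ (fun b => ?_) b) b
    · simp [stdU, stdX]
    · simp [stdU, stdX, hσ', mul_comm]
    · simp only [stdU, stdX, Fin.cons_succ, mul_zero, neg_zero, Pi.single_apply]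
      split_ifs <;> simp
  · intro a b
    have h1 : δ a (∑ i, Y i * Y i) = 2 * ∑ i, δ a (Y i) * Y i := by
      rw [map_sum, Finset.mul_sum]
      exact Finset.sum_congr rfl fun i _ => by
        rw [Derivation.leibniz, smul_eq_mul]; ring
    refine Fin.cases ?_ (fun b => Fin.cases ?_ (fun b => ?_) b) b
    · simp only [stdD, stdX, Fin.cons_zero, map_neg, Derivation.leibniz, smul_eq_mul, map_add, h1,
        ht', Derivation.map_one_eq_zero, mul_neg, Finset.sum_neg_distrib]
      linear_combination (-∑ i, δ a (Y i) * Y i) * ht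
    · simp only [stdD, stdX, Fin.cons_zero, Fin.cons_succ, Derivation.leibniz, smul_eq_mul,
        map_sub, h1, ht', hσ', Derivation.map_one_eq_zero, mul_neg, Finset.sum_neg_distrib]
      have : ∑ i, δ a (Y i) * (σ * Y i) = σ * ∑ i, δ a (Y i) * Y i := by
        rw [Finset.mul_sum]; exact Finset.sum_congr rfl fun _ _ => by ring
      rw [this]
      linear_combination (-σ * ∑ i, δ a (Y i) * Y i) * ht
    · simp [stdD, stdX, Pi.single_apply]
  · simp only [dot, Fin.sum_univ_succ, stdSign, stdD, Fin.cons_zero, Fin.cons_succ, one_mul]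
    linear_combination t ^ 2 * (1 - ∑ i, Y i * Y i) ^ 2 * hσ
      + (-(∑ i, Y i * Y i) * (2 * t + 1)) * ht
  · simp only [dot, Fin.sum_univ_succ, stdSign, stdD, stdU, Fin.cons_zero, Fin.cons_succ, one_mul,
      mul_zero, Finset.sum_const_zero]
    linear_combination t * (1 - ∑ i, Y i * Y i) * hσ + ht
  · simp only [dot, Fin.sum_univ_succ, stdSign, stdU, Fin.cons_zero, Fin.cons_succ, one_mul,
      mul_zero, Finset.sum_const_zero]
    linear_combination hσ
  · intro i
    simp only [dot, Fin.sum_univ_succ, stdSign, stdD, stdX, Fin.cons_zero, Fin.cons_succ, one_mul,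
      Pi.single_apply, mul_ite, mul_one, mul_zero, Finset.sum_ite_eq', Finset.mem_univ, if_true]
    linear_combination -t * (1 - ∑ i, Y i * Y i) * Y i * hσ - Y i * ht
  · intro i
    simp only [dot, Fin.sum_univ_succ, stdSign, stdU, stdX, Fin.cons_zero, Fin.cons_succ, one_mul,
      zero_mul, mul_zero, Finset.sum_const_zero]
    linear_combination -Y i * hσ
  · intro i j
    simp only [dot, Fin.sum_univ_succ, stdSign, stdX, Fin.cons_zero, Fin.cons_succ, one_mul,
      Pi.single_apply, mul_ite, mul_one, mul_zero, Finset.sum_ite_eq', Finset.mem_univ, if_true]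
    rw [show (if i = j then (1 : R) else 0) = if j = i then 1 else 0 by simp only [eq_comm]]
    linear_combination Y i * Y j * hσ
  · have hX : ∀ b (c : Fin m), ∑ i, stdX σ Y i b * (Pi.single i 1 : Fin m → R) c
        = stdX σ Y c b := fun b c => by simp [Pi.single_apply]
    have hs : ∀ a b, stdD σ t Y a * stdU m σ b + stdU m σ a * stdD σ t Y b
        + ∑ i, stdX σ Y i a * stdX σ Y i b
        = stdD σ t Y b * stdU m σ a + stdU m σ b * stdD σ t Y a
        + ∑ i, stdX σ Y i b * stdX σ Y i a := fun a b => by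
      rw [Finset.sum_congr rfl fun i _ => mul_comm (stdX σ Y i a) (stdX σ Y i b)]; ring
    have hlast : ∀ a (c : Fin m), stdD σ t Y a * stdU m σ c.succ.succ
        + stdU m σ a * stdD σ t Y c.succ.succ + ∑ i, stdX σ Y i a * stdX σ Y i c.succ.succ
        = if a = c.succ.succ then stdSign m R a else 0 := fun a c => by
      have h1 : ∑ i, stdX σ Y i a * stdX σ Y i c.succ.succ = stdX σ Y c a := by
        rw [← hX]; rfl
      rw [h1]
      refine Fin.cases ?_ (fun a => Fin.cases ?_ (fun a => ?_) a) a
      · rw [if_neg (by simp [Fin.ext_iff])]; simp [stdD, stdU, stdX]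
      · rw [if_neg (by simp [Fin.ext_iff])]; simp [stdD, stdU, stdX]
      · simp [stdD, stdU, stdX, stdSign, Pi.single_apply]
    intro a b
    refine Fin.cases ?_ (fun b => Fin.cases ?_ (fun b => hlast a b) b) b
    · refine Fin.cases ?_ (fun a => Fin.cases ?_ (fun a => ?_) a) a
      · simp only [stdD, stdU, stdX, stdSign, Fin.cons_zero, if_true, neg_mul_neg]
        linear_combination (-1 - ∑ i, Y i * Y i) * ht
      · simp only [stdD, stdU, stdX, stdSign, Fin.cons_zero, Fin.cons_succ, Fin.succ_ne_zero,
          if_false, mul_neg, neg_mul, neg_neg]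
        have : ∑ i, σ * Y i * Y i = σ * ∑ i, Y i * Y i := by
          rw [Finset.mul_sum]; exact Finset.sum_congr rfl fun _ _ => by ring
        rw [this]
        linear_combination -σ * (∑ i, Y i * Y i) * ht
      · rw [hs, hlast, if_neg (by simp [Fin.ext_iff]), if_neg (by simp [Fin.ext_iff])]
    · refine Fin.cases ?_ (fun a => Fin.cases ?_ (fun a => ?_) a) a
      · simp only [stdD, stdU, stdX, stdSign, Fin.cons_zero, Fin.cons_succ,
          (Fin.succ_ne_zero _).symm, if_false, mul_neg, neg_mul, neg_neg]
        have : ∑ i, Y i * (σ * Y i) = σ * ∑ i, Y i * Y i := by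
          rw [Finset.mul_sum]; exact Finset.sum_congr rfl fun _ _ => by ring
        rw [this]
        linear_combination -σ * (∑ i, Y i * Y i) * ht
      · simp only [stdD, stdU, stdX, stdSign, Fin.cons_zero, Fin.cons_succ, if_true, neg_mul_neg]
        have : ∑ i, σ * Y i * (σ * Y i) = σ * σ * ∑ i, Y i * Y i := by
          rw [Finset.mul_sum]; exact Finset.sum_congr rfl fun _ _ => by ring
        rw [this]
        linear_combination (2 * t + (1 - 2 * t) * ∑ i, Y i * Y i) * hσ
          + (1 - ∑ i, Y i * Y i) * ht
      · rw [hs, hlast, if_neg (by simp [Fin.ext_iff]), if_neg (by simp [Fin.ext_iff])]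

end StandardFrame

/-! ### Coordinate curvature as germs -/

section Bridge

open Filter Topology

variable {n : ℕ} {x₀ : Coord n}

/-- The identity between germs is a matrix identity at every nearby point, and there a one-sided
inverse is the inverse. -/
theorem IsGerm.inv_matrix {G : MetricField n} {g gi : Fin n → Fin n → SmoothGerm x₀}
    (hG : ∀ a b, IsGerm x₀ (fun x => G x a b) (g a b))
    (hi : ∀ a b, ∑ e, g a e * gi e b = if a = b then 1 else 0) (a b : Fin n) :
    IsGerm x₀ (fun x => (G x)⁻¹ a b) (gi a b) := by
  choose f hf using fun a b => exists_rep (gi a b)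
  refine (hf a b).congr ?_
  have h1 : ∀ a b, ∀ᶠ x in 𝓝 x₀, ∑ e, G x a e * f e b x = if a = b then 1 else 0 := fun a b => by
    refine ((IsGerm.sum fun e => (hG a e).mul (hf e b)).eq_iff
      (g := fun _ => if a = b then 1 else 0) (s := if a = b then 1 else 0) ?_).1 (hi a b)
    split_ifs
    · exact .one
    · exact .zero
  filter_upwards [eventually_all.2 fun a => eventually_all.2 (h1 a)] with x hx
  have : G x * Matrix.of (fun e b => f e b x) = 1 := by
    ext a b
    rw [Matrix.mul_apply, Matrix.one_apply]
    exact hx a b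
  rw [Matrix.inv_eq_right_inv this]
  rfl

variable {G : MetricField n} {g gi : Fin n → Fin n → SmoothGerm x₀}
  (hG : ∀ a b, IsGerm x₀ (fun x => G x a b) (g a b))
  (hi : ∀ a b, ∑ e, g a e * gi e b = if a = b then 1 else 0)
include hG hi

theorem isGerm_christoffel (c a b : Fin n) :
    IsGerm x₀ (fun x => christoffel G x c a b) (formalChristoffel (germD x₀) g gi c a b) :=
  (IsGerm.const (1 / 2)).mul <| IsGerm.sum fun d => (IsGerm.inv_matrix hG hi c d).mul <|
    (((hG d b).germD a).add ((hG d a).germD b)).sub ((hG a b).germD d)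

theorem isGerm_riemannUp (a b c d : Fin n) :
    IsGerm x₀ (fun x => riemannUp G x a b c d) (formalRiemannUp (germD x₀) g gi a b c d) := by
  have h1 := isGerm_christoffel hG hi
  exact (((h1 a d b).germD c).sub ((h1 a c b).germD d)).add <| IsGerm.sum fun e =>
    ((h1 a c e).mul (h1 e d b)).sub ((h1 a d e).mul (h1 e c b))

theorem isGerm_riemann (a b c d : Fin n) :
    IsGerm x₀ (fun x => riemann G x a b c d) (formalRiemann (germD x₀) g gi a b c d) :=
  IsGerm.sum fun e => (hG a e).mul (isGerm_riemannUp hG hi e b c d)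

theorem isGerm_ricci (b d : Fin n) :
    IsGerm x₀ (fun x => ricci G x b d) (formalRicci (germD x₀) g gi b d) :=
  IsGerm.sum fun a => isGerm_riemannUp hG hi a b a d

theorem isGerm_covDeriv {k : Coord n → Coord n} {κ : Fin n → SmoothGerm x₀}
    (hk : ∀ a, IsGerm x₀ (fun x => k x a) (κ a)) (a b : Fin n) :
    IsGerm x₀ (fun x => covDeriv G k x a b)
      (germD x₀ b (κ a) - ∑ c, formalChristoffel (germD x₀) g gi c a b * κ c) :=
  ((hk a).germD b).sub <| IsGerm.sum fun c => (isGerm_christoffel hG hi c a b).mul (hk c)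

end Bridge

/-! ### Local model of a Kerr–Schild metric -/

section LocalModel

open Filter Topology

variable {n : ℕ} {ι : Type*} [Fintype ι] [DecidableEq ι]

/-- The germ of a Kerr-Schild metric in terms of a null frame of the flat background. -/
structure LocalModel (H : Coord n → ℝ) (k : Coord n → Coord n) (x₀ : Coord n)
    (η D U : Fin n → SmoothGerm x₀) (X : ι → Fin n → SmoothGerm x₀) (Y : ι → SmoothGerm x₀)
    (h l : SmoothGerm x₀) : Prop where
  frame : FlatNullFrame (germD x₀) η D U X Y
  h_ne : germValue x₀ h ≠ 0
  l_ne : germValue x₀ l ≠ 0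
  covector : ∀ a, IsGerm x₀ (fun x => k x a) (l * (η a * D a))
  vector : ∀ a, ksVector k x₀ a = germValue x₀ (l * D a)
  metric : ∀ a b, IsGerm x₀ (fun x => ksMetric H k x a b) (ksLow η D h a b)

theorem minkowski_inv (n : ℕ) : (minkowski n)⁻¹ = minkowski n := by
  refine Matrix.inv_eq_right_inv ?_
  rw [minkowski, Matrix.diagonal_mul_diagonal, ← Matrix.diagonal_one]
  congr 1
  ext a
  split_ifs <;> norm_num

theorem minkowski_apply (m : ℕ) (a b : Fin (m + 2)) :
    minkowski (m + 2) a b = if a = b then stdSign m ℝ a else 0 := by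
  rw [minkowski, Matrix.diagonal_apply]
  congr 1
  refine Fin.cases ?_ (fun a => Fin.cases ?_ (fun a => ?_) a) a <;> simp [stdSign]

/-- A nonzero null covector has `k_0 ≠ 0`, so `l = k(U) = k_0 + σ k_1` is nonzero for one of the
signs. Dividing by `l` gives the normalization of the stereographic chart, with `Y_i` the remaining
components of `k / l`. -/
theorem exists_localModel {m : ℕ} {H : Coord (m + 2) → ℝ} {k : Coord (m + 2) → Coord (m + 2)}
    {V : Set (Coord (m + 2))} (hV : IsOpen V) (hH : ContDiffOn ℝ ∞ H V) (hk : ContDiffOn ℝ ∞ k V)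
    (hH0 : ∀ x ∈ V, H x ≠ 0) (hnull : IsNullOneForm k V) {x₀ : Coord (m + 2)} (hx : x₀ ∈ V) :
    ∃ (η D U : Fin (m + 2) → SmoothGerm x₀) (X : Fin m → Fin (m + 2) → SmoothGerm x₀)
      (Y : Fin m → SmoothGerm x₀) (h l : SmoothGerm x₀), LocalModel H k x₀ η D U X Y h l := by
  have hsq : ∀ x ∈ V, k x 0 * k x 0 = k x 1 * k x 1 + ∑ i : Fin m, k x i.succ.succ * k x i.succ.succ
      := fun x hx => by
    have h1 := (hnull x hx).2
    simp only [minkowski_inv, minkowski_apply, ite_mul, zero_mul, Finset.sum_ite_eq,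
      Finset.mem_univ, if_true, Fin.sum_univ_succ, stdSign, Fin.cons_zero, Fin.cons_succ,
      one_mul, Fin.succ_zero_eq_one] at h1
    linarith
  have hk0 : k x₀ 0 ≠ 0 := fun h0 => by
    have h1 := hsq x₀ hx
    have h2 : 0 ≤ ∑ i : Fin m, k x₀ i.succ.succ * k x₀ i.succ.succ :=
      Finset.sum_nonneg fun _ _ => mul_self_nonneg _
    have h3 := mul_self_nonneg (k x₀ 1)
    rw [h0, mul_zero] at h1
    have h4 : k x₀ 1 = 0 := mul_self_eq_zero.1 (by linarith)
    have h5 : ∑ i : Fin m, k x₀ i.succ.succ * k x₀ i.succ.succ = 0 := by linarith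
    refine (hnull x₀ hx).1 (funext fun a => ?_)
    refine Fin.cases h0 (fun a => Fin.cases h4 (fun a => ?_) a) a
    exact mul_self_eq_zero.1 ((Finset.sum_eq_zero_iff_of_nonneg fun _ _ => mul_self_nonneg _).1 h5 a
      (Finset.mem_univ a))
  obtain ⟨s, hs, hl⟩ : ∃ s : ℝ, s * s = 1 ∧ k x₀ 0 + s * k x₀ 1 ≠ 0 := by
    by_cases h1 : k x₀ 0 + k x₀ 1 = 0
    · exact ⟨-1, by norm_num, fun h2 => hk0 (by linarith)⟩
    · exact ⟨1, by norm_num, by rwa [one_mul]⟩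
  have hVx : V ∈ 𝓝 x₀ := hV.mem_nhds hx
  choose κ hκ using fun a => ((contDiffAt_pi.1 (hk.contDiffAt hVx)) a).exists_germ
  obtain ⟨χ, hχ⟩ := (hH.contDiffAt hVx).exists_germ
  set σ : SmoothGerm x₀ := algebraMap ℝ _ s with hσ_def
  set t : SmoothGerm x₀ := algebraMap ℝ _ (1 / 2) with ht_def
  have hσg : IsGerm x₀ (fun _ => s) σ := .const s
  have ht : 2 * t = 1 := by
    rw [ht_def, ← map_ofNat (algebraMap ℝ (SmoothGerm x₀)) 2, ← map_mul]; norm_num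
  have hσ : σ * σ = 1 := by rw [hσ_def, ← map_mul, hs, map_one]
  set l : SmoothGerm x₀ := κ 0 + σ * κ 1 with hl_def
  have hlg : IsGerm x₀ (fun x => k x 0 + s * k x 1) l := (hκ 0).add (hσg.mul (hκ 1))
  have hl0 : germValue x₀ l ≠ 0 := by rwa [hlg.value]
  obtain ⟨l', hl'⟩ := exists_inv hl0
  set Y : Fin m → SmoothGerm x₀ := fun i => κ i.succ.succ * l' with hY
  have hsqg : κ 0 * κ 0 = κ 1 * κ 1 + ∑ i : Fin m, κ i.succ.succ * κ i.succ.succ := by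
    refine (((hκ 0).mul (hκ 0)).eq_iff (((hκ 1).mul (hκ 1)).add
      (IsGerm.sum fun i => (hκ _).mul (hκ _)))).2 ?_
    filter_upwards [hVx] with x hx
    exact hsq x hx
  -- The null condition factors as `(k_0 + σ k_1)(k_0 - σ k_1) = ∑ k_i²`, and the first factor is
  -- `l`.
  have hYY : ∑ i, Y i * Y i = l' * (κ 0 - σ * κ 1) := by
    have h1 : ∑ i, Y i * Y i = l' ^ 2 * ∑ i : Fin m, κ i.succ.succ * κ i.succ.succ := by
      rw [Finset.mul_sum]; exact Finset.sum_congr rfl fun i _ => by rw [hY]; ring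
    rw [h1]
    linear_combination (-l' ^ 2) * hsqg + l' * (κ 0 - σ * κ 1) * hl' + l' ^ 2 * κ 1 * κ 1 * hσ
  have hkd : ∀ a, κ a = l * (stdSign m _ a * stdD σ t Y a) := fun a => by
    refine Fin.cases ?_ (fun a => Fin.cases ?_ (fun a => ?_) a) a
    · simp only [stdSign, stdD, Fin.cons_zero, hYY]
      linear_combination (-κ 0) * ht - t * (κ 0 - σ * κ 1) * hl'
    · change κ 1 = l * (1 * (σ * (t * (1 - ∑ i, Y i * Y i))))
      rw [hYY]
      linear_combination (-κ 1) * ht + σ * t * (κ 0 - σ * κ 1) * hl' - 2 * t * κ 1 * hσ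
    · simp only [stdSign, stdD, Fin.cons_succ, hY]
      linear_combination (-κ a.succ.succ) * hl'
  have hfr : FlatNullFrame (germD x₀) (stdSign m (SmoothGerm x₀)) (stdD σ t Y) (stdU m σ)
      (stdX σ Y) Y := stdFrame germD_comm hσ ht (fun a => Derivation.map_algebraMap _ _) Y
  have hsgn : ∀ a, IsGerm x₀ (fun _ => stdSign m ℝ a) (stdSign m (SmoothGerm x₀) a) := fun a => by
    refine Fin.cases ?_ (fun a => Fin.cases ?_ (fun a => ?_) a) a
    · exact IsGerm.one.neg
    · exact IsGerm.one
    · exact IsGerm.one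
  have hkg : ∀ a, IsGerm x₀ (fun x => k x a) (l * (stdSign m _ a * stdD σ t Y a)) := fun a => by
    rw [← hkd]; exact hκ a
  -- Replacing `k` by `D = k / l` in the metric moves `l²` into the profile function.
  refine ⟨stdSign m _, stdD σ t Y, stdU m σ, stdX σ Y, Y, l * l * χ, l, hfr, ?_, hl0, hkg, ?_, ?_⟩
  · rw [map_mul, map_mul, hχ.value]
    exact mul_ne_zero (mul_ne_zero hl0 hl0) (hH0 x₀ hx)
  · intro a
    have h1 : ksVector k x₀ a = stdSign m ℝ a * k x₀ a := by
      simp [ksVector, minkowski_inv, minkowski_apply]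
    rw [h1, ← (hsgn a).value, ← (hkg a).value, ← map_mul]
    congr 1
    linear_combination (l * stdD σ t Y a) * hfr.sq a
  · intro a b
    have h1 : IsGerm x₀ (fun _ => minkowski (m + 2) a b)
        (if a = b then stdSign m (SmoothGerm x₀) a else 0) := by
      simp only [minkowski_apply]
      split_ifs
      · exact hsgn a
      · exact .zero
    have h2 := h1.sub (((IsGerm.two.mul hχ).mul (hkg a)).mul (hkg b))
    have h3 : ksLow (stdSign m _) (stdD σ t Y) (l * l * χ) a b
        = (if a = b then stdSign m (SmoothGerm x₀) a else 0)
          - 2 * χ * (l * (stdSign m _ a * stdD σ t Y a)) * (l * (stdSign m _ b * stdD σ t Y b)) := by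
      rw [ksLow]; ring
    rw [h3]
    exact h2

end LocalModel

/-! ### Bilinear contraction and ring homomorphisms -/

section Contract

variable {n : ℕ} {R S : Type*} [CommRing R] [CommRing S]

/-- Contraction of the components of a tensor of rank two with two vectors. -/
def contract2 (T : Fin n → Fin n → R) (v w : Fin n → R) : R := ∑ a, ∑ b, T a b * v a * w b

theorem contract2_linear_left (T : Fin n → Fin n → R) (w : Fin n → R) :
    IsLinearMap R fun v => contract2 T v w where
  map_add x y := by
    simp only [contract2, ← Finset.sum_add_distrib, Pi.add_apply]
    exact Finset.sum_congr rfl fun _ _ => Finset.sum_congr rfl fun _ _ => by ring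
  map_smul r x := by
    simp only [contract2, Finset.mul_sum, Pi.smul_apply, smul_eq_mul]
    exact Finset.sum_congr rfl fun _ _ => Finset.sum_congr rfl fun _ _ => by ring

theorem contract2_linear_right (T : Fin n → Fin n → R) (v : Fin n → R) :
    IsLinearMap R fun w => contract2 T v w where
  map_add x y := by
    simp only [contract2, ← Finset.sum_add_distrib, Pi.add_apply]
    exact Finset.sum_congr rfl fun _ _ => Finset.sum_congr rfl fun _ _ => by ring
  map_smul r x := by
    simp only [contract2, Finset.mul_sum, Pi.smul_apply, smul_eq_mul]
    exact Finset.sum_congr rfl fun _ _ => Finset.sum_congr rfl fun _ _ => by ring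

theorem contract2_smul_left (T : Fin n → Fin n → R) (c : R) (v w : Fin n → R) :
    contract2 T (c • v) w = c * contract2 T v w := (contract2_linear_left T w).map_smul c v

theorem contract2_smul_right (T : Fin n → Fin n → R) (c : R) (v w : Fin n → R) :
    contract2 T v (c • w) = c * contract2 T v w := (contract2_linear_right T v).map_smul c w

theorem map_contract2 (φ : R →+* S) (T : Fin n → Fin n → R) (v w : Fin n → R) :
    φ (contract2 T v w) = contract2 (fun a b => φ (T a b)) (fun a => φ (v a)) fun a => φ (w a) := by
  simp only [contract2, map_sum, map_mul]

theorem map_contract4 (φ : R →+* S) (T : Fin n → Fin n → Fin n → Fin n → R)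
    (u v w z : Fin n → R) :
    φ (contract4 T u v w z) = contract4 (fun a b c d => φ (T a b c d)) (fun a => φ (u a))
      (fun a => φ (v a)) (fun a => φ (w a)) fun a => φ (z a) := by
  simp only [contract4, map_sum, map_mul]

theorem contract2_eq {T : Fin n → Fin n → R} {f : (Fin n → R) → (Fin n → R) → R}
    (h1 : ∀ w, IsLinearMap R fun v => f v w) (h2 : ∀ v, IsLinearMap R fun w => f v w)
    (hT : ∀ a b, T a b = f (Pi.single a 1) (Pi.single b 1)) (v w : Fin n → R) :
    contract2 T v w = f v w := by
  rw [← sum_single_mul (h1 w)]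
  refine Finset.sum_congr rfl fun a _ => ?_
  rw [← sum_single_mul (h2 _), Finset.sum_mul]
  exact Finset.sum_congr rfl fun b _ => by rw [hT]; ring

end Contract

/-! ### Null frames at a point -/

section Frames

variable {n : ℕ} {G : Matrix (Fin n) (Fin n) ℝ} {e : FrameIdx n → Coord n}

theorem frameProduct_sum (p : FrameIdx n) (f : FrameIdx n → ℝ) :
    ∑ q, frameProduct p q * f q = match p with
      | .inl p => f (.inl (1 - p))
      | .inr i => f (.inr i) := by
  rcases p with p | i
  · fin_cases p <;> simp [frameProduct]
  · simp [frameProduct]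

/-- The frame matrix satisfies `Eᵀ G E = P` with `P² = 1`. It is square because there are `n` labels
when `2 ≤ n`, so the one-sided inverse is two-sided and `G⁻¹ = E P Eᵀ`; no invertibility of `G` is
presupposed. -/
theorem IsNullFrame.inv_mul_and_complete (hn : 2 ≤ n) (he : IsNullFrame G e) :
    G⁻¹ * G = 1 ∧ ∀ a b, e (.inl 0) a * e (.inl 1) b + e (.inl 1) a * e (.inl 0) b
      + ∑ i, e (.inr i) a * e (.inr i) b = G⁻¹ a b := by
  let E : Matrix (Fin n) (FrameIdx n) ℝ := Matrix.of fun a p => e p a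
  let P : Matrix (FrameIdx n) (FrameIdx n) ℝ := Matrix.of frameProduct
  have h1 : E.transpose * G * E = P := by
    ext p q
    simp only [Matrix.mul_apply, Matrix.transpose_apply, E, P, Matrix.of_apply, Finset.sum_mul]
    rw [Finset.sum_comm, ← he p q]
    exact Finset.sum_congr rfl fun _ _ => Finset.sum_congr rfl fun _ _ => by ring
  have h2 : P * P = 1 := by
    ext p q
    rw [Matrix.mul_apply]
    refine (frameProduct_sum p fun r => frameProduct r q).trans ?_
    rcases p with p | i <;> rcases q with q | j
    · fin_cases p <;> fin_cases q <;> simp [frameProduct]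
    · simp [frameProduct]
    · simp [frameProduct]
    · simp [frameProduct, Matrix.one_apply]
  have h3 : (P * E.transpose * G) * E = 1 := by
    rw [← h2, ← h1]; simp only [Matrix.mul_assoc]
  have h4 : E * (P * E.transpose * G) = 1 := by
    refine (Matrix.mul_eq_one_comm_of_equiv (Fintype.equivOfCardEq ?_)).1 h3
    simp; omega
  have h5 : G⁻¹ = E * P * E.transpose := by
    refine Matrix.inv_eq_left_inv ?_
    rw [← h4]; simp only [Matrix.mul_assoc]
  refine ⟨by rw [h5, ← h4]; simp only [Matrix.mul_assoc], fun a b => ?_⟩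
  rw [h5, Matrix.mul_assoc, Matrix.mul_apply]
  have h6 : ∀ p, (P * E.transpose) p b = ∑ q, frameProduct p q * e q b := fun p => by
    rw [Matrix.mul_apply]; rfl
  simp only [h6, frameProduct_sum]
  simp only [Fintype.sum_sum_type, Fin.sum_univ_two, E, Matrix.of_apply]
  simp

theorem IsNullFrame.complete (hn : 2 ≤ n) (he : IsNullFrame G e) (a b : Fin n) :
    e (.inl 0) a * e (.inl 1) b + e (.inl 1) a * e (.inl 0) b
      + ∑ i, e (.inr i) a * e (.inr i) b = G⁻¹ a b := (he.inv_mul_and_complete hn).2 a b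

theorem IsNullFrame.expand (hn : 2 ≤ n) (he : IsNullFrame G e) (v : Coord n) :
    v = contract2 G (e (.inl 1)) v • e (.inl 0) + contract2 G (e (.inl 0)) v • e (.inl 1)
      + ∑ i, contract2 G (e (.inr i)) v • e (.inr i) := by
  ext a
  have h1 : v a = ∑ c, (G⁻¹ * G) a c * v c := by
    rw [(he.inv_mul_and_complete hn).1]; simp [Matrix.one_apply]
  have h2 : ∀ c, (G⁻¹ * G) a c * v c = (∑ b, G b c * e (.inl 1) b * v c) * e (.inl 0) a
      + (∑ b, G b c * e (.inl 0) b * v c) * e (.inl 1) a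
      + ∑ i, (∑ b, G b c * e (.inr i) b * v c) * e (.inr i) a := fun c => by
    simp only [Matrix.mul_apply, ← he.complete hn, add_mul, Finset.sum_add_distrib, Finset.sum_mul]
    congr 1
    · congr 1 <;> exact Finset.sum_congr rfl fun _ _ => by ring
    · rw [Finset.sum_comm]
      exact Finset.sum_congr rfl fun _ _ => Finset.sum_congr rfl fun _ _ => by ring
  rw [h1, Finset.sum_congr rfl fun c _ => h2 c]
  simp only [Finset.sum_add_distrib, Pi.add_apply, Pi.smul_apply, smul_eq_mul, Finset.sum_apply,
    contract2]
  congr 1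
  · congr 1 <;> rw [← Finset.sum_mul, Finset.sum_comm]
  · rw [Finset.sum_comm]
    refine Finset.sum_congr rfl fun i _ => ?_
    rw [← Finset.sum_mul, Finset.sum_comm]

/-- A boost of a null frame. -/
noncomputable def boostFrame (c : ℝ) (e : FrameIdx n → Coord n) : FrameIdx n → Coord n
  | .inl p => if p = 0 then c • e (.inl 0) else c⁻¹ • e (.inl 1)
  | .inr i => e (.inr i)

theorem IsNullFrame.boost (he : IsNullFrame G e) {c : ℝ} (hc : c ≠ 0) :
    IsNullFrame G (boostFrame c e) := by
  have h1 : ∀ p q, contract2 (fun a b => G a b) (e p) (e q) = frameProduct p q := he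
  intro p q
  change contract2 (fun a b => G a b) (boostFrame c e p) (boostFrame c e q) = _
  rcases p with p | i <;> rcases q with q | j
  · fin_cases p <;> fin_cases q <;>
      simp [boostFrame, contract2_smul_left, contract2_smul_right, h1, frameProduct, hc]
  · fin_cases p <;> simp [boostFrame, contract2_smul_left, h1, frameProduct]
  · fin_cases q <;> simp [boostFrame, contract2_smul_right, h1, frameProduct]
  · exact h1 _ _

/-- The trace of a bilinear form over the spacelike vectors of a null frame depends only on the
first null vector if the form vanishes on it suitably. -/
theorem IsNullFrame.trace_eq (hn : 2 ≤ n) {e' : FrameIdx n → Coord n} (he : IsNullFrame G e)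
    (he' : IsNullFrame G e') (h0 : e (.inl 0) = e' (.inl 0)) {B : Fin n → Fin n → ℝ} {A : ℝ}
    (hl : ∀ w, contract2 B (e (.inl 0)) w = 0)
    (hr : ∀ v, contract2 B v (e (.inl 0)) = A * contract2 G (e (.inl 0)) v) :
    ∑ i, contract2 B (e (.inr i)) (e (.inr i)) = ∑ i, contract2 B (e' (.inr i)) (e' (.inr i)) := by
  -- The full trace with `G⁻¹` is independent of the frame, and the two mixed null terms are `0` and
  -- `A` in either frame.
  have key : ∀ e : FrameIdx n → Coord n, IsNullFrame G e →
      ∑ a, ∑ b, B a b * G⁻¹ a b = contract2 B (e (.inl 0)) (e (.inl 1))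
        + contract2 B (e (.inl 1)) (e (.inl 0)) + ∑ i, contract2 B (e (.inr i)) (e (.inr i)) := by
    intro e he
    simp only [← he.complete hn, contract2, mul_add, Finset.sum_add_distrib, Finset.mul_sum]
    congr 1
    · congr 1 <;>
        exact Finset.sum_congr rfl fun _ _ => Finset.sum_congr rfl fun _ _ => by ring
    · have h1 : ∀ a, ∑ b, ∑ i, B a b * (e (.inr i) a * e (.inr i) b)
          = ∑ i, ∑ b, B a b * (e (.inr i) a * e (.inr i) b) := fun a => Finset.sum_comm
      rw [Finset.sum_congr rfl fun a _ => h1 a, Finset.sum_comm]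
      exact Finset.sum_congr rfl fun _ _ => Finset.sum_congr rfl fun _ _ =>
        Finset.sum_congr rfl fun _ _ => by ring
  have h1 := key e he
  rw [key e' he', ← h0, hl, hl, hr, hr, h0] at h1
  have h2 : contract2 G (e' (.inl 0)) (e' (.inl 1)) = 1 := (he' _ _).trans (by simp [frameProduct])
  have h3 : contract2 G (e (.inl 0)) (e (.inl 1)) = 1 := (he _ _).trans (by simp [frameProduct])
  rw [h0] at h3
  rw [h2, h3] at h1
  linarith

end Frames

/-! ### The Kerr–Schild frame and the covariant derivative of `k` -/

section FrameValues

open Filter Topology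

variable {n : ℕ} {ι R : Type*} [Fintype ι] [DecidableEq ι] [CommRing R] [Algebra ℝ R]
  {δ : Fin n → Derivation ℝ R R} {η D U : Fin n → R} {X : ι → Fin n → R} {Y : ι → R} {h : R}

theorem contract2_ksLow (v w : Fin n → R) :
    contract2 (ksLow η D h) v w = dot η v w - 2 * h * dot η D v * dot η D w := by
  refine contract2_eq (f := fun v w => dot η v w - 2 * h * dot η D v * dot η D w)
    (fun w => ⟨fun x y => ?_, fun r x => ?_⟩) (fun v => ⟨fun x y => ?_, fun r x => ?_⟩)
    (fun a b => ?_) v w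
  · rw [dot_comm (x + y), dot_add_right, dot_add_right, dot_comm w, dot_comm w]; ring
  · rw [dot_comm (r • x), dot_smul_right, dot_smul_right, dot_comm w, smul_eq_mul]; ring
  · simp only [dot_add_right]; ring
  · simp only [dot_smul_right, smul_eq_mul]; ring
  · simp only [dot_single, ksLow, Pi.single_apply]
    split_ifs with h1 h2 h2
    · subst h1; ring
    · exact absurd h1.symm h2
    · exact absurd h2.symm h1
    · ring

theorem FlatNullFrame.contract2_ksFrame {X : Fin (n - 2) → Fin n → R} {Y : Fin (n - 2) → R}
    (H : FlatNullFrame δ η D U X Y) (p q : FrameIdx n) :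
    contract2 (ksLow η D h) (ksFrame D U X h p) (ksFrame D U X h q) = match p, q with
      | .inl p, .inl q => if p = q then 0 else 1
      | .inr i, .inr j => if i = j then 1 else 0
      | _, _ => 0 := by
  have h1 : dot η U D = 1 := H.UD
  have key : ∀ v, dot η (U + h • D) v = dot η U v + h * dot η D v := fun v => by
    rw [dot_comm, dot_add_right, dot_smul_right, dot_comm v, dot_comm v]
  rw [contract2_ksLow]
  rcases p with p | i <;> rcases q with q | j
  · fin_cases p <;> fin_cases q <;>
      simp [ksFrame, dot_add_right, dot_smul_right, H.DD, H.DU, H.UD, H.UU, key]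
    ring
  · fin_cases p <;> simp [ksFrame, H.DX, H.UX, key]
  · fin_cases q <;> simp [ksFrame, dot_add_right, dot_smul_right, H.DX, H.XD, H.XU]
  · simp [ksFrame, H.XX, H.DX]

/-- The covariant derivative of the Kerr-Schild covector contracted with vectors. -/
theorem FlatNullFrame.contract2_covDeriv (H : FlatNullFrame δ η D U X Y) (l : R)
    (v w : Fin n → R) :
    contract2 (fun a b => δ b (l * (η a * D a))
        - ∑ c, formalChristoffel δ (ksLow η D h) (ksUp η D h) c a b * (l * (η c * D c))) v w
      = along δ w l * dot η D v + l * nullD δ η X Y v w - l * ksGamma δ η D X Y h D v w := by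
  refine contract2_eq (f := fun v w => along δ w l * dot η D v + l * nullD δ η X Y v w
      - l * ksGamma δ η D X Y h D v w)
    (fun w => ⟨fun x y => ?_, fun r x => ?_⟩) (fun v => ⟨fun x y => ?_, fun r x => ?_⟩)
    (fun a b => ?_) v w
  · simp only [(ksGamma_linear₂ δ η D X Y h D w).map_add, nullD_add_left, dot_add_right]; ring
  · simp only [(ksGamma_linear₂ δ η D X Y h D w).map_smul, nullD_smul_left, dot_smul_right,
      smul_eq_mul]; ring
  · simp only [(ksGamma_linear₃ δ η D X Y h D v).map_add, nullD_add_right, along_add]; ring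
  · simp only [(ksGamma_linear₃ δ η D X Y h D v).map_smul, nullD_smul_right, along_smul,
      smul_eq_mul]; ring
  · have h1 : ∀ d, ∑ c, ksUp η D h c d * (η c * D c) = D d := fun d => by
      have : ∀ c, ksUp η D h c d * (η c * D c)
          = (if c = d then η c * η c * D c else 0) + 2 * h * D d * (η c * D c * D c) := fun c => by
        rw [ksUp]; split_ifs <;> ring
      simp only [this, Finset.sum_add_distrib, ← Finset.mul_sum, Finset.sum_ite_eq',
        Finset.mem_univ, if_true, H.sq, one_mul]
      change D d + 2 * h * D d * dot η D D = D d
      rw [H.DD]; ring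
    have h2 : ∑ c, formalChristoffel δ (ksLow η D h) (ksUp η D h) c a b * (l * (η c * D c))
        = l * ksGamma δ η D X Y h D (Pi.single a 1) (Pi.single b 1) := by
      rw [← sum_single_mul (ksGamma_linear₁ δ η D X Y h _ _) D]
      simp only [formalChristoffel_eq, Finset.sum_mul, H.christoffelLow_eq]
      rw [Finset.sum_comm, Finset.mul_sum]
      refine Finset.sum_congr rfl fun d _ => ?_
      rw [← h1 d, Finset.mul_sum, Finset.mul_sum]
      exact Finset.sum_congr rfl fun _ _ => by ring
    have h3 : δ b (l * (η a * D a)) = l * δ b (η a * D a) + η a * D a * δ b l := by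
      rw [Derivation.leibniz, smul_eq_mul, smul_eq_mul]
    rw [h2, h3, H.d_null]
    simp only [along_single, dot_single]
    ring

/-- The connection changes the flat derivative of `k` only by a multiple of `k_a k_b`, invisible to
the vectors `X i`; the optical matrix is therefore that of the flat background. -/
theorem FlatNullFrame.ksGamma_D (H : FlatNullFrame δ η D U X Y)
    (geo : ∀ i, along δ D (Y i) = 0) (v w : Fin n → R) :
    ksGamma δ η D X Y h D v w = along δ D h * dot η D v * dot η D w := by
  have h1 : ∀ v, nullD δ η X Y v D = 0 := fun v => by simp [nullD, geo]
  simp only [ksGamma, perturbD, H.nullD_D, h1, H.DD]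
  ring

end FrameValues

/-! ### Geodetic property and expansion in the local model -/

namespace LocalModel

open Filter Topology

variable {n : ℕ} {H : Coord n → ℝ} {k : Coord n → Coord n} {x₀ : Coord n}
  {η D U : Fin n → SmoothGerm x₀} {X : Fin (n - 2) → Fin n → SmoothGerm x₀}
  {Y : Fin (n - 2) → SmoothGerm x₀} {h l : SmoothGerm x₀}
  (K : LocalModel H k x₀ η D U X Y h l)
include K

/-- The null frame of the Kerr-Schild metric at the base point. -/
theorem isNullFrame : IsNullFrame (ksMetric H k x₀)
    fun p a => germValue x₀ (ksFrame D U X h p a) := fun p q => by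
  have h1 := congrArg (germValue x₀) (K.frame.contract2_ksFrame (h := h) p q)
  rw [map_contract2] at h1
  simp only [(K.metric _ _).value] at h1
  refine h1.trans ?_
  rcases p with p | i <;> rcases q with q | j <;> simp only [frameProduct, map_zero]
  · split_ifs <;> simp
  · split_ifs <;> simp

theorem isGerm_riemann (a b c d : Fin n) :
    IsGerm x₀ (fun x => riemann (ksMetric H k) x a b c d)
      (formalRiemann (germD x₀) (ksLow η D h) (ksUp η D h) a b c d) :=
  KerrSchild.isGerm_riemann K.metric (K.frame.ks_mul h) a b c d

theorem value_ksRiemann (u v w z : Fin n → SmoothGerm x₀) :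
    germValue x₀ (ksRiemann (germD x₀) η D U X Y h u v w z)
      = contract4 (riemann (ksMetric H k) x₀) (fun a => germValue x₀ (u a))
        (fun a => germValue x₀ (v a)) (fun a => germValue x₀ (w a))
        fun a => germValue x₀ (z a) := by
  rw [← K.frame.contract4_formalRiemann, map_contract4]
  simp only [(K.isGerm_riemann _ _ _ _).value]

theorem ricci_zero (hvac : ∀ᶠ x in 𝓝 x₀, ∀ a b, ricci (ksMetric H k) x a b = 0) (b d : Fin n) :
    formalRicci (germD x₀) (ksLow η D h) (ksUp η D h) b d = 0 := by
  refine ((isGerm_ricci K.metric (K.frame.ks_mul h) b d).eq_iff .zero).2 ?_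
  filter_upwards [hvac] with x hx
  exact hx b d

theorem exists_h_inv : ∃ s, s * h = 1 := exists_inv K.h_ne

theorem geodetic (hR : ∀ b d, formalRicci (germD x₀) (ksLow η D h) (ksUp η D h) b d = 0)
    (i : Fin (n - 2)) : along (germD x₀) D (Y i) = 0 := by
  have h1 := K.frame.ricci_DD (h := h)
  simp only [hR, zero_mul, Finset.sum_const_zero] at h1
  obtain ⟨s, hs⟩ := K.exists_h_inv
  obtain ⟨t, ht⟩ := exists_half (SmoothGerm x₀)
  refine eq_zero_of_sum_sq (r := fun i => along (germD x₀) D (Y i)) ?_ i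
  set S := ∑ i, along (germD x₀) D (Y i) * along (germD x₀) D (Y i)
  linear_combination (-s * t) * h1 - S * ht - 2 * t * S * hs

/-- In an expanding Kerr-Schild congruence the trace of the optical matrix does not vanish. -/
theorem trace_ne_zero (hn : 2 ≤ n) (geo : ∀ i, along (germD x₀) D (Y i) = 0)
    (hexp : IsExpandingAt H k x₀) :
    germValue x₀ (∑ i, along (germD x₀) (X i) (Y i)) ≠ 0 := by
  obtain ⟨e, he, he0, hθ⟩ := hexp
  intro h0
  set lv := germValue x₀ l with hlv
  set B : Fin n → Fin n → ℝ := fun a b => covDeriv (ksMetric H k) k x₀ a b with hB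
  have hcov : ∀ v w : Fin n → SmoothGerm x₀,
      contract2 B (fun a => germValue x₀ (v a)) (fun a => germValue x₀ (w a))
        = germValue x₀ (along (germD x₀) w l * dot η D v + l * nullD (germD x₀) η X Y v w
          - l * (along (germD x₀) D h * dot η D v * dot η D w)) := fun v w => by
    rw [← K.frame.ksGamma_D geo, ← K.frame.contract2_covDeriv, map_contract2]
    simp only [(isGerm_covDeriv K.metric (K.frame.ks_mul h) K.covector _ _).value, hB]
  have hcst : ∀ v : Coord n, v = fun a => germValue x₀ (algebraMap ℝ (SmoothGerm x₀) (v a)) :=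
    fun v => funext fun a => ((IsGerm.const (v a)).value).symm
  set e₀ : FrameIdx n → Coord n := fun p a => germValue x₀ (ksFrame D U X h p a) with he₀
  have hk : ksVector k x₀ = lv • e₀ (.inl 0) := funext fun a => by
    rw [K.vector, map_mul]; rfl
  have hD0 : ∀ w, contract2 B (e₀ (.inl 0)) w = 0 := fun w => by
    rw [hcst w]
    refine (hcov D _).trans ?_
    rw [K.frame.DD, K.frame.nullD_D]
    simp
  have hD1 : ∀ v, contract2 B v (e₀ (.inl 0)) = germValue x₀ (along (germD x₀) D l)
      * contract2 (fun a b => ksMetric H k x₀ a b) (e₀ (.inl 0)) v := fun v => by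
    have hnull : ∀ v, nullD (germD x₀) η X Y v D = 0 := fun v => by simp [nullD, geo]
    rw [hcst v]
    refine (hcov _ D).trans ?_
    simp only [← (K.metric _ _).value]
    have h1 := map_contract2 (germValue x₀) (ksLow η D h) D
      fun a => algebraMap ℝ (SmoothGerm x₀) (v a)
    refine Eq.trans ?_ (congrArg _ h1)
    rw [contract2_ksLow, hnull, K.frame.DD, ← map_mul]
    congr 1
    ring
  -- The model frame starts with `D` rather than `k = l D`; a boost by the value of `l` makes the
  -- first vectors agree.
  have h1 := IsNullFrame.trace_eq hn he (K.isNullFrame.boost K.l_ne) (he0.trans hk)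
    (B := B) (A := germValue x₀ (along (germD x₀) D l)) (fun w => ?_) (fun v => ?_)
  · apply hθ
    rw [expansionScalar, Matrix.trace]
    have h2 : ∑ i, contract2 B (e₀ (.inr i)) (e₀ (.inr i)) = 0 := by
      have h3 : ∀ i, contract2 B (e₀ (.inr i)) (e₀ (.inr i))
          = lv * germValue x₀ (along (germD x₀) (X i) (Y i)) := fun i => by
        refine (hcov (X i) (X i)).trans ?_
        rw [K.frame.DX, K.frame.nullD_X, hlv, ← map_mul]
        congr 1; ring
      simp only [h3]
      rw [← Finset.mul_sum, ← map_sum, h0, mul_zero]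
    have h4 : ∑ i, contract2 B (e (.inr i)) (e (.inr i)) = 0 := h1.trans h2
    have h5 : ∑ i, (opticalMatrix (ksMetric H k) k x₀ e).diag i = 0 := h4
    rw [h5, zero_div]
  · rw [he0, hk, contract2_smul_left, hD0, mul_zero]
  · rw [he0, hk, contract2_smul_right, hD1]
    refine Eq.trans ?_ (congrArg _ (contract2_smul_left _ _ _ _).symm)
    ring

end LocalModel

/-! ### Multilinearity of the contraction -/

section Contract

variable {n : ℕ} {R : Type*} [CommRing R] (T : Fin n → Fin n → Fin n → Fin n → R)

theorem contract4_linear₁ (v w z : Fin n → R) : IsLinearMap R fun u => contract4 T u v w z where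
  map_add x y := by
    simp only [contract4, ← Finset.sum_add_distrib, Pi.add_apply]
    exact Finset.sum_congr rfl fun _ _ => Finset.sum_congr rfl fun _ _ =>
      Finset.sum_congr rfl fun _ _ => Finset.sum_congr rfl fun _ _ => by ring
  map_smul r x := by
    simp only [contract4, Finset.mul_sum, Pi.smul_apply, smul_eq_mul]
    exact Finset.sum_congr rfl fun _ _ => Finset.sum_congr rfl fun _ _ =>
      Finset.sum_congr rfl fun _ _ => Finset.sum_congr rfl fun _ _ => by ring

theorem contract4_linear₂ (u w z : Fin n → R) : IsLinearMap R fun v => contract4 T u v w z where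
  map_add x y := by
    simp only [contract4, ← Finset.sum_add_distrib, Pi.add_apply]
    exact Finset.sum_congr rfl fun _ _ => Finset.sum_congr rfl fun _ _ =>
      Finset.sum_congr rfl fun _ _ => Finset.sum_congr rfl fun _ _ => by ring
  map_smul r x := by
    simp only [contract4, Finset.mul_sum, Pi.smul_apply, smul_eq_mul]
    exact Finset.sum_congr rfl fun _ _ => Finset.sum_congr rfl fun _ _ =>
      Finset.sum_congr rfl fun _ _ => Finset.sum_congr rfl fun _ _ => by ring

theorem contract4_linear₃ (u v z : Fin n → R) : IsLinearMap R fun w => contract4 T u v w z where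
  map_add x y := by
    simp only [contract4, ← Finset.sum_add_distrib, Pi.add_apply]
    exact Finset.sum_congr rfl fun _ _ => Finset.sum_congr rfl fun _ _ =>
      Finset.sum_congr rfl fun _ _ => Finset.sum_congr rfl fun _ _ => by ring
  map_smul r x := by
    simp only [contract4, Finset.mul_sum, Pi.smul_apply, smul_eq_mul]
    exact Finset.sum_congr rfl fun _ _ => Finset.sum_congr rfl fun _ _ =>
      Finset.sum_congr rfl fun _ _ => Finset.sum_congr rfl fun _ _ => by ring

theorem contract4_linear₄ (u v w : Fin n → R) : IsLinearMap R fun z => contract4 T u v w z where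
  map_add x y := by
    simp only [contract4, ← Finset.sum_add_distrib, Pi.add_apply]
    exact Finset.sum_congr rfl fun _ _ => Finset.sum_congr rfl fun _ _ =>
      Finset.sum_congr rfl fun _ _ => Finset.sum_congr rfl fun _ _ => by ring
  map_smul r x := by
    simp only [contract4, Finset.mul_sum, Pi.smul_apply, smul_eq_mul]
    exact Finset.sum_congr rfl fun _ _ => Finset.sum_congr rfl fun _ _ =>
      Finset.sum_congr rfl fun _ _ => Finset.sum_congr rfl fun _ _ => by ring

end Contract

/-! ### Type III kills a component of boost weight zero -/

section TypeThree

variable {n : ℕ} {G : Matrix (Fin n) (Fin n) ℝ} {e : FrameIdx n → Coord n}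

theorem IsNullFrame.linear_apply (hn : 2 ≤ n) (he : IsNullFrame G e) {f : Coord n → ℝ}
    (hf : IsLinearMap ℝ f) (v : Coord n) :
    f v = contract2 G (e (.inl 1)) v * f (e (.inl 0)) + contract2 G (e (.inl 0)) v * f (e (.inl 1))
      + ∑ i, contract2 G (e (.inr i)) v * f (e (.inr i)) := by
  have h1 := congrArg (IsLinearMap.mk' f hf) (he.expand hn v)
  simpa only [map_add, map_sum, map_smul, IsLinearMap.mk'_apply, smul_eq_mul] using h1

/-- If the first null vector of a frame is doubly aligned with a tensor with the symmetries of the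
curvature, and the tensor is of type III or more special, then its components of type `0i1j`
vanish. -/
theorem component_eq_zero_of_aligned (hn : 2 ≤ n) (hG : ∀ a b, G a b = G b a) {C : Tensor4 n}
    (hl : ∀ u v w z, contract4 C v u w z = -contract4 C u v w z)
    (hs : ∀ u v w z, contract4 C u v w z = contract4 C w z u v) (he : IsNullFrame G e)
    (h1 : ∀ i j, contract4 C (e (.inl 0)) (e (.inr i)) (e (.inl 0)) (e (.inr j)) = 0)
    (h2 : ∀ i, contract4 C (e (.inl 0)) (e (.inr i)) (e (.inl 0)) (e (.inl 1)) = 0)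
    (h3 : ∀ i j k, contract4 C (e (.inl 0)) (e (.inr i)) (e (.inr j)) (e (.inr k)) = 0)
    (hC : AlignedUpTo G C (-1)) (i j : Fin (n - 2)) :
    contract4 C (e (.inl 0)) (e (.inr i)) (e (.inl 1)) (e (.inr j)) = 0 := by
  obtain ⟨f, hf, hw⟩ := hC
  have hw' : ∀ p q r s, -1 < boostWeight p q r s → contract4 C (f p) (f q) (f r) (f s) = 0 := hw
  have hr : ∀ u v w z, contract4 C u v z w = -contract4 C u v w z := fun u v w z => by
    rw [hs, hl, hs]
  have hGs : ∀ v w, contract2 G v w = contract2 G w v := fun v w => by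
    unfold contract2
    rw [Finset.sum_comm]
    exact Finset.sum_congr rfl fun a _ => Finset.sum_congr rfl fun b _ => by rw [hG]; ring
  have hfp : ∀ p q, contract2 G (f p) (f q) = frameProduct p q := hf
  have hep : ∀ p q, contract2 G (e p) (e q) = frameProduct p q := he
  have w0 : idxWeight (.inl 0 : FrameIdx n) = 1 := rfl
  have w1 : idxWeight (.inl 1 : FrameIdx n) = -1 := rfl
  have w2 : ∀ i, idxWeight (.inr i : FrameIdx n) = 0 := fun _ => rfl
  -- Orthogonality to the aligned vector removes the part of `x` and `y` along `f (.inl 1)`. Every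
  -- surviving term has boost weight at least `0`, even where `z` contributes `-1`.
  have key : ∀ x y z, contract2 G (f (.inl 0)) x = 0 → contract2 G (f (.inl 0)) y = 0 →
      contract4 C (f (.inl 0)) x z y = 0 := by
    intro x y z hx hy
    rw [hf.linear_apply hn (contract4_linear₂ C _ z y) x, hx]
    have a1 : contract4 C (f (.inl 0)) (f (.inl 0)) z y = 0 := by
      linarith [hl (f (.inl 0)) (f (.inl 0)) z y]
    have a2 : ∀ i, contract4 C (f (.inl 0)) (f (.inr i)) z y = 0 := fun i => by
      rw [hf.linear_apply hn (contract4_linear₄ C _ _ z) y, hy]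
      have b1 : ∀ s, 0 ≤ idxWeight s → contract4 C (f (.inl 0)) (f (.inr i)) z (f s) = 0 :=
        fun s hs' => by
          rw [hf.linear_apply hn (contract4_linear₃ C _ _ _) z]
          rw [hw', hw']
          · simp only [mul_zero, zero_add]
            refine Finset.sum_eq_zero fun k _ => ?_
            rw [hw', mul_zero]
            simp only [boostWeight, w0, w2]; omega
          · simp only [boostWeight, w0, w1, w2]; omega
          · simp only [boostWeight, w0, w2]; omega
      rw [b1 _ (by simp [idxWeight])]
      simp only [mul_zero, zero_mul, zero_add]
      exact Finset.sum_eq_zero fun k _ => by rw [b1 _ (by simp [idxWeight]), mul_zero]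
    simp [a1, a2]
  set ℓ := f (.inl 0) with hℓ
  have hexp := fun {g : Coord n → ℝ} (hg : IsLinearMap ℝ g) => he.linear_apply hn hg ℓ
  have hℓℓ : contract2 G ℓ ℓ = 0 := (hfp _ _).trans (by simp [frameProduct])
  have hℓn : contract2 G ℓ (f (.inl 1)) = 1 := (hfp _ _).trans (by simp [frameProduct])
  -- If `ℓ` is orthogonal to `e (.inl 0)`, being null it is a nonzero multiple of it and `key`
  -- applies directly. Otherwise each `e (.inr i)` is corrected by a multiple of `e (.inl 0)` to
  -- become orthogonal to `ℓ`.
  by_cases hα : contract2 G (e (.inl 0)) ℓ = 0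
  · have hc : ∀ i, contract2 G (e (.inr i)) ℓ = 0 := by
      have c1 := hexp (contract2_linear_right G ℓ)
      rw [hα, hGs ℓ (e (.inl 0)), hα, hℓℓ] at c1
      simp only [hGs ℓ, mul_zero, zero_mul, zero_add] at c1
      intro i
      have := (Finset.sum_eq_zero_iff_of_nonneg fun _ _ => mul_self_nonneg _).1 c1.symm i
        (Finset.mem_univ i)
      exact mul_self_eq_zero.1 this
    have hne : contract2 G (e (.inl 1)) ℓ ≠ 0 := fun h0 => by
      have c1 := hexp (contract2_linear_left G (f (.inl 1)))
      rw [hα, h0, hℓn] at c1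
      simp [hc] at c1
    have c2 := hexp (contract4_linear₁ C (e (.inr i)) (e (.inl 1)) (e (.inr j)))
    rw [key _ _ _ (by rw [hGs, hc]) (by rw [hGs, hc]), hα] at c2
    simp only [hc, zero_mul, Finset.sum_const_zero, add_zero] at c2
    exact (mul_eq_zero.1 c2.symm).resolve_left hne
  · set α := contract2 G (e (.inl 0)) ℓ with hα_def
    have hx : ∀ i, contract2 G ℓ (e (.inr i) + (-(contract2 G (e (.inr i)) ℓ) / α) • e (.inl 0)) = 0 :=
      fun i => by
        rw [(contract2_linear_right G ℓ).map_add, (contract2_linear_right G ℓ).map_smul, hGs ℓ,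
          hGs ℓ (e (.inl 0)), ← hα_def, smul_eq_mul]
        field_simp
        ring
    -- After exchange of the pairs, `ℓ` stands in the third slot. Expanded in the frame `e`, only
    -- its part along `e (.inl 1)`, with coefficient `α ≠ 0`, escapes the vanishing components.
    have c0 := key _ _ (e (.inl 0)) (hx j) (hx i)
    rw [hs] at c0
    have hd : ∀ w z, contract4 C (e (.inl 0)) (e (.inl 0)) w z = 0 := fun w z => by
      linarith [hl (e (.inl 0)) (e (.inl 0)) w z]
    have hd' : ∀ w z, contract4 C w z (e (.inl 0)) (e (.inl 0)) = 0 := fun w z => by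
      rw [hs, hd]
    rw [(contract4_linear₂ C _ _ _).map_add, (contract4_linear₂ C _ _ _).map_smul, hd, smul_zero,
      add_zero, hexp (contract4_linear₃ C _ _ _), (contract4_linear₄ C _ _ _).map_add,
      (contract4_linear₄ C _ _ _).map_smul, hd', h1, (contract4_linear₄ C _ _ _).map_add,
      (contract4_linear₄ C _ _ _).map_smul, hr _ _ (e (.inl 0)) (e (.inl 1)), h2,
      Finset.sum_eq_zero fun k _ => ?_] at c0
    · simp only [smul_zero, add_zero, mul_zero, neg_zero, zero_add] at c0
      exact (mul_eq_zero.1 c0).resolve_left hα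
    · rw [(contract4_linear₄ C _ _ _).map_add, (contract4_linear₄ C _ _ _).map_smul, h3,
        hr _ _ (e (.inl 0)), h1]
      simp

end TypeThree

/-! ### Rank one at a point -/

section RankOne

open Matrix

variable {ι : Type*} [Fintype ι] [DecidableEq ι]

theorem eq_zero_of_trace_mul_transpose {M : Matrix ι ι ℝ} (h : (M * Mᵀ).trace = 0) : M = 0 := by
  ext i j
  simp only [trace, diag_apply, mul_apply, transpose_apply] at h
  have h1 := (Finset.sum_eq_zero_iff_of_nonneg fun i _ =>
    Finset.sum_nonneg fun j _ => mul_self_nonneg (M i j)).1 h i (Finset.mem_univ i)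
  exact mul_self_eq_zero.1 ((Finset.sum_eq_zero_iff_of_nonneg fun j _ => mul_self_nonneg _).1 h1 j
    (Finset.mem_univ j))

/-- `L / F` is an orthogonal projection of trace one. A normalized nonzero column serves as `e`; the
rest `Q` is symmetric with `Q Q = F Q` and trace zero, so its Frobenius norm vanishes. -/
theorem exists_rank_one {L : Matrix ι ι ℝ} {F : ℝ} (hF : F ≠ 0) (hs : Lᵀ = L)
    (h1 : L * L = F • L) (h2 : L.trace = F) :
    ∃ e : ι → ℝ, e ⬝ᵥ e = 1 ∧ L = F • vecMulVec e e := by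
  have hL : L ≠ 0 := fun h0 => hF (by rw [← h2, h0, trace_zero])
  obtain ⟨j, hj⟩ : ∃ j, L.col j ≠ 0 := by
    by_contra! hc
    exact hL (by ext i j; exact congrFun (hc j) i)
  set v := L.col j with hv
  have hLv : L *ᵥ v = F • v := by
    ext i
    exact congrFun (congrFun h1 i) j
  have hw : 0 < v ⬝ᵥ v := lt_of_le_of_ne (Finset.sum_nonneg fun _ _ => mul_self_nonneg _)
    (fun h0 => hj (dotProduct_self_eq_zero.1 h0.symm))
  set s := Real.sqrt (v ⬝ᵥ v) with hs_def
  have hs0 : s ≠ 0 := (Real.sqrt_pos.2 hw).ne'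
  have hss : s * s = v ⬝ᵥ v := Real.mul_self_sqrt hw.le
  set e := s⁻¹ • v with he
  have hee : e ⬝ᵥ e = 1 := by
    rw [he, smul_dotProduct, dotProduct_smul, ← hss, smul_eq_mul, smul_eq_mul]
    field_simp
  have hLe : L *ᵥ e = F • e := by
    rw [he, mulVec_smul, hLv, smul_comm]
  have heL : e ᵥ* L = F • e := by
    rw [← hLe, ← vecMul_transpose, hs]
  refine ⟨e, hee, ?_⟩
  set Q := L - F • vecMulVec e e with hQ
  have hQT : Qᵀ = Q := by
    rw [hQ, transpose_sub, transpose_smul, transpose_vecMulVec, hs]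
  have hLW : L * vecMulVec e e = F • vecMulVec e e := by
    rw [mul_vecMulVec, hLe, smul_vecMulVec]
  have hWL : vecMulVec e e * L = F • vecMulVec e e := by
    rw [vecMulVec_mul, heL, vecMulVec_smul]
  have hWW : vecMulVec e e * vecMulVec e e = vecMulVec e e := by
    rw [vecMulVec_mul_vecMulVec, hee, one_smul]
  have hQQ : Q * Q = F • Q := by
    simp only [hQ, mul_sub, sub_mul, h1, Matrix.smul_mul, Matrix.mul_smul, hLW, hWL, hWW]
    module
  have hQ0 : Q = 0 := by
    refine eq_zero_of_trace_mul_transpose ?_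
    rw [hQT, hQQ, trace_smul, hQ, trace_sub, trace_smul, trace_vecMulVec, h2, hee]
    simp
  exact sub_eq_zero.1 hQ0

/-- The optical constraint together with the vanishing of the curvature components of boost weight
zero forces the optical matrix to have rank one. -/
theorem rank_one_of_optical {L : Matrix ι ι ℝ} {F φ : ℝ} (h1 : (2 : ℝ) • (L * Lᵀ) = F • (L + Lᵀ))
    (h2 : φ • L + (Lᵀ - L) * L = 0) (h3 : F = φ + L.trace) (h4 : L.trace ≠ 0) :
    F ≠ 0 ∧ ∃ e : ι → ℝ, e ⬝ᵥ e = 1 ∧ L = F • vecMulVec e e := by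
  have t1 : (L * Lᵀ).trace = F * L.trace := by
    have := congrArg trace h1
    simp only [trace_smul, trace_add, trace_transpose, smul_eq_mul] at this
    linarith
  have hF : F ≠ 0 := fun h0 => by
    rw [h0, zero_mul] at t1
    exact h4 (by rw [eq_zero_of_trace_mul_transpose t1, trace_zero])
  -- Multiply `h2` by `Lᵀ` and take the trace: the cubic terms agree under transposition, leaving `φ
  -- |L|² = 0`.
  have hφ : φ = 0 := by
    have t2 := congrArg (fun M => (M * Lᵀ).trace) h2
    simp only [add_mul, sub_mul, trace_add, trace_sub, smul_mul, trace_smul, zero_mul,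
      trace_zero, smul_eq_mul] at t2
    have t3 : (Lᵀ * L * Lᵀ).trace = (L * L * Lᵀ).trace := by
      rw [← trace_transpose, transpose_mul, transpose_mul, transpose_transpose,
        trace_mul_comm, mul_assoc, trace_mul_comm, mul_assoc]
    rw [t3, t1, sub_self, add_zero] at t2
    exact (mul_eq_zero.1 t2).resolve_right (mul_ne_zero hF h4)
  rw [hφ, zero_add] at h3
  rw [hφ, zero_smul, zero_add, sub_mul, sub_eq_zero] at h2
  -- `Lᵀ L = L L` gives `tr (L L) = |L|²`, so `|L - Lᵀ|² = 2 |L|² - 2 tr (L L)` vanishes.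
  have hsym : L - Lᵀ = 0 := by
    refine eq_zero_of_trace_mul_transpose ?_
    have t4 : (Lᵀ * L).trace = (L * Lᵀ).trace := trace_mul_comm _ _
    have t5 : (Lᵀ * Lᵀ).trace = (L * L).trace := by rw [← transpose_mul, trace_transpose]
    rw [transpose_sub, transpose_transpose, sub_mul, mul_sub, mul_sub, trace_sub, trace_sub,
      trace_sub, t5, ← h2, t4]
    ring
  have hsym' : Lᵀ = L := (sub_eq_zero.1 hsym).symm
  refine ⟨hF, exists_rank_one hF hsym' ?_ h3.symm⟩
  rw [hsym', ← two_smul ℝ L, smul_comm F] at h1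
  exact smul_right_injective _ two_ne_zero h1

end RankOne

/-! ### Extending the eigenvector to a neighbourhood -/

section Eigenvector

open Matrix

variable {ι R : Type*} [Fintype ι] [DecidableEq ι] [CommRing R]

theorem det_one_sub_vecMulVec (u v : ι → R) : (1 - vecMulVec u v).det = 1 - v ⬝ᵥ u := by
  have h1 : 1 - vecMulVec u v
      = 1 + replicateCol Unit (-u) * replicateRow Unit v := by
    rw [← vecMulVec_eq, neg_vecMulVec, sub_eq_add_neg]
  rw [h1, det_one_add_replicateCol_mul_replicateRow, dotProduct_neg, sub_eq_add_neg]

/-- An orthogonal matrix which specializes to a reflection has an eigenvector for the eigenvalue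
`-1`. -/
theorem exists_reflected_vector {φ : R →+* ℝ} (hφ : ∀ r, φ r ≠ 0 → IsUnit r) {O : Matrix ι ι R}
    (hO : O * Oᵀ = 1) {e₀ : ι → R} (he₀ : (φ ∘ e₀) ⬝ᵥ (φ ∘ e₀) = 1)
    (hmap : O.map φ = 1 - (2 : ℝ) • vecMulVec (φ ∘ e₀) (φ ∘ e₀)) :
    ∃ e : ι → R, e₀ ⬝ᵥ e = 1 ∧ O *ᵥ e = -e ∧ Oᵀ *ᵥ e = -e := by
  have h2 : IsUnit (2 : R) := hφ 2 (by rw [map_ofNat]; norm_num)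
  -- The square of the determinant is one, and its value at the base point is that of a reflection,
  -- so `det O - 1` is a unit.
  have hdet : O.det = -1 := by
    have h3 : (O.det - 1) * (O.det + 1) = 0 := by
      have := congrArg det hO
      rw [det_mul, det_transpose, det_one] at this
      linear_combination this
    have h4 : φ (O.det - 1) ≠ 0 := by
      rw [map_sub, map_one, RingHom.map_det, RingHom.mapMatrix_apply, hmap, ← smul_vecMulVec,
        det_one_sub_vecMulVec, dotProduct_smul, he₀]
      norm_num
    have h5 := (hφ _ h4).mul_right_eq_zero.1 h3
    linear_combination h5
  have hA : (1 + O).det = 0 := by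
    have h3 : O * (1 + O)ᵀ = 1 + O := by
      rw [transpose_add, transpose_one, mul_add, mul_one, hO, add_comm]
    have h4 := congrArg det h3
    rw [det_mul, det_transpose, hdet] at h4
    exact h2.mul_right_eq_zero.1 (by linear_combination -h4)
  -- The rank-one term compensates the kernel of `1 + O` at the base point: there `N` is twice the
  -- identity, hence `N` is invertible.
  set N := 1 + O + (2 : R) • vecMulVec e₀ e₀ with hN
  have hNu : IsUnit N.det := by
    refine hφ _ ?_
    have h3 : N.map φ = (2 : ℝ) • (1 : Matrix ι ι ℝ) := by
      have h4 : N.map φ = 1 + O.map φ + (2 : ℝ) • vecMulVec (φ ∘ e₀) (φ ∘ e₀) := by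
        ext i j
        simp [hN, vecMulVec_apply, Matrix.one_apply, apply_ite φ, map_ofNat φ 2]
      rw [h4, hmap]
      module
    rw [RingHom.map_det, RingHom.mapMatrix_apply, h3, det_smul, det_one, mul_one]
    positivity
  set e := N⁻¹ *ᵥ ((2 : R) • e₀) with he
  have hNe : N *ᵥ e = (2 : R) • e₀ := by
    rw [he, mulVec_mulVec, mul_nonsing_inv _ hNu, one_mulVec]
  have hfac : 1 + O = N * (1 - vecMulVec e e₀) := by
    rw [mul_sub, mul_one, mul_vecMulVec, hNe, smul_vecMulVec, hN]
    abel
  -- Since `1 + O` is singular and `N` is not, the factor `1 - e e₀ᵀ` has determinant zero.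
  have h1 : e₀ ⬝ᵥ e = 1 := by
    rw [hfac, det_mul, det_one_sub_vecMulVec] at hA
    have := hNu.mul_right_eq_zero.1 hA
    linear_combination -this
  have h3 : O *ᵥ e = -e := by
    have h4 : (1 + O) *ᵥ e = 0 := by
      have : 1 + O = N - (2 : R) • vecMulVec e₀ e₀ := by rw [hN]; abel
      rw [this, sub_mulVec, hNe, smul_mulVec, vecMulVec_mulVec, h1]
      simp
    rw [add_mulVec, one_mulVec] at h4
    exact eq_neg_of_add_eq_zero_right h4
  refine ⟨e, h1, h3, ?_⟩
  have h4 : Oᵀ *ᵥ (O *ᵥ e) = e := by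
    rw [mulVec_mulVec, mul_eq_one_comm.1 hO, one_mulVec]
  rw [h3, mulVec_neg] at h4
  exact neg_eq_iff_eq_neg.1 h4

/-- An optical matrix of germs which has rank one at the base point has an eigenvector. -/
theorem exists_eigenvector {n : ℕ} {x₀ : Coord n} {L : Matrix ι ι (SmoothGerm x₀)}
    {F G : SmoothGerm x₀} (hF : G * F = 1)
    (h1 : (2 : SmoothGerm x₀) • (L * Lᵀ) = F • (L + Lᵀ)) {e₀ : ι → ℝ} (he₀ : e₀ ⬝ᵥ e₀ = 1)
    (hL : L.map (germValue x₀) = germValue x₀ F • vecMulVec e₀ e₀) :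
    ∃ e : ι → SmoothGerm x₀, e ⬝ᵥ e = 1 ∧ L *ᵥ e = F • e ∧ Lᵀ *ᵥ e = F • e ∧
      ∀ i j, germValue x₀ (L i j - F * e i * e j) = 0 := by
  have hunit : ∀ r : SmoothGerm x₀, germValue x₀ r ≠ 0 → IsUnit r := fun r hr => by
    obtain ⟨s, hs⟩ := exists_inv hr
    exact IsUnit.of_mul_eq_one_right s hs
  have hGF : germValue x₀ G * germValue x₀ F = 1 := by rw [← map_mul, hF, map_one]
  -- The optical constraint is exactly the orthogonality of this matrix; its eigenvalue `-1`
  -- corresponds to the eigenvalue `F` of `L`.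
  set O : Matrix ι ι (SmoothGerm x₀) := 1 - (2 * G) • L with hOdef
  have hO : O * Oᵀ = 1 := by
    have h2 : (2 * G) • (2 * G) • (L * Lᵀ) = (2 * G) • (L + Lᵀ) := by
      have h3 : (2 * G) • (2 * G) • (L * Lᵀ) = (2 * G * G) • (2 : SmoothGerm x₀) • (L * Lᵀ) := by
        simp only [smul_smul]; congr 1; ring
      rw [h3, h1, smul_smul]
      congr 1
      linear_combination 2 * G * hF
    rw [hOdef, transpose_sub, transpose_one, transpose_smul, sub_mul, mul_sub, mul_sub]
    simp only [Matrix.smul_mul, Matrix.mul_smul, one_mul, mul_one, h2, smul_add]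
    abel
  set c : ι → SmoothGerm x₀ := fun i => algebraMap ℝ _ (e₀ i) with hc
  have hcv : germValue x₀ ∘ c = e₀ := funext fun i => (IsGerm.const (e₀ i)).value
  have hmap : O.map (germValue x₀)
      = 1 - (2 : ℝ) • vecMulVec (germValue x₀ ∘ c) (germValue x₀ ∘ c) := by
    have h2 : O.map (germValue x₀) = 1 - (2 * germValue x₀ G) • L.map (germValue x₀) := by
      ext i j
      simp [hOdef, Matrix.one_apply, apply_ite (germValue x₀), map_ofNat (germValue x₀) 2]
    rw [h2, hL, hcv, smul_smul, mul_assoc, hGF, mul_one]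
  obtain ⟨v, hv1, hv2, hv3⟩ := exists_reflected_vector hunit hO (by rw [hcv, he₀]) hmap
  have hpos : 0 < germValue x₀ (v ⬝ᵥ v) := by
    have h2 : germValue x₀ (v ⬝ᵥ v) = ∑ i, germValue x₀ (v i) * germValue x₀ (v i) := by
      simp [dotProduct]
    have h3 : 0 ≤ ∑ i, germValue x₀ (v i) * germValue x₀ (v i) :=
      Finset.sum_nonneg fun _ _ => mul_self_nonneg _
    rw [h2]
    refine lt_of_le_of_ne h3 fun h4 => ?_
    have h5 : ∀ i, germValue x₀ (v i) = 0 := fun i => mul_self_eq_zero.1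
      ((Finset.sum_eq_zero_iff_of_nonneg fun _ _ => mul_self_nonneg _).1 h4.symm i
        (Finset.mem_univ i))
    have h6 := congrArg (germValue x₀) hv1
    simp [dotProduct, h5] at h6
  obtain ⟨s, hs⟩ := exists_sqrt hpos
  have hs0 : germValue x₀ s ≠ 0 := fun h2 => by
    rw [← hs, map_mul, h2, mul_zero] at hpos
    exact lt_irrefl _ hpos
  obtain ⟨r, hr⟩ := exists_inv hs0
  have heig : ∀ M : Matrix ι ι (SmoothGerm x₀), (1 - (2 * G) • M) *ᵥ v = -v →
      M *ᵥ (r • v) = F • r • v := by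
    intro M hM
    obtain ⟨t, ht⟩ := exists_half (SmoothGerm x₀)
    rw [sub_mulVec, one_mulVec, smul_mulVec] at hM
    rw [mulVec_smul, smul_comm F]
    congr 1
    ext i
    have h2 := congrFun hM i
    simp only [Pi.sub_apply, Pi.smul_apply, Pi.neg_apply, smul_eq_mul] at h2 ⊢
    linear_combination (-t * F) * h2 + (F * v i - F * G * (M *ᵥ v) i) * ht - (M *ᵥ v) i * hF
  have hLe : L *ᵥ (r • v) = F • r • v := heig L hv2
  have hee : (r • v) ⬝ᵥ (r • v) = 1 := by
    rw [smul_dotProduct, dotProduct_smul, ← hs, smul_eq_mul, smul_eq_mul]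
    linear_combination (r * s + 1) * hr
  refine ⟨r • v, hee, hLe, heig Lᵀ ?_, ?_⟩
  · rw [← hv3, hOdef, transpose_sub, transpose_one, transpose_smul]
  · set e := r • v
    set E : ι → ℝ := fun i => germValue x₀ (e i) with hE
    have hEE : ∑ i, E i * E i = 1 := by
      have := congrArg (germValue x₀) hee
      simpa [dotProduct] using this
    have hLv : ∀ i j, germValue x₀ (L i j) = germValue x₀ F * (e₀ i * e₀ j) := fun i j =>
      congrFun (congrFun hL i) j
    have hF0 : germValue x₀ F ≠ 0 := right_ne_zero_of_mul_eq_one hGF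
    have h2 : ∀ i, e₀ i * ∑ j, e₀ j * E j = E i := fun i => by
      have h3 := congrArg (germValue x₀) (congrFun hLe i)
      simp only [mulVec, dotProduct, map_sum, map_mul, hLv, Pi.smul_apply, smul_eq_mul] at h3
      refine mul_left_cancel₀ hF0 (Eq.trans ?_ h3)
      rw [Finset.mul_sum, Finset.mul_sum]
      exact Finset.sum_congr rfl fun j _ => by ring
    -- The value of `e` at the base point is `e₀` up to sign, and the sign drops out of `e eᵀ`.
    have h3 : (∑ j, e₀ j * E j) * (∑ j, e₀ j * E j) = 1 := by
      rw [← hEE, Finset.sum_mul]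
      exact Finset.sum_congr rfl fun j _ => by rw [← h2 j]; ring
    intro i j
    rw [map_sub, map_mul, map_mul, hLv]
    change _ - germValue x₀ F * E i * E j = 0
    rw [← h2 i, ← h2 j]
    linear_combination (-germValue x₀ F * e₀ i * e₀ j) * h3

end Eigenvector

/-! ### Alignment of the Kerr–Schild direction -/

section Local

open Filter Topology Matrix

theorem contract4_single {n : ℕ} {R : Type*} [CommRing R]
    (T : Fin n → Fin n → Fin n → Fin n → R) (a b c d : Fin n) :
    contract4 T (Pi.single a 1) (Pi.single b 1) (Pi.single c 1) (Pi.single d 1) = T a b c d := by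
  simp [contract4, Pi.single_apply]

namespace LocalModel

variable {n : ℕ} {H : Coord n → ℝ} {k : Coord n → Coord n} {x₀ : Coord n}
  {η D U : Fin n → SmoothGerm x₀} {X : Fin (n - 2) → Fin n → SmoothGerm x₀}
  {Y : Fin (n - 2) → SmoothGerm x₀} {h l : SmoothGerm x₀}
  (K : LocalModel H k x₀ η D U X Y h l)
include K

theorem contract4_riemann (u v w z : Coord n) :
    contract4 (riemann (ksMetric H k) x₀) u v w z = germValue x₀ (ksRiemann (germD x₀) η D U X Y h
      (fun a => algebraMap ℝ _ (u a)) (fun a => algebraMap ℝ _ (v a))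
      (fun a => algebraMap ℝ _ (w a)) fun a => algebraMap ℝ _ (z a)) := by
  rw [K.value_ksRiemann]
  simp only [(IsGerm.const _).value]

theorem riemann_swap (u v w z : Coord n) :
    contract4 (riemann (ksMetric H k) x₀) v u w z
      = -contract4 (riemann (ksMetric H k) x₀) u v w z := by
  rw [K.contract4_riemann, K.contract4_riemann, ksRiemann_swap_left, map_neg]

theorem riemann_pair (u v w z : Coord n) :
    contract4 (riemann (ksMetric H k) x₀) u v w z
      = contract4 (riemann (ksMetric H k) x₀) w z u v := by
  rw [K.contract4_riemann, K.contract4_riemann, K.frame.pair_symm]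

theorem riemann_frame (p q r s : FrameIdx n) :
    contract4 (riemann (ksMetric H k) x₀) (fun a => germValue x₀ (ksFrame D U X h p a))
      (fun a => germValue x₀ (ksFrame D U X h q a)) (fun a => germValue x₀ (ksFrame D U X h r a))
      (fun a => germValue x₀ (ksFrame D U X h s a))
      = germValue x₀ (ksRiemann (germD x₀) η D U X Y h (ksFrame D U X h p) (ksFrame D U X h q)
        (ksFrame D U X h r) (ksFrame D U X h s)) := (K.value_ksRiemann _ _ _ _).symm

variable (geo : ∀ i, along (germD x₀) D (Y i) = 0)
include geo

theorem riemann_DXDX (i j : Fin (n - 2)) : ksRiemann (germD x₀) η D U X Y h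
    (ksFrame D U X h (.inl 0)) (ksFrame D U X h (.inr i)) (ksFrame D U X h (.inl 0))
    (ksFrame D U X h (.inr j)) = 0 := K.frame.riemann_DXDX geo i j

theorem riemann_DXDU (i : Fin (n - 2)) : ksRiemann (germD x₀) η D U X Y h
    (ksFrame D U X h (.inl 0)) (ksFrame D U X h (.inr i)) (ksFrame D U X h (.inl 0))
    (ksFrame D U X h (.inl 1)) = 0 := by
  change ksRiemann (germD x₀) η D U X Y h D (X i) D (U + h • D) = 0
  rw [(ksRiemann_linear₄ ..).map_add, (ksRiemann_linear₄ ..).map_smul, K.frame.riemann_DXDU geo,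
    ksRiemann_self_right]
  simp

theorem riemann_DXXX (i j k : Fin (n - 2)) : ksRiemann (germD x₀) η D U X Y h
    (ksFrame D U X h (.inl 0)) (ksFrame D U X h (.inr i)) (ksFrame D U X h (.inr j))
    (ksFrame D U X h (.inr k)) = 0 := K.frame.riemann_DXXX geo i j k

theorem riemann_DXUX (i j : Fin (n - 2)) : ksRiemann (germD x₀) η D U X Y h
    (ksFrame D U X h (.inl 0)) (ksFrame D U X h (.inr i)) (ksFrame D U X h (.inl 1))
    (ksFrame D U X h (.inr j)) = ksRiemann (germD x₀) η D U X Y h D (X i) U (X j) := by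
  change ksRiemann (germD x₀) η D U X Y h D (X i) (U + h • D) (X j) = _
  rw [(ksRiemann_linear₃ ..).map_add, (ksRiemann_linear₃ ..).map_smul, K.frame.riemann_DXDX geo]
  simp

/-- The Kerr-Schild direction of a vacuum metric is a multiple aligned null direction. -/
theorem aligned : AlignedUpTo (ksMetric H k x₀) (riemann (ksMetric H k) x₀) 0 := by
  refine ⟨_, K.isNullFrame, fun p q r s hw => ?_⟩
  refine positive_weight_eq_zero (C := fun p q r s => frameComp (riemann (ksMetric H k) x₀)
    (fun p a => germValue x₀ (ksFrame D U X h p a)) p q r s) (fun p q r s => K.riemann_swap _ _ _ _)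
    (fun p q r s => K.riemann_pair _ _ _ _) (fun i j => ?_) (fun i => ?_) (fun i j k => ?_)
    p q r s hw
  · refine (K.riemann_frame _ _ _ _).trans ?_
    rw [K.riemann_DXDX geo, map_zero]
  · refine (K.riemann_frame _ _ _ _).trans ?_
    rw [K.riemann_DXDU geo, map_zero]
  · refine (K.riemann_frame _ _ _ _).trans ?_
    rw [K.riemann_DXXX geo, map_zero]

theorem value_DXUX_eq_zero (hn : 2 ≤ n)
    (h3 : AlignedUpTo (ksMetric H k x₀) (riemann (ksMetric H k) x₀) (-1)) (i j : Fin (n - 2)) :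
    germValue x₀ (ksRiemann (germD x₀) η D U X Y h D (X i) U (X j)) = 0 := by
  rw [← K.riemann_DXUX geo, ← K.riemann_frame]
  refine component_eq_zero_of_aligned hn (fun a b => ?_) K.riemann_swap K.riemann_pair
    K.isNullFrame (fun i j => ?_) (fun i => ?_) (fun i j k => ?_) h3 i j
  · rw [← (K.metric a b).value, ← (K.metric b a).value, ksLow_symm]
  · rw [K.riemann_frame, K.riemann_DXDX geo, map_zero]
  · rw [K.riemann_frame, K.riemann_DXDU geo, map_zero]
  · rw [K.riemann_frame, K.riemann_DXXX geo, map_zero]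

omit geo in
theorem rankOneOptics {F G : SmoothGerm x₀} {e : Fin (n - 2) → SmoothGerm x₀} (inv : G * F = 1)
    (optical : ∀ i j, 2 * ∑ p, along (germD x₀) (X p) (Y i) * along (germD x₀) (X p) (Y j)
      = F * (along (germD x₀) (X j) (Y i) + along (germD x₀) (X i) (Y j)))
    (unit : ∑ i, e i * e i = 1) (right : ∀ i, ∑ j, along (germD x₀) (X j) (Y i) * e j = F * e i)
    (left : ∀ j, ∑ i, along (germD x₀) (X j) (Y i) * e i = F * e j) :
    RankOneOptics (fun i => along (germD x₀) (X i)) (along (germD x₀) U) Y F G e where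
  comm_XX i j f := by
    rw [K.frame.along_X, K.frame.along_X, K.frame.hess_comm]; ring
  comm_VX j f := by
    rw [K.frame.along_X, K.frame.along_U, K.frame.hess_comm]; ring
  inv := inv
  optical := optical
  unit := unit
  right := right
  left := left

end LocalModel

end Local

/-! ### Type III implies flatness nearby -/

section Local

open Filter Topology Matrix

namespace LocalModel

variable {n : ℕ} {H : Coord n → ℝ} {k : Coord n → Coord n} {x₀ : Coord n}
  {η D U : Fin n → SmoothGerm x₀} {X : Fin (n - 2) → Fin n → SmoothGerm x₀}
  {Y : Fin (n - 2) → SmoothGerm x₀} {h l : SmoothGerm x₀}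
  (K : LocalModel H k x₀ η D U X Y h l)
include K

/-- If the optical matrix has rank one at the base point, then it has rank one nearby, and the
metric is flat there. -/
theorem riemann_eventually_zero
    (hR : ∀ b d, formalRicci (germD x₀) (ksLow η D h) (ksUp η D h) b d = 0)
    {F G : SmoothGerm x₀} {e : Fin (n - 2) → SmoothGerm x₀}
    (O : RankOneOptics (fun i => along (germD x₀) (X i)) (along (germD x₀) U) Y F G e)
    (h0 : ∀ i j, germValue x₀ (along (germD x₀) (X j) (Y i) - F * e i * e j) = 0) :
    ∀ᶠ x in 𝓝 x₀, riemann (ksMetric H k) x = 0 := by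
  have geo := K.geodetic hR
  set J := restIdeal (fun i => along (germD x₀) (X i)) Y F e with hJ
  set M := opticalRest (fun i => along (germD x₀) (X i)) Y F e with hM
  have hsachs : ∀ i j, along (germD x₀) D (along (germD x₀) (X j) (Y i))
      = -∑ p, along (germD x₀) (X p) (Y i) * along (germD x₀) (X j) (Y p) := fun i j => by
    rw [K.frame.along_X, geo, zero_mul, sub_zero, K.frame.hess_comm, K.frame.hess_X_D geo]
  -- A coordinate derivative is a combination of derivatives along `U`, `D` and the `X i`, and each
  -- of these sends the sum of squares into `J ^ 2`.
  have hM0 : ∀ i j, M i j = 0 := fun i j => by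
    refine eq_zero_of_derivative_mem_sq (M := fun p : Fin (n - 2) × Fin (n - 2) => M p.1 p.2)
      (fun p => h0 p.1 p.2) (fun a => ?_) (i, j)
    rw [Fintype.sum_prod_type, K.frame.coord_eq a]
    refine Ideal.mul_mem_left _ _ (add_mem (add_mem ?_ ?_) (Ideal.sum_mem _ fun i _ => ?_)) <;>
      refine Ideal.mul_mem_left _ _ ?_
    · exact O.V_rest_sq_mem
    · exact O.sachs_rest_sq_mem _ hsachs
    · exact O.X_rest_sq_mem i
  have hJ0 : ∀ {r}, r ∈ J → r = 0 := fun {r} hr => by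
    have : J = ⊥ := by
      rw [hJ, restIdeal, Ideal.span_eq_bot]
      rintro _ ⟨p, rfl⟩
      exact hM0 p.1 p.2
    rwa [this, Ideal.mem_bot] at hr
  have V : RankOneVacuum (germD x₀) η D U X Y h F G e
      fun i => ∑ k, e k * along (germD x₀) (X k) (e i) :=
    { frame := K.frame
      geo := geo
      inv := O.inv
      unit := O.unit
      rank_one := fun i j => sub_eq_zero.1 (hM0 i j)
      along_e := fun i j => sub_eq_zero.1 (hJ0 (O.rigid.2.1 j i))
      ricci := hR }
  have hzero : ∀ a b c d, ∀ᶠ x in 𝓝 x₀, riemann (ksMetric H k) x a b c d = 0 := fun a b c d => by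
    refine ((K.isGerm_riemann a b c d).eq_iff .zero).1 ?_
    rw [← contract4_single (formalRiemann (germD x₀) (ksLow η D h) (ksUp η D h)),
      K.frame.contract4_formalRiemann, V.riemann_eq_zero]
  filter_upwards [eventually_all.2 fun a => eventually_all.2 fun b => eventually_all.2 fun c =>
    eventually_all.2 fun d => hzero a b c d] with x hx
  ext a b c d
  exact hx a b c d

/-- An expanding Kerr-Schild vacuum metric of type III or more special at a point is flat nearby. -/
theorem flat_of_aligned (hn : 2 ≤ n)
    (hR : ∀ b d, formalRicci (germD x₀) (ksLow η D h) (ksUp η D h) b d = 0)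
    (hexp : IsExpandingAt H k x₀)
    (h3 : AlignedUpTo (ksMetric H k x₀) (riemann (ksMetric H k) x₀) (-1)) :
    ∀ᶠ x in 𝓝 x₀, riemann (ksMetric H k) x = 0 := by
  have geo := K.geodetic hR
  obtain ⟨g, hg⟩ := K.exists_h_inv
  set L : Matrix (Fin (n - 2)) (Fin (n - 2)) (SmoothGerm x₀) :=
    Matrix.of fun i j => along (germD x₀) (X j) (Y i) with hL
  -- `φ = D(h)/h`, so that `F` is the factor in the optical constraint obtained from `ricci_XX`.
  set φ := g * along (germD x₀) D h with hφ
  set F := φ + L.trace with hF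
  have hopt : ∀ i j, 2 * ∑ p, along (germD x₀) (X p) (Y i) * along (germD x₀) (X p) (Y j)
      = F * (along (germD x₀) (X j) (Y i) + along (germD x₀) (X i) (Y j)) := fun i j => by
    have h1 := K.frame.ricci_XX (h := h) geo i j
    simp only [hR, zero_mul, Finset.sum_const_zero] at h1
    have h2 : L.trace = ∑ p, along (germD x₀) (X p) (Y p) := rfl
    rw [hF, h2, hφ]
    set S := ∑ p, along (germD x₀) (X p) (Y i) * along (germD x₀) (X p) (Y j)
    linear_combination (-g) * h1 + (-2 * S + (∑ p, along (germD x₀) (X p) (Y p))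
      * (along (germD x₀) (X j) (Y i) + along (germD x₀) (X i) (Y j))) * hg
  have hoptL : (2 : SmoothGerm x₀) • (L * Lᵀ) = F • (L + Lᵀ) := by
    ext i j
    exact hopt i j
  -- The optical constraint holds near `x₀`, but the right side here is known to vanish only at
  -- `x₀`. This is why rank one must be propagated.
  have hval : φ • L + (Lᵀ - L) * L = Matrix.of fun i j =>
      -g * ksRiemann (germD x₀) η D U X Y h D (X i) U (X j) := by
    ext i j
    have h1 : ((Lᵀ - L) * L) i j = ∑ p, (along (germD x₀) (X i) (Y p)
        - along (germD x₀) (X p) (Y i)) * along (germD x₀) (X j) (Y p) := rfl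
    rw [Matrix.add_apply, h1, Matrix.smul_apply, Matrix.of_apply, K.frame.riemann_DXUX geo, hφ]
    change g * along (germD x₀) D h * along (germD x₀) (X j) (Y i) + _ = _
    linear_combination (-(∑ p, (along (germD x₀) (X i) (Y p)
        - along (germD x₀) (X p) (Y i)) * along (germD x₀) (X j) (Y p))) * hg
  set v := germValue x₀ with hv
  have h1 : (2 : ℝ) • (L.map v * (L.map v)ᵀ) = v F • (L.map v + (L.map v)ᵀ) := by
    have h5 := congrArg (fun M => M.map v) hoptL
    ext i j
    have h6 := congrFun (congrFun h5 i) j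
    have h7 : v 2 = 2 := map_ofNat v 2
    simpa only [Matrix.map_apply, Matrix.smul_apply, Matrix.add_apply, Matrix.mul_apply,
      Matrix.transpose_apply, smul_eq_mul, map_mul, map_add, map_sum, h7] using h6
  have h2 : v φ • L.map v + ((L.map v)ᵀ - L.map v) * L.map v = 0 := by
    have h5 := congrArg (fun M => M.map v) hval
    ext i j
    have h6 := congrFun (congrFun h5 i) j
    simpa [Matrix.mul_apply, hv, K.value_DXUX_eq_zero geo hn h3] using h6
  have htr : (L.map v).trace = v L.trace := by
    simp [Matrix.trace]
  obtain ⟨hF0, e₀, he₀, hLe⟩ := rank_one_of_optical h1 h2 (by rw [htr, ← map_add])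
    (by rw [htr]; exact K.trace_ne_zero hn geo hexp)
  obtain ⟨G, hG⟩ := exists_inv hF0
  obtain ⟨e, he, hr, hl, hz⟩ := exists_eigenvector hG hoptL he₀ hLe
  exact K.riemann_eventually_zero hR (K.rankOneOptics hG hopt he (fun i => congrFun hr i)
    fun j => congrFun hl j) hz

end LocalModel

theorem weyl_eq_riemann {n : ℕ} {g : MetricField n} {x : Coord n} (h : ∀ a b, ricci g x a b = 0) :
    weyl g x = riemann g x := by
  ext a b c d
  simp [weyl, scalarCurv, h]

end Local

end KerrSchild

/-! ### The open–closed argument -/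

open KerrSchild Filter Topology in
theorem proposition4 (n : ℕ) (hn : 4 ≤ n) (U : Set (KerrSchild.Coord n)) (hUo : IsOpen U)
    (hUc : IsConnected U) (H : KerrSchild.Coord n → ℝ)
    (k : KerrSchild.Coord n → KerrSchild.Coord n)
    (hH : ContDiffOn ℝ ∞ H U) (hk : ContDiffOn ℝ ∞ k U)
    (hH0 : ∀ x ∈ U, H x ≠ 0) (hnull : KerrSchild.IsNullOneForm k U)
    (hvac : KerrSchild.IsVacuumOn (KerrSchild.ksMetric H k) U)
    (hnonflat : ∃ x ∈ U, KerrSchild.riemann (KerrSchild.ksMetric H k) x ≠ 0)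
    (hexp : ∀ x ∈ U, KerrSchild.IsExpandingAt H k x) :
    ∀ x ∈ U,
      KerrSchild.IsTypeII (KerrSchild.ksMetric H k x)
          (KerrSchild.weyl (KerrSchild.ksMetric H k) x) ∨
        KerrSchild.IsTypeD (KerrSchild.ksMetric H k x)
          (KerrSchild.weyl (KerrSchild.ksMetric H k) x) := by
  have hmodel : ∀ x₀ ∈ U, ∃ (η D V : Fin n → SmoothGerm x₀)
      (X : Fin (n - 2) → Fin n → SmoothGerm x₀) (Y : Fin (n - 2) → SmoothGerm x₀)
      (h l : SmoothGerm x₀), LocalModel H k x₀ η D V X Y h l := by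
    obtain ⟨m, rfl⟩ : ∃ m, n = m + 2 := ⟨n - 2, by omega⟩
    exact fun x₀ hx => exists_localModel hUo hH hk hH0 hnull hx
  have hev : ∀ x₀ ∈ U, ∀ᶠ x in 𝓝 x₀, ∀ a b, ricci (ksMetric H k) x a b = 0 := fun x₀ hx => by
    filter_upwards [hUo.mem_nhds hx] with x hx
    exact hvac x hx
  have hflat : ∀ x₀ ∈ U, AlignedUpTo (ksMetric H k x₀) (riemann (ksMetric H k) x₀) (-1) →
      ∀ᶠ x in 𝓝 x₀, riemann (ksMetric H k) x = 0 := fun x₀ hx h3 => by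
    obtain ⟨η, D, V, X, Y, h, l, K⟩ := hmodel x₀ hx
    exact K.flat_of_aligned (by omega) (K.ricci_zero (hev x₀ hx)) (hexp x₀ hx) h3
  have hII : ∀ x₀ ∈ U, AlignedUpTo (ksMetric H k x₀) (riemann (ksMetric H k) x₀) 0 :=
    fun x₀ hx => by
      obtain ⟨η, D, V, X, Y, h, l, K⟩ := hmodel x₀ hx
      exact K.aligned (K.geodetic (K.ricci_zero (hev x₀ hx)))
  have hne : ∀ x₀ ∈ U, riemann (ksMetric H k) x₀ ≠ 0 := by
    have hcont : ContinuousOn (riemann (ksMetric H k)) U := fun x₀ hx => by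
      obtain ⟨η, D, V, X, Y, h, l, K⟩ := hmodel x₀ hx
      refine ContinuousAt.continuousWithinAt ?_
      refine continuousAt_pi.2 fun a => continuousAt_pi.2 fun b => continuousAt_pi.2 fun c =>
        continuousAt_pi.2 fun d => (K.isGerm_riemann a b c d).1.continuousAt
    have hopen1 : IsOpen (U ∩ {x | riemann (ksMetric H k) x ≠ 0}) :=
      hcont.isOpen_inter_preimage hUo isOpen_compl_singleton
    -- Zero curvature at a point is type O, which is aligned at every level, so `hflat` spreads
    -- flatness to a neighbourhood. The frame needed as a witness is borrowed from `hII`.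
    have hopen2 : IsOpen (U ∩ {x | riemann (ksMetric H k) x = 0}) := by
      rw [isOpen_iff_mem_nhds]
      rintro x₀ ⟨hx, hx0⟩
      have h3 : AlignedUpTo (ksMetric H k x₀) (riemann (ksMetric H k) x₀) (-1) := by
        obtain ⟨e, he, -⟩ := hII x₀ hx
        refine ⟨e, he, fun p q r s _ => ?_⟩
        rw [show riemann (ksMetric H k) x₀ = 0 from hx0]
        simp [frameComp]
      exact inter_mem (hUo.mem_nhds hx) (hflat x₀ hx h3)
    intro x₀ hx hx0
    obtain ⟨y, hy, hy0⟩ := hnonflat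
    obtain ⟨z, hz, hz1, hz2⟩ := hUc.isPreconnected _ _ hopen1 hopen2 (fun x hx => by
      by_cases h0 : riemann (ksMetric H k) x = 0
      · exact Or.inr ⟨hx, h0⟩
      · exact Or.inl ⟨hx, h0⟩) ⟨y, hy, hy, hy0⟩ ⟨x₀, hx, hx, hx0⟩
    exact hz1.2 hz2.2
  intro x hx
  rw [weyl_eq_riemann (hvac x hx)]
  have hprin : IsPrincipalTypeII (ksMetric H k x) (riemann (ksMetric H k) x) :=
    ⟨hII x hx, fun h3 => hne x hx (hflat x hx h3).self_of_nhds⟩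
  by_cases hD : IsTypeD (ksMetric H k x) (riemann (ksMetric H k) x)
  · exact Or.inr hD
  · exact Or.inl ⟨hprin, hD⟩
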